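/- Let $\mathbf w=(w_k)_{k\ge0}$ be a sequence of non-negative real numbers with $w_0>0$ and $\omega:=\sup\{k:w_k>0\}=\infty$. Let $\Phi(t)=\sum_k w_kt^k$, let $\rho\in[0,\infty]$ be its radius of convergence, and let $\Psi(t)=\sum_k kw_kt^k/\sum_k w_kt^k$ for $0\le t\le\rho$ with $\Phi(t)<\infty$; if $\Phi(\rho)=\infty$, let $\Psi(\rho)=\lim_{t\uparrow\rho}\Psi(t)$. Let $\nu=\Psi(\rho)\in[0,\infty]$. For $m\ge0$ and $n\ge1$ let $Z(m,n)=\sum\prod_{i=1}^n w_{y_i}$, the sum over all $(y_1,\dots,y_n)\in\mathbb Z_{\ge0}^n$ with $y_1+\dots+y_n=m$; if $Z(m,n)>0$, let $B_{m,n}=(Y_1,\dots,Y_n)$ be the random allocation of $m$ balls in $n$ boxes with $P(B_{m,n}=(y_1,\dots,y_n))=\prod_i w_{y_i}/Z(m,n)$ for these $(y_1,\dots,y_n)$. Write $Y_{(1)}\ge Y_{(2)}\ge\dots\ge Y_{(n)}$ for $Y_1,\dots,Y_n$ in decreasing order, and $N_A=|\{i\le n:Y_i\in A\}|$. For random variables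 $X,X'$ in $\mathbb Z_{\ge0}$ let $$d_K(X,X')=\sup_{x\in\mathbb Z_{\ge0}}|P(X\le x)-P(X'\le x)|,\qquad \tilde d_K(X,X')=\sup_{x\in\mathbb Z_{\ge0}}\frac{|P(X\le x)-P(X'\le x)|}{1+x},$$ $$d_{TV}(X,X')=\sup_{A\subseteq\mathbb Z_{\ge0}}|P(X\in A)-P(X'\in A)|,$$ and let $\mathrm{Po}(\infty)$ be the point mass at $\infty$. Let $n\to\infty$, possibly only through a given set $S$ of positive integers, and let $m=m(n)$ be such that $Z(m(n),n)>0$ for these $n$. Let $0<\lambda<\infty$ with $\lambda\le\nu$. There is a unique $\tau\in[0,\rho]$ with $\Psi(\tau)=\lambda$, and $P(\xi=k)=w_k\tau^k/\Phi(\tau)$, $k\ge0$, defines a probability distribution. Let $\xi_1,\dots,\xi_n$ be i.i.d. copies of $\xi$, let $\xi_{(1)}\ge\dots\ge\xi_{(n)}$ be these in decreasing order, and let $\bar N_A=|\{i\le n:\xi_i\in A\}|$. If $\lambda<\nu$, then $\operatorname{Var}\xi<\infty$. Suppose that $\operatorname{Var}\xi<\infty$ and $m=\lambda n+o(\sqrt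 n)$. Then the following hold. (i) If, possibly only for $n$ in a subsequence, $h(n)$ are integers with $nP(\xi\ge h(n))\to\alpha\in[0,\infty]$, then, along the same $n$, $N_{[h(n),\infty)}\to\mathrm{Po}(\alpha)$ in distribution, as random variables in $\{0,1,\dots,\infty\}$. (ii) If $h(n)$ are integers with $nP(\xi\ge h(n))\to0$, then $P(Y_{(1)}<h(n))\to1$. (iii) If $h(n)$ are integers with $nP(\xi\ge h(n))\to\infty$, then $P(Y_{(j)}\ge h(n))\to1$ for every fixed $j\ge1$. (iv) For every real sequence $h(n)$, $\tilde d_K(N_{[h(n),\infty)},\bar N_{[h(n),\infty)})\to0$. (v) For every fixed $j\ge1$, $d_K(Y_{(j)},\xi_{(j)})\to0$. (vi) $d_{TV}(Y_{(1)},\xi_{(1)})\to0$. If $\lambda<\nu$, then (i)–(vi) also hold when the condition $m=\lambda n+o(\sqrt n)$ is replaced by $m/n=\lambda+o(1/\log n)$. Moreover, if $\lambda<\nu$ and only $m/n\to\lambda$, then for all large $n$ there is a unique $\tau_n\in[0,\rho]$ with $\Psi(\tau_n)=m/n$, and $P(\xi^{(n)}=k)=w_k\tau_n^k/\Phi(\tau_n)$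 defines a probability distribution; and (i)–(vi) hold with $\xi$ replaced by $\xi^{(n)}$ and $\xi_1,\dots,\xi_n$ (in the definitions of $\bar N_A$ and $\xi_{(j)}$) replaced by i.i.d. copies of $\xi^{(n)}$. -/

import Mathlib

open Filter Topology MeasureTheory ProbabilityTheory Asymptotics
open scoped ENNReal NNReal

noncomputable section

namespace BallsInBoxes

/-! ### Parameters of a weight sequence `w = (w_k)_{k ≥ 0}` of non-negative reals -/

/-- `ω = sup {k : w_k > 0} ≤ ∞`. -/
def omega (w : ℕ → ℝ≥0) : ℕ∞ := ⨆ k ∈ {k : ℕ | 0 < w k}, (k : ℕ∞)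

/-- The generating function `Φ(t) = ∑ w_k t^k`, for `t ∈ [0, ∞]`, with values in `[0, ∞]`. -/
def Phi (w : ℕ → ℝ≥0) (t : ℝ≥0∞) : ℝ≥0∞ := ∑' k : ℕ, (w k : ℝ≥0∞) * t ^ k

/-- The radius of convergence `ρ ∈ [0, ∞]` of the power series `∑ w_k z^k`. -/
def rho (w : ℕ → ℝ≥0) : ℝ≥0∞ :=
  (FormalMultilinearSeries.ofScalars ℝ (fun k => (w k : ℝ))).radius

/-- The quotient `∑ k w_k t^k / ∑ w_k t^k`, meaningful when `Φ(t) < ∞`. -/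
def psiRatio (w : ℕ → ℝ≥0) (t : ℝ≥0∞) : ℝ≥0∞ :=
  (∑' k : ℕ, (k : ℝ≥0∞) * (w k : ℝ≥0∞) * t ^ k) / Phi w t

open Classical in
/-- The function `Ψ` on `[0, ρ]`: it is `t Φ'(t) / Φ(t) = ∑ k w_k t^k / ∑ w_k t^k` where
`Φ(t) < ∞`, and if `Φ(ρ) = ∞` then `Ψ(ρ)` is the limit of `Ψ(s)` as `s ↑ ρ`.
Only arguments `t ≤ ρ` are ever used. -/
def Psi (w : ℕ → ℝ≥0) (t : ℝ≥0∞) : ℝ≥0∞ :=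
  if Phi w t = ⊤ then limUnder (𝓝[<] t) (psiRatio w) else psiRatio w t

/-- `ν = Ψ(ρ)`. -/
def nu (w : ℕ → ℝ≥0) : ℝ≥0∞ := Psi w (rho w)

/-- `τ(x) = sup {t ≤ ρ : Ψ(t) ≤ x}`; for `x ≤ ν` this is the unique `t ∈ [0, ρ]` with
`Ψ(t) = x`. -/
def tau (w : ℕ → ℝ≥0) (x : ℝ≥0∞) : ℝ≥0∞ := sSup {t : ℝ≥0∞ | t ≤ rho w ∧ Psi w t ≤ x}

/-- The distribution on `ℕ` giving mass `w_k t^k / Φ(t)` to each `k`. -/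
def tiltedLaw (w : ℕ → ℝ≥0) (t : ℝ≥0∞) : Measure ℕ :=
  Measure.sum fun k : ℕ => ((w k : ℝ≥0∞) * t ^ k / Phi w t) • Measure.dirac k

/-! ### The random allocation -/

/-- The partition function `Z(m, n)`: the sum of the weights `∏ w_{y_i}` over all allocations
`(y_1, …, y_n)` of `m` balls in `n` boxes. -/
def partitionFn (w : ℕ → ℝ≥0) (m n : ℕ) : ℝ≥0 :=
  ∑ y ∈ Finset.Nat.antidiagonalTuple n m, ∏ i, w (y i)

/-- The law of the random allocation `B_{m,n} = (Y_1, …, Y_n)`: each allocation `y` of `m` balls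
in `n` boxes has probability `∏ w_{y_i} / Z(m, n)`. Meaningful when `Z(m, n) > 0`. -/
def allocLaw (w : ℕ → ℝ≥0) (m n : ℕ) : Measure (Fin n → ℕ) :=
  ∑ y ∈ Finset.Nat.antidiagonalTuple n m,
    ((∏ i, w (y i)) / partitionFn w m n) • Measure.dirac y

/-- The joint law of `n` i.i.d. random variables with law `μ`. -/
def iidLaw (μ : Measure ℕ) (n : ℕ) : Measure (Fin n → ℕ) := Measure.pi fun _ => μ

/-- The `j`-th largest of `y_1, …, y_n`, for `1 ≤ j ≤ n` (and `0` for other `j`).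
`Tuple.sort y` arranges the values in increasing order, at positions `0, …, n - 1`. -/
def jthLargest {n : ℕ} (j : ℕ) (y : Fin n → ℕ) : ℕ :=
  if h : 1 ≤ j ∧ j ≤ n then y (Tuple.sort y ⟨n - j, by omega⟩) else 0

/-- The number of indices `i` with `y_i ∈ A`. -/
def countIn {n : ℕ} (A : Set ℕ) (y : Fin n → ℕ) : ℕ := {i : Fin n | y i ∈ A}.ncard

/-! ### Distances and limits -/

/-- The Kolmogorov distance of two distributions on `ℕ`. -/
def dK (μ μ' : Measure ℕ) : ℝ :=
  ⨆ x : ℕ, |μ.real {k | k ≤ x} - μ'.real {k | k ≤ x}|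

/-- The modified Kolmogorov distance of two distributions on `ℕ`. -/
def dKmod (μ μ' : Measure ℕ) : ℝ :=
  ⨆ x : ℕ, |μ.real {k | k ≤ x} - μ'.real {k | k ≤ x}| / (1 + (x : ℝ))

/-- The total variation distance of two distributions on `ℕ`. -/
def dTV (μ μ' : Measure ℕ) : ℝ := ⨆ A : Set ℕ, |μ.real A - μ'.real A|

open Classical in
/-- The Poisson distribution `Po(α)`, `α ∈ [0, ∞]`, as a distribution on `{0, 1, …, ∞}`; `Po(∞)`
is the point mass at `∞`. -/
def poissonExt (α : ℝ≥0∞) : Measure ℕ∞ :=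
  if α = ⊤ then Measure.dirac ⊤ else (poissonMeasure α.toNNReal).map (fun k : ℕ => (k : ℕ∞))

instance (w : ℕ → ℝ≥0) (m n : ℕ) : IsFiniteMeasure (allocLaw w m n) := by
  unfold allocLaw; infer_instance

instance (α : ℝ≥0∞) : IsFiniteMeasure (poissonExt α) := by
  unfold poissonExt; split_ifs <;> infer_instance

instance : OpensMeasurableSpace ℕ∞ := ⟨fun _ _ => MeasurableSpace.measurableSet_top⟩

/-- The law, on `{0, 1, …, ∞}`, of the number `N_A` of boxes of `B_{m,n}` whose number of balls
is in `A`. -/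
def boxCountLaw (w : ℕ → ℝ≥0) (m n : ℕ) (A : Set ℕ) : FiniteMeasure ℕ∞ :=
  ⟨(allocLaw w m n).map (fun y => (countIn A y : ℕ∞)), inferInstance⟩

/-- Let `n → ∞` in the set `S`, let `m = m(n)`, and let `μ n` be a distribution on `ℕ`.
This is the list of properties expressing that the largest boxes of `B_{m,n}` behave as the largest
of `n` i.i.d. random variables with law `μ n`. -/
structure LargestBoxesLikeIID (w : ℕ → ℝ≥0) (m : ℕ → ℕ) (S : Set ℕ) (μ : ℕ → Measure ℕ) :
    Prop where
  /-- If, along some subset `T` of `S`, `n P(ξ ≥ h(n)) → α ∈ [0, ∞]`, then the number of boxes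
  with at least `h(n)` balls converges in distribution (weakly, as a random element of
  `{0, 1, …, ∞}`) to `Po(α)`, along `T`. -/
  count_tendsto : ∀ T ⊆ S, ∀ (h : ℕ → ℤ) (α : ℝ≥0∞),
    Tendsto (fun n : ℕ => (n : ℝ≥0∞) * μ n {k : ℕ | h n ≤ (k : ℤ)}) (atTop ⊓ 𝓟 T) (𝓝 α) →
    Tendsto (fun n : ℕ => boxCountLaw w (m n) n {k : ℕ | h n ≤ (k : ℤ)}) (atTop ⊓ 𝓟 T)
      (𝓝 (⟨poissonExt α, inferInstance⟩ : FiniteMeasure ℕ∞))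
  /-- If `n P(ξ ≥ h(n)) → 0`, then `Y_(1) < h(n)` with probability tending to 1. -/
  max_lt : ∀ h : ℕ → ℤ,
    Tendsto (fun n : ℕ => (n : ℝ≥0∞) * μ n {k : ℕ | h n ≤ (k : ℤ)}) (atTop ⊓ 𝓟 S) (𝓝 0) →
    Tendsto (fun n : ℕ => allocLaw w (m n) n {y | (jthLargest 1 y : ℤ) < h n}) (atTop ⊓ 𝓟 S) (𝓝 1)
  /-- If `n P(ξ ≥ h(n)) → ∞`, then, for every fixed `j ≥ 1`, `Y_(j) ≥ h(n)` with probability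
  tending to 1. -/
  le_jth : ∀ h : ℕ → ℤ,
    Tendsto (fun n : ℕ => (n : ℝ≥0∞) * μ n {k : ℕ | h n ≤ (k : ℤ)}) (atTop ⊓ 𝓟 S) (𝓝 ⊤) →
    ∀ j : ℕ, 1 ≤ j →
    Tendsto (fun n : ℕ => allocLaw w (m n) n {y | h n ≤ (jthLargest j y : ℤ)}) (atTop ⊓ 𝓟 S) (𝓝 1)
  /-- For any real sequence `h(n)`, the number of boxes with at least `h(n)` balls is close, in the
  modified Kolmogorov distance, to the number of i.i.d. variables that are at least `h(n)`. -/
  dKmod_count : ∀ h : ℕ → ℝ,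
    Tendsto (fun n : ℕ => dKmod
        ((allocLaw w (m n) n).map (countIn {k : ℕ | h n ≤ (k : ℝ)}))
        ((iidLaw (μ n) n).map (countIn {k : ℕ | h n ≤ (k : ℝ)})))
      (atTop ⊓ 𝓟 S) (𝓝 0)
  /-- For every fixed `j ≥ 1`, the Kolmogorov distance of `Y_(j)` and `ξ_(j)` tends to 0. -/
  dK_jth : ∀ j : ℕ, 1 ≤ j →
    Tendsto (fun n : ℕ => dK ((allocLaw w (m n) n).map (jthLargest j))
      ((iidLaw (μ n) n).map (jthLargest j))) (atTop ⊓ 𝓟 S) (𝓝 0)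
  /-- The total variation distance of `Y_(1)` and `ξ_(1)` tends to 0. -/
  dTV_max :
    Tendsto (fun n : ℕ => dTV ((allocLaw w (m n) n).map (jthLargest 1))
      ((iidLaw (μ n) n).map (jthLargest 1))) (atTop ⊓ 𝓟 S) (𝓝 0)

end BallsInBoxes

end

open BallsInBoxes

noncomputable section

namespace BallsInBoxes

/-! For every tilting parameter, `B_{m,n}` is a vector of i.i.d. variables `ξ_i` conditioned on `ξ_1
+ ⋯ + ξ_n = m` (`allocLaw_real_eq`). Conditioning on the sum hardly affects a few boxes. If `k`
boxes hold `s` balls in total, their joint probability is multiplied by `P(S_{n-k} = m - s) / P(S_n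
= m)`, and this factor is `1 + O((s + k) / √n)`. The proof is Fourier inversion on the lattice `dℕ`
spanned by the support. A Gaussian bound on the characteristic functions, uniform in `n`
(`exists_norm_latticeChar_le_exp`), makes the two local probabilities differ by `O((s + k) / n)`
when `k ≤ n / 2` (`norm_locProb_sub_le`), while `P(S_n = m)` is at least a constant times `1 / √n`
because `m` is within `o(√n)` of the mean (`DominatedLaws.exists_le_norm_locProb`).

The central notion is `ConfigurationsClose`: uniformly over sets `B` of boxes and sets `A` of values
with `|B| P(ξ ∈ A) ≤ C`, an event depending only on the boxes of `B` with contents in `A`, and on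
these contents, has nearly the same probability in both models. Möbius inversion writes its
indicator as a sum over `I ⊆ B` of functions of `(y_i)_{i ∈ I}` supported where all these `y_i` lie
in `A`. The errors of the summands add up to `O(|B| E[ξ + 1; ξ ∈ A] / √n)`, which is `o(1)` by
truncation at `η√n` and the finite second moment (`DominatedLaws.configurationsClose`).

If `n P(ξ ∈ A)` is bounded, this applies to all boxes. If it is large, it applies to a subset `B`
with `|B| P(ξ ∈ A)` of a suitable constant order, which already makes `N_A ≥ j` likely in both
models. Hence `P(N_A < j)` agrees asymptotically, uniformly in `A`
(`ConfigurationsClose.eventually_abs_sub_le`). Since `Y_(j) < h` means `N_{[h,∞)} < j`, the binomial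
law of the i.i.d. counts and its Poisson limit give the claims on counts and order statistics; total
variation for the maximum needs a further splitting of its range.

It remains to supply tilted laws. With finite variance and `m = λn + o(√n)` the fixed parameter `τ`
works. If only `m / n → λ < ν`, the parameter `τ_n` gives mean exactly `m / n`, and `τ_n → τ < ρ`
yields a common dominating sequence. If `m / n = λ + o(1 / log n)`, then `log τ_n - log τ = o(1 /
log n)`; apart from an event of probability `o(1 / n)`, `ξ` is `O(log n)`, so the likelihood ratio
is `1 + o(1)` and `τ_n` may be replaced by `τ` (`ConfigurationsClose.tiltedLaw_limit`). Existence
and uniqueness of `τ` come from strict monotonicity of `Ψ`, the intermediate value theorem and the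
behaviour at `ρ`, where `Φ(ρ) = ∞` forces `Ψ(ρ) = ∞` because `ω = ∞`. -/

/-! ### Local probabilities by Fourier inversion -/

/-- The character `e^{iθ}`. -/
def unitExp (θ : ℝ) : ℂ := Complex.exp (Complex.I * θ)

lemma unitExp_add (a b : ℝ) : unitExp (a + b) = unitExp a * unitExp b := by
  simp [unitExp, mul_add, Complex.exp_add]

lemma norm_unitExp (θ : ℝ) : ‖unitExp θ‖ = 1 := by
  simp [unitExp, mul_comm Complex.I, Complex.norm_exp_ofReal_mul_I]

lemma unitExp_zero : unitExp 0 = 1 := by simp [unitExp]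

lemma continuous_unitExp : Continuous unitExp := by unfold unitExp; fun_prop

lemma unitExp_sum {ι : Type*} (s : Finset ι) (f : ι → ℝ) :
    unitExp (∑ i ∈ s, f i) = ∏ i ∈ s, unitExp (f i) := by
  simp [unitExp, Finset.mul_sum, Complex.exp_sum]

lemma norm_unitExp_sub_one_le (θ : ℝ) : ‖unitExp θ - 1‖ ≤ |θ| :=
  Real.norm_exp_I_mul_ofReal_sub_one_le

lemma norm_unitExp_add_sub_one_le (a b : ℝ) :
    ‖unitExp (a + b) - 1‖ ≤ ‖unitExp a - 1‖ + ‖unitExp b - 1‖ := by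
  have : unitExp (a + b) - 1 = unitExp a * (unitExp b - 1) + (unitExp a - 1) := by
    rw [unitExp_add]; ring
  rw [this]
  refine (norm_add_le _ _).trans ?_
  rw [norm_mul, norm_unitExp, one_mul, add_comm]

lemma norm_unitExp_neg_sub_one (a : ℝ) : ‖unitExp (-a) - 1‖ = ‖unitExp a - 1‖ := by
  have h : unitExp (-a) - 1 = -(unitExp (-a) * (unitExp a - 1)) := by
    rw [mul_sub, ← unitExp_add]; simp [unitExp_zero]
  rw [h, norm_neg, norm_mul, norm_unitExp, one_mul]

/-- The characteristic function of a law on `ℕ`, in the variable scaled by `1 / d`. -/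
def latticeChar (d : ℕ) (μ : Measure ℕ) (t : ℝ) : ℂ := ∫ k : ℕ, unitExp (t * (k / d)) ∂μ

/-- The Fourier integral for `P(ξ_1 + ⋯ + ξ_j = s)`, with `ξ_i` i.i.d. of law `μ` on `d ℕ`. -/
def locProb (d : ℕ) (μ : Measure ℕ) (j : ℕ) (s : ℤ) : ℂ :=
  (2 * Real.pi : ℝ)⁻¹ • ∫ t in (-Real.pi)..Real.pi,
    latticeChar d μ t ^ j * unitExp (-(t * (s / d)))

lemma integrable_unitExp (μ : Measure ℕ) [IsFiniteMeasure μ] (f : ℕ → ℝ) :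
    Integrable (fun k => unitExp (f k)) μ :=
  Integrable.of_bound Measurable.of_discrete.aestronglyMeasurable 1 (by simp [norm_unitExp])

lemma continuous_latticeChar (d : ℕ) (μ : Measure ℕ) [IsFiniteMeasure μ] :
    Continuous (latticeChar d μ) := by
  unfold latticeChar
  refine continuous_of_dominated (F := fun (t : ℝ) (k : ℕ) => unitExp (t * (k / d)))
    (bound := fun _ => 1) ?_ ?_ ?_ ?_
  · intro t; exact Measurable.of_discrete.aestronglyMeasurable
  · intro t; simp [norm_unitExp]
  · exact integrable_const _
  · exact Eventually.of_forall fun k => continuous_unitExp.comp (by fun_prop)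

lemma norm_latticeChar_le_one (d : ℕ) (μ : Measure ℕ) [IsProbabilityMeasure μ] (t : ℝ) :
    ‖latticeChar d μ t‖ ≤ 1 := by
  refine (norm_integral_le_integral_norm _).trans ?_
  simp [norm_unitExp]

lemma integral_unitExp_int (z : ℤ) :
    ∫ t in (-Real.pi)..Real.pi, unitExp (t * z) = if z = 0 then ((2 * Real.pi : ℝ) : ℂ) else 0 := by
  split_ifs with h
  · subst h
    simp only [Int.cast_zero, mul_zero, unitExp_zero, intervalIntegral.integral_const]
    simp; ring
  · have hc : (Complex.I * z : ℂ) ≠ 0 := by simp [h]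
    have := integral_exp_mul_complex (a := -Real.pi) (b := Real.pi) hc
    have e : ∀ t : ℝ, unitExp (t * z) = Complex.exp (Complex.I * z * t) := by
      intro t; simp only [unitExp]; push_cast; ring_nf
    simp_rw [e, this]
    have : Complex.exp (Complex.I * z * ((-Real.pi : ℝ) : ℂ)) =
        Complex.exp (Complex.I * z * (Real.pi : ℂ)) := by
      rw [Complex.exp_eq_exp_iff_exists_int]
      exact ⟨-z, by push_cast; ring⟩
    rw [this, sub_self, zero_div]

lemma latticeChar_pow (d : ℕ) (μ : Measure ℕ) [IsProbabilityMeasure μ] {ι : Type*} [Fintype ι]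
    (t : ℝ) : latticeChar d μ t ^ Fintype.card ι =
      ∫ y : ι → ℕ, unitExp (t * ((∑ i, (y i : ℝ)) / d)) ∂(Measure.pi fun _ => μ) := by
  unfold latticeChar
  rw [← integral_fintype_prod_eq_pow]
  congr 1; ext y
  rw [← unitExp_sum, Finset.sum_div, Finset.mul_sum]

lemma ae_pi_forall {ι : Type*} [Fintype ι] (μ : Measure ℕ) [IsProbabilityMeasure μ]
    {P : ℕ → Prop} (h : ∀ᵐ k ∂μ, P k) : ∀ᵐ y ∂(Measure.pi fun _ : ι => μ), ∀ i, P (y i) :=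
  ae_all_iff.2 fun i =>
    (Measure.quasiMeasurePreserving_eval (fun _ : ι => μ) i).ae h

/-- Orthogonality of characters on `[-π, π]`: the variables and `s` all lie in `dℤ`, so the rescaled
difference is almost surely an integer, and Fubini exchanges the Fourier integral with the
expectation. The index type is arbitrary so that the formula also serves for the boxes outside a
fixed set. -/
lemma measureReal_sum_eq_locProb {d : ℕ} (hd : 0 < d) (μ : Measure ℕ) [IsProbabilityMeasure μ]
    (hμ : ∀ᵐ k ∂μ, d ∣ k) {ι : Type*} [Fintype ι] {s : ℤ} (hs : (d : ℤ) ∣ s) :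
    (((Measure.pi fun _ : ι => μ).real {y | ∑ i, (y i : ℤ) = s} : ℝ) : ℂ) =
      locProb d μ (Fintype.card ι) s := by
  set π := Measure.pi fun _ : ι => μ
  have h1 : ∀ t : ℝ, latticeChar d μ t ^ Fintype.card ι * unitExp (-(t * (s / d))) =
      ∫ y : ι → ℕ, unitExp (t * ((∑ i, (y i : ℝ) - s) / d)) ∂π := by
    intro t
    rw [latticeChar_pow, ← integral_mul_const]
    congr 1; ext y
    rw [← unitExp_add]; ring_nf
  unfold locProb
  simp_rw [h1]
  rw [intervalIntegral_integral_swap]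
  · have h2 : (fun y : ι → ℕ => ∫ t in (-Real.pi)..Real.pi,
        unitExp (t * ((∑ i, (y i : ℝ) - s) / d))) =ᵐ[π]
        Set.indicator {y | ∑ i, (y i : ℤ) = s} (fun _ => ((2 * Real.pi : ℝ) : ℂ)) := by
      filter_upwards [ae_pi_forall (ι := ι) μ hμ] with y hy
      obtain ⟨z, hz⟩ : (d : ℤ) ∣ (∑ i, (y i : ℤ) - s) :=
        dvd_sub (Finset.dvd_sum fun i _ => by exact_mod_cast hy i) hs
      have hz' : ((∑ i, (y i : ℝ) - s) / d) = z := by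
        have : ((∑ i, (y i : ℤ) - s : ℤ) : ℝ) = ((d * z : ℤ) : ℝ) := by rw [hz]
        push_cast at this
        rw [this]; field_simp
      simp_rw [hz', integral_unitExp_int, Set.indicator_apply, Set.mem_ofPred_eq]
      have : z = 0 ↔ ∑ i, (y i : ℤ) = s := by
        rw [← sub_eq_zero (a := ∑ i, (y i : ℤ)), hz]; simp [hd.ne']
      simp only [this]
    rw [integral_congr_ae h2, integral_indicator_const _ (Set.to_countable _).measurableSet]
    simp only [Complex.real_smul]
    push_cast
    field_simp
  · have : IsFiniteMeasure (volume.restrict (Set.uIoc (-Real.pi) Real.pi)) :=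
      ⟨by simp [Set.uIoc]⟩
    refine Integrable.of_bound ?_ 1 (by simp [Function.uncurry, norm_unitExp])
    refine (Measurable.aestronglyMeasurable ?_)
    refine measurable_from_prod_countable_left fun y => ?_
    exact (continuous_unitExp.comp (by fun_prop)).measurable

/-! ### Decay of characteristic functions -/

/-- The function `z ↦ |e^{iθz} - 1|` is even and subadditive, so it is controlled on a subgroup by
its values at generators, with `K` and `C` independent of `θ`. -/
lemma exists_norm_unitExp_le_of_mem_closure {s : Set ℕ} {z : ℤ}
    (hz : z ∈ AddSubgroup.closure ((fun k : ℕ => (k : ℤ)) '' s)) :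
    ∃ K : Finset ℕ, (↑K ⊆ s) ∧ ∃ C : ℝ, 0 ≤ C ∧
      ∀ θ : ℝ, ‖unitExp (θ * z) - 1‖ ≤ C * ∑ k ∈ K, ‖unitExp (θ * k) - 1‖ := by
  classical
  induction hz using AddSubgroup.closure_induction with
  | mem x hx =>
    obtain ⟨k, hk, rfl⟩ := hx
    exact ⟨{k}, by simpa using hk, 1, zero_le_one, fun θ => by simp⟩
  | zero => exact ⟨∅, by simp, 0, le_rfl, fun θ => by simp [unitExp_zero]⟩
  | add x y _ _ hx hy =>
    obtain ⟨K, hK, C, hC, h⟩ := hx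
    obtain ⟨K', hK', C', hC', h'⟩ := hy
    refine ⟨K ∪ K', by simp [hK, hK'], C + C', by positivity, fun θ => ?_⟩
    have e : θ * ((x + y : ℤ) : ℝ) = θ * x + θ * y := by push_cast; ring
    rw [e, add_mul]
    refine (norm_unitExp_add_sub_one_le _ _).trans (add_le_add ((h θ).trans ?_) ((h' θ).trans ?_))
    · gcongr; exact Finset.subset_union_left
    · gcongr; exact Finset.subset_union_right
  | neg x _ hx =>
    obtain ⟨K, hK, C, hC, h⟩ := hx
    refine ⟨K, hK, C, hC, fun θ => ?_⟩
    have e : θ * ((-x : ℤ) : ℝ) = -(θ * x) := by push_cast; ring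
    rw [e, norm_unitExp_neg_sub_one]
    exact h θ

/-- Here `d` is the gcd of `s`, and the inequality is quantitative aperiodicity: if `e^{itk/d}` is
near `1` for all `k ∈ K`, so is `e^{it}`. Finiteness of `K` allows uniform use along a sequence of
laws, where only finitely many masses can be kept away from zero. -/
lemma exists_lattice_span {s : Set ℕ} {k₀ : ℕ} (hk₀ : k₀ ∈ s) (h0 : k₀ ≠ 0) :
    ∃ d : ℕ, 0 < d ∧ (∀ k ∈ s, d ∣ k) ∧ ∃ K : Finset ℕ, (↑K ⊆ s) ∧ ∃ C : ℝ, 0 < C ∧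
      ∀ t : ℝ, ‖unitExp t - 1‖ ≤ C * ∑ k ∈ K, ‖unitExp (t * (k / d)) - 1‖ := by
  obtain ⟨a, ha⟩ := Int.subgroup_cyclic (AddSubgroup.closure ((fun k : ℕ => (k : ℤ)) '' s))
  have hdvd : ∀ k ∈ s, a.natAbs ∣ k := by
    intro k hk
    have : (k : ℤ) ∈ AddSubgroup.closure ((fun k : ℕ => (k : ℤ)) '' s) :=
      AddSubgroup.subset_closure ⟨k, hk, rfl⟩
    rw [ha, AddSubgroup.mem_closure_singleton] at this
    obtain ⟨n, hn⟩ := this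
    rw [← Int.natCast_dvd_natCast, Int.natAbs_dvd]
    exact ⟨n, by rw [← hn, smul_eq_mul, mul_comm]⟩
  have hpos : 0 < a.natAbs := Nat.pos_of_dvd_of_pos (hdvd k₀ hk₀) (Nat.pos_of_ne_zero h0)
  have hmem : (a.natAbs : ℤ) ∈ AddSubgroup.closure ((fun k : ℕ => (k : ℤ)) '' s) := by
    rw [ha, AddSubgroup.mem_closure_singleton]
    rcases Int.natAbs_eq a with h | h
    · exact ⟨1, by rw [one_smul]; exact h⟩
    · exact ⟨-1, by rw [neg_smul, one_smul]; omega⟩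
  obtain ⟨K, hK, C, hC, h⟩ := exists_norm_unitExp_le_of_mem_closure hmem
  refine ⟨a.natAbs, hpos, hdvd, K, hK, C + 1, by positivity, fun t => ?_⟩
  have h1 := h (t / a.natAbs)
  have hp : (a.natAbs : ℝ) ≠ 0 := by exact_mod_cast hpos.ne'
  have e : t / (a.natAbs : ℝ) * ((a.natAbs : ℤ) : ℝ) = t := by
    rw [Int.cast_natCast]; field_simp
  rw [e] at h1
  refine h1.trans ?_
  have e2 : ∀ k : ℕ, t / (a.natAbs : ℝ) * k = t * (k / a.natAbs) := fun k => by ring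
  simp_rw [e2]
  gcongr
  linarith

/-- The square of the left side is `(p + q)² - pq|e^{iθ} - 1|²`, and `p + q ≤ 1` makes the square of
the right side at least as large. -/
lemma norm_add_mul_unitExp_le {p q : ℝ} (hp : 0 ≤ p) (hq : 0 ≤ q) (hpq : p + q ≤ 1) (θ : ℝ) :
    ‖(p : ℂ) + q * unitExp θ‖ ≤ p + q - p * q * ‖unitExp θ - 1‖ ^ 2 / 2 := by
  have hx : ‖unitExp θ - 1‖ ≤ 2 := by
    refine (norm_sub_le _ _).trans ?_
    rw [norm_unitExp]; norm_num
  have hx0 := norm_nonneg (unitExp θ - 1)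
  have hre : ‖unitExp θ - 1‖ ^ 2 = 2 - 2 * (unitExp θ).re := by
    have h1 := norm_unitExp θ
    rw [Complex.norm_eq_one_iff'] at h1
    obtain ⟨φ, -, hφ⟩ := h1
    rw [← hφ, ← Complex.normSq_eq_norm_sq, Complex.normSq_apply]
    simp [Complex.exp_re, Complex.exp_im]
    nlinarith [Real.sin_sq_add_cos_sq φ]
  have hsq : ‖(p : ℂ) + q * unitExp θ‖ ^ 2 = (p + q) ^ 2 - p * q * ‖unitExp θ - 1‖ ^ 2 := by
    rw [hre]
    have h1 := norm_unitExp θ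
    have h2 : ‖unitExp θ‖ ^ 2 = 1 := by rw [h1]; norm_num
    rw [← Complex.normSq_eq_norm_sq, Complex.normSq_apply] at h2 ⊢
    simp
    linear_combination q ^ 2 * h2
  set x := ‖unitExp θ - 1‖
  have hx2 : x ^ 2 ≤ 4 := by nlinarith
  have hpq0 : 0 ≤ p * q := mul_nonneg hp hq
  refine abs_le_of_sq_le_sq' ?_ ?_ |>.2
  · rw [hsq]
    have : 0 ≤ p * q * x ^ 2 * (1 - (p + q)) := by
      have : 0 ≤ 1 - (p + q) := by linarith
      positivity
    nlinarith [sq_nonneg (p * q * x ^ 2)]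
  · nlinarith [mul_le_mul_of_nonneg_left hx2 hpq0, sq_nonneg (p - q)]

/-- Cancellation between the atoms at `0` and `k` gives the gain; the rest of the integral is
bounded by its mass. -/
lemma norm_latticeChar_le (d : ℕ) (μ : Measure ℕ) [IsProbabilityMeasure μ] {k : ℕ} (hk : k ≠ 0)
    (t : ℝ) : ‖latticeChar d μ t‖ ≤
      1 - μ.real {0} * μ.real {k} * ‖unitExp (t * (k / d)) - 1‖ ^ 2 / 2 := by
  have hms : ∀ A : Set ℕ, MeasurableSet A := fun A => A.to_countable.measurableSet
  have hint := integrable_unitExp μ (fun k : ℕ => t * (k / d))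
  have h1 : latticeChar d μ t = ((μ.real {0} : ℝ) : ℂ) + μ.real {k} * unitExp (t * (k / d))
      + ∫ k in ({0, k} : Set ℕ)ᶜ, unitExp (t * (k / d)) ∂μ := by
    unfold latticeChar
    rw [← integral_add_compl (hms {0, k}) hint]
    congr 1
    rw [Set.insert_eq, setIntegral_union (by simpa using hk.symm) (hms _) hint.integrableOn
      hint.integrableOn, integral_singleton, integral_singleton]
    simp [unitExp_zero]
  have h2 : μ.real ({0, k} : Set ℕ)ᶜ = 1 - μ.real {0} - μ.real {k} := by
    rw [probReal_compl_eq_one_sub (hms _), Set.insert_eq,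
      measureReal_union (by simpa using hk.symm) (hms _)]
    ring
  have h3 : ‖∫ k in ({0, k} : Set ℕ)ᶜ, unitExp (t * (k / d)) ∂μ‖ ≤ μ.real ({0, k} : Set ℕ)ᶜ := by
    refine (norm_setIntegral_le_of_norm_le_const (C := 1) (measure_lt_top _ _)
      (by simp [norm_unitExp])).trans ?_
    simp
  have h4 : 0 ≤ μ.real ({0, k} : Set ℕ)ᶜ := measureReal_nonneg
  have h5 := norm_add_mul_unitExp_le (p := μ.real {0}) (q := μ.real {k}) measureReal_nonneg
    measureReal_nonneg (by linarith) (t * (k / d))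
  rw [h1]
  refine (norm_add_le _ _).trans ?_
  linarith

lemma le_norm_unitExp_sub_one {t : ℝ} (ht : |t| ≤ Real.pi) :
    2 / Real.pi * |t| ≤ ‖unitExp t - 1‖ := by
  rw [unitExp, Complex.norm_exp_I_mul_ofReal_sub_one, Real.norm_eq_abs]
  have : |2 * Real.sin (t / 2)| = 2 * Real.sin (|t| / 2) := by
    rw [abs_mul, abs_two]
    rcases abs_cases t with ⟨h, h'⟩ | ⟨h, h'⟩
    · rw [h, abs_of_nonneg]
      exact Real.sin_nonneg_of_nonneg_of_le_pi (by linarith) (by linarith [Real.pi_pos])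
    · rw [h, ← abs_neg, ← Real.sin_neg, neg_div, abs_of_nonneg]
      exact Real.sin_nonneg_of_nonneg_of_le_pi (by linarith) (by linarith [Real.pi_pos])
  rw [this]
  have := Real.mul_le_sin (x := |t| / 2) (by positivity) (by linarith)
  linarith

/-- Since `|e^{it} - 1| ≥ 2|t|/π` for `|t| ≤ π`, some `k ∈ K` has `|e^{itk/d} - 1|` of order at
least `|t|`, and the atoms at `0` and this `k` lower the norm by a multiple of `t²`. The masses on
the finite set are bounded below uniformly in `n`, hence so is the rate `c`. -/
lemma exists_norm_latticeChar_le_exp {d : ℕ} {K : Finset ℕ} {C : ℝ} (hC : 0 < C)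
    (hK : ∀ t : ℝ, ‖unitExp t - 1‖ ≤ C * ∑ k ∈ K, ‖unitExp (t * (k / d)) - 1‖)
    {l : Filter ℕ} {μ : ℕ → Measure ℕ} (hprob : ∀ᶠ n in l, IsProbabilityMeasure (μ n))
    (hpos : ∀ k ∈ insert 0 K, ∃ c > 0, ∀ᶠ n in l, c ≤ (μ n).real {k}) :
    ∃ c > 0, ∀ᶠ n in l, ∀ t : ℝ, |t| ≤ Real.pi →
      ‖latticeChar d (μ n) t‖ ≤ Real.exp (-(c * t ^ 2)) := by
  obtain ⟨c₀, hc₀, hev⟩ : ∃ c > 0, ∀ᶠ n in l, ∀ k ∈ insert 0 K, c ≤ (μ n).real {k} := by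
    generalize insert 0 K = L at hpos
    induction L using Finset.induction_on with
    | empty => exact ⟨1, one_pos, by simp⟩
    | insert a L _ ih =>
      obtain ⟨c, hc, h⟩ := ih fun k hk => hpos k (Finset.mem_insert_of_mem hk)
      obtain ⟨c', hc', h'⟩ := hpos a (Finset.mem_insert_self _ _)
      refine ⟨min c c', lt_min hc hc', ?_⟩
      filter_upwards [h, h'] with n hn hn' k hk
      rcases Finset.mem_insert.1 hk with rfl | hk
      · exact (min_le_right _ _).trans hn'
      · exact (min_le_left _ _).trans (hn k hk)
  have hpi := Real.pi_pos
  -- The `+ 1` makes the pigeonhole inequality strict and covers an empty `K`.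
  set b : ℝ := 2 / Real.pi / (C * (K.card + 1)) with hb
  have hb0 : 0 < b := by positivity
  refine ⟨c₀ * c₀ * b ^ 2 / 2, by positivity, ?_⟩
  filter_upwards [hev, hprob] with n hn hn' t ht
  rcases eq_or_ne t 0 with rfl | ht0
  · simpa using norm_latticeChar_le_one d (μ n) 0
  have ht1 : 0 < |t| := abs_pos.2 ht0
  obtain ⟨k, hk, hbk⟩ : ∃ k ∈ K, b * |t| ≤ ‖unitExp (t * (k / d)) - 1‖ := by
    by_contra! hcon
    have h1 := (le_norm_unitExp_sub_one ht).trans (hK t)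
    have h2 : ∑ k ∈ K, ‖unitExp (t * (k / d)) - 1‖ ≤ ∑ k ∈ K, b * |t| :=
      Finset.sum_le_sum fun k hk => (hcon k hk).le
    rw [Finset.sum_const, nsmul_eq_mul] at h2
    have h3 : 2 / Real.pi * |t| ≤ C * (K.card * (b * |t|)) :=
      h1.trans (mul_le_mul_of_nonneg_left h2 hC.le)
    have h4 : 2 / Real.pi = b * (C * (K.card + 1)) :=
      (div_mul_cancel₀ _ (by positivity)).symm
    rw [h4] at h3
    have : 0 < b * C * |t| := mul_pos (mul_pos hb0 hC) ht1
    nlinarith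
  have hk0 : k ≠ 0 := by
    rintro rfl
    have : 0 < b * |t| := mul_pos hb0 ht1
    have h0 : ‖unitExp (t * ((0 : ℕ) / d)) - 1‖ = 0 := by
      rw [Nat.cast_zero, zero_div, mul_zero, unitExp_zero, sub_self, norm_zero]
    linarith
  refine (norm_latticeChar_le d (μ n) hk0 t).trans ?_
  have h1 : c₀ * c₀ * (b * |t|) ^ 2 ≤
      (μ n).real {0} * (μ n).real {k} * ‖unitExp (t * (k / d)) - 1‖ ^ 2 := by
    gcongr
    · exact hn 0 (Finset.mem_insert_self _ _)
    · exact hn k (Finset.mem_insert_of_mem hk)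
  have h2 := Real.add_one_le_exp (-(c₀ * c₀ * b ^ 2 / 2 * t ^ 2))
  rw [mul_pow, sq_abs] at h1
  linarith

/-! ### Smoothness of local probabilities -/

lemma integral_abs_mul_exp_neg_le {b : ℝ} (hb : 0 < b) {a : ℝ} (ha : 0 ≤ a) :
    ∫ t in (-a)..a, |t| * Real.exp (-(b * t ^ 2)) ≤ 1 / b := by
  have hc : Continuous fun t : ℝ => |t| * Real.exp (-(b * t ^ 2)) := by fun_prop
  have h1 : ∫ t in (0 : ℝ)..a, |t| * Real.exp (-(b * t ^ 2)) =
      (1 - Real.exp (-(b * a ^ 2))) / (2 * b) := by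
    have h2 : ∀ t ∈ Set.uIcc 0 a, HasDerivAt (fun t : ℝ => -Real.exp (-(b * t ^ 2)) / (2 * b))
        (|t| * Real.exp (-(b * t ^ 2))) t := by
      intro t ht
      rw [Set.uIcc_of_le ha] at ht
      rw [abs_of_nonneg ht.1]
      have h3 : HasDerivAt (fun t : ℝ => -(b * t ^ 2)) (-(b * (2 * t))) t := by
        simpa using ((hasDerivAt_pow 2 t).const_mul b).fun_neg
      convert! (h3.exp.neg.div_const (2 * b)) using 1
      field_simp
    rw [intervalIntegral.integral_eq_sub_of_hasDerivAt h2 (hc.intervalIntegrable _ _)]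
    simp
    ring
  have h4 : ∫ t in (-a)..0, |t| * Real.exp (-(b * t ^ 2)) =
      ∫ t in (0 : ℝ)..a, |t| * Real.exp (-(b * t ^ 2)) := by
    have := intervalIntegral.integral_comp_neg (a := 0) (b := a)
      (fun t : ℝ => |t| * Real.exp (-(b * t ^ 2)))
    simpa using this.symm
  rw [← intervalIntegral.integral_add_adjacent_intervals (b := 0) (hc.intervalIntegrable _ _)
    (hc.intervalIntegrable _ _), h4, h1]
  have := Real.exp_pos (-(b * a ^ 2))
  rw [← add_div, div_le_div_iff₀ (by positivity) hb]
  nlinarith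

lemma norm_latticeChar_sub_one_le (d : ℕ) (μ : Measure ℕ) [IsProbabilityMeasure μ]
    (hint : Integrable (fun k : ℕ => (k : ℝ)) μ) (t : ℝ) :
    ‖latticeChar d μ t - 1‖ ≤ |t| * ((∫ k : ℕ, (k : ℝ) ∂μ) / d) := by
  have : latticeChar d μ t - 1 = ∫ k : ℕ, (unitExp (t * (k / d)) - 1) ∂μ := by
    rw [integral_sub (integrable_unitExp _ _) (integrable_const _)]
    simp [latticeChar]
  rw [this, ← integral_div, ← integral_const_mul]
  refine norm_integral_le_of_norm_le ((hint.div_const _).const_mul _) (ae_of_all _ fun k => ?_)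
  refine (norm_unitExp_sub_one_le _).trans ?_
  rw [abs_mul, abs_of_nonneg (by positivity : (0 : ℝ) ≤ k / d)]

lemma norm_pow_sub_one_le {z : ℂ} (hz : ‖z‖ ≤ 1) (k : ℕ) : ‖z ^ k - 1‖ ≤ k * ‖z - 1‖ := by
  induction k with
  | zero => simp
  | succ k ih =>
    have : z ^ (k + 1) - 1 = z * (z ^ k - 1) + (z - 1) := by ring
    rw [this]
    refine (norm_add_le _ _).trans ?_
    rw [norm_mul]
    have := mul_le_mul hz ih (norm_nonneg _) zero_le_one
    push_cast
    linarith

/-- With `φ` the characteristic function and `M` the mean, both integrands contain `φ^j e^{-itm/d}`.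
The remaining factor `(e^{its/d} - 1) - (φ^k - 1)` is at most `(s + kM)|t|`, and `∫ |t| e^{-cjt²} ≤
1/(cj)`. The factor `|t|` is what gains `j^{-1/2}` over the usual size `j^{-1/2}` of a local
probability. -/
lemma norm_locProb_sub_le {d : ℕ} (hd : 0 < d) (μ : Measure ℕ) [IsProbabilityMeasure μ]
    (hint : Integrable (fun k : ℕ => (k : ℝ)) μ) {c : ℝ} (hc : 0 < c)
    (hdec : ∀ t : ℝ, |t| ≤ Real.pi → ‖latticeChar d μ t‖ ≤ Real.exp (-(c * t ^ 2)))
    {j : ℕ} (hj : 0 < j) (k s : ℕ) (m : ℤ) :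
    ‖locProb d μ j (m - s) - locProb d μ (j + k) m‖ ≤
      (s + k * ∫ k : ℕ, (k : ℝ) ∂μ) / (c * j) := by
  set M := ∫ k : ℕ, (k : ℝ) ∂μ with hM
  have hM0 : 0 ≤ M := integral_nonneg fun k => by positivity
  have hd1 : (1 : ℝ) ≤ d := by exact_mod_cast hd
  have hcont := continuous_latticeChar d μ
  have hj' : (0 : ℝ) < j := by exact_mod_cast hj
  have hcu : ∀ x : ℝ, Continuous fun t : ℝ => unitExp (-(t * x)) := fun x =>
    continuous_unitExp.comp (by fun_prop)
  have hI : ∀ (i : ℕ) (x : ℝ), IntervalIntegrable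
      (fun t => latticeChar d μ t ^ i * unitExp (-(t * x))) volume (-Real.pi) Real.pi :=
    fun i x => ((hcont.pow i).mul (hcu x)).intervalIntegrable _ _
  unfold locProb
  rw [← smul_sub, ← intervalIntegral.integral_sub (hI _ _) (hI _ _), norm_smul]
  have hpi := Real.pi_pos
  have hbound : ‖∫ t in (-Real.pi)..Real.pi,
      (latticeChar d μ t ^ j * unitExp (-(t * ((m - s : ℤ) / d))) -
        latticeChar d μ t ^ (j + k) * unitExp (-(t * (m / d))))‖ ≤
      ∫ t in (-Real.pi)..Real.pi, (s + k * M) * (|t| * Real.exp (-(c * j * t ^ 2))) := by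
    refine intervalIntegral.norm_integral_le_of_norm_le (by linarith) ?_ ?_
    · refine ae_of_all _ fun t ht => ?_
      have ht' : |t| ≤ Real.pi := abs_le.2 ⟨ht.1.le, ht.2⟩
      have e : latticeChar d μ t ^ j * unitExp (-(t * ((m - s : ℤ) / d))) -
          latticeChar d μ t ^ (j + k) * unitExp (-(t * (m / d))) =
          latticeChar d μ t ^ j * unitExp (-(t * (m / d))) *
            ((unitExp (t * (s / d)) - 1) - (latticeChar d μ t ^ k - 1)) := by
        have : -(t * ((m - s : ℤ) / d)) = -(t * (m / d)) + t * (s / d) := by push_cast; ring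
        rw [this, unitExp_add]; ring
      rw [e, norm_mul, norm_mul, norm_unitExp, mul_one, norm_pow]
      have h1 : ‖latticeChar d μ t‖ ^ j ≤ Real.exp (-(c * j * t ^ 2)) := by
        refine (pow_le_pow_left₀ (norm_nonneg _) (hdec t ht') j).trans (le_of_eq ?_)
        rw [← Real.exp_nat_mul]; ring_nf
      have h2 : ‖(unitExp (t * (s / d)) - 1) - (latticeChar d μ t ^ k - 1)‖ ≤
          (s + k * M) * |t| := by
        refine (norm_sub_le _ _).trans ?_
        have h3 : ‖unitExp (t * (s / d)) - 1‖ ≤ s * |t| := by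
          refine (norm_unitExp_sub_one_le _).trans ?_
          rw [abs_mul, abs_of_nonneg (by positivity : (0 : ℝ) ≤ s / d), mul_comm]
          gcongr
          exact div_le_self (by positivity) hd1
        have h4 : ‖latticeChar d μ t ^ k - 1‖ ≤ k * M * |t| := by
          refine (norm_pow_sub_one_le (norm_latticeChar_le_one d μ t) k).trans ?_
          rw [mul_assoc]
          gcongr
          refine (norm_latticeChar_sub_one_le d μ hint t).trans ?_
          rw [mul_comm]
          gcongr
          exact div_le_self hM0 hd1
        linarith
      calc _ ≤ Real.exp (-(c * j * t ^ 2)) * ((s + k * M) * |t|) := by gcongr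
        _ = _ := by ring
    · exact (by fun_prop : Continuous fun t : ℝ =>
        (s + k * M) * (|t| * Real.exp (-(c * j * t ^ 2)))).intervalIntegrable _ _
  rw [intervalIntegral.integral_const_mul] at hbound
  have h1 := integral_abs_mul_exp_neg_le (b := c * j) (by positivity) hpi.le
  have h2 : ‖((2 * Real.pi : ℝ)⁻¹ : ℝ)‖ ≤ 1 := by
    rw [Real.norm_eq_abs, abs_of_pos (by positivity)]
    exact inv_le_one_of_one_le₀ (by linarith [Real.pi_gt_three])
  calc _ ≤ 1 * ((s + k * M) * (1 / (c * j))) := by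
        gcongr
        exact hbound.trans (by gcongr)
    _ = _ := by ring

/-! ### The local limit theorem -/

/-- Laws `μ n` on `ℕ` that converge pointwise along `l` and have a common dominating sequence `q`
with a finite second moment. -/
structure DominatedLaws (l : Filter ℕ) (μ : ℕ → Measure ℕ) (μ₀ : Measure ℕ) (q : ℕ → ℝ) :
    Prop where
  prob : ∀ᶠ n in l, IsProbabilityMeasure (μ n)
  prob_limit : IsProbabilityMeasure μ₀
  tendsto : ∀ k, Tendsto (fun n => (μ n).real {k}) l (𝓝 (μ₀.real {k}))
  le : ∀ᶠ n in l, ∀ k, (μ n).real {k} ≤ q k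
  summable : Summable fun k : ℕ => ((k : ℝ) ^ 2 + 1) * q k

lemma integrable_of_summable_real {E : Type*} [NormedAddCommGroup E] [MeasurableSpace E]
    [BorelSpace E] [SecondCountableTopology E] {μ : Measure ℕ} [IsFiniteMeasure μ]
    {f : ℕ → E} (h : Summable fun k => μ.real {k} * ‖f k‖) : Integrable f μ := by
  refine ⟨Measurable.of_discrete.aestronglyMeasurable, ?_⟩
  rw [HasFiniteIntegral, lintegral_countable']
  have : ∀ k, ‖f k‖ₑ * μ {k} = ENNReal.ofReal (μ.real {k} * ‖f k‖) := fun k => by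
    rw [ENNReal.ofReal_mul measureReal_nonneg, ofReal_measureReal, ofReal_norm, mul_comm]
  simp_rw [this]
  exact h.tsum_ofReal_lt_top

lemma DominatedLaws.limit_le {l : Filter ℕ} [l.NeBot] {μ : ℕ → Measure ℕ} {μ₀ : Measure ℕ}
    {q : ℕ → ℝ} (H : DominatedLaws l μ μ₀ q) (k : ℕ) : μ₀.real {k} ≤ q k :=
  le_of_tendsto (H.tendsto k) (H.le.mono fun _ h => h k)

lemma integrable_of_le {μ : Measure ℕ} [IsFiniteMeasure μ] {q : ℕ → ℝ}
    (hq : Summable fun k : ℕ => ((k : ℝ) ^ 2 + 1) * q k) (hle : ∀ k, μ.real {k} ≤ q k)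
    {E : Type*} [NormedAddCommGroup E] [MeasurableSpace E] [BorelSpace E] [SecondCountableTopology E] {f : ℕ → E} {C : ℝ}
    (hf : ∀ k : ℕ, ‖f k‖ ≤ C * ((k : ℝ) ^ 2 + 1)) : Integrable f μ := by
  refine integrable_of_summable_real (Summable.of_nonneg_of_le (fun k => by positivity)
    (fun k => ?_) (hq.mul_left C))
  calc μ.real {k} * ‖f k‖ ≤ q k * (C * ((k : ℝ) ^ 2 + 1)) :=
        mul_le_mul (hle k) (hf k) (norm_nonneg _) (measureReal_nonneg.trans (hle k))
    _ = _ := by ring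

/-- Dominated convergence for the sums over `k`, with both integrand and law varying; the majorant
is `C (k² + 1) q_k`, so quadratic growth is allowed. -/
lemma DominatedLaws.tendsto_integral {l : Filter ℕ} [l.NeBot] {μ : ℕ → Measure ℕ}
    {μ₀ : Measure ℕ} {q : ℕ → ℝ} (H : DominatedLaws l μ μ₀ q) {E : Type*} [NormedAddCommGroup E]
    [NormedSpace ℝ E] [CompleteSpace E] [MeasurableSpace E] [BorelSpace E] [SecondCountableTopology E]
    {f : ℕ → ℕ → E} {g : ℕ → E} {C : ℝ}
    (hf : ∀ᶠ n in l, ∀ k : ℕ, ‖f n k‖ ≤ C * ((k : ℝ) ^ 2 + 1))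
    (hlim : ∀ k, Tendsto (fun n => f n k) l (𝓝 (g k))) :
    Tendsto (fun n => ∫ k, f n k ∂(μ n)) l (𝓝 (∫ k, g k ∂μ₀)) := by
  have := H.prob_limit
  have hg : ∀ k : ℕ, ‖g k‖ ≤ C * ((k : ℝ) ^ 2 + 1) := fun k =>
    le_of_tendsto (hlim k).norm (hf.mono fun _ h => h k)
  rw [integral_countable (integrable_of_le H.summable H.limit_le hg)]
  have h1 : Tendsto (fun n => ∑' k, (μ n).real {k} • f n k) l (𝓝 (∑' k, μ₀.real {k} • g k)) := by
    refine tendsto_tsum_of_dominated_convergence (H.summable.mul_left C)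
      (fun k => (H.tendsto k).smul (hlim k)) ?_
    filter_upwards [hf, H.le] with n hn hle k
    rw [norm_smul, Real.norm_of_nonneg measureReal_nonneg]
    calc (μ n).real {k} * ‖f n k‖ ≤ q k * (C * ((k : ℝ) ^ 2 + 1)) :=
          mul_le_mul (hle k) (hn k) (norm_nonneg _) (measureReal_nonneg.trans (hle k))
      _ = _ := by ring
  refine h1.congr' ?_
  filter_upwards [hf, H.le, H.prob] with n hn hle hp
  rw [integral_countable (integrable_of_le H.summable hle hn)]

lemma norm_unitExp_sub_sub_le (x : ℝ) : ‖unitExp x - 1 - Complex.I * x‖ ≤ 3 * x ^ 2 := by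
  have hn : ‖Complex.I * (x : ℂ)‖ = |x| := by simp
  rcases le_total |x| 1 with h | h
  · have := Complex.norm_exp_sub_one_sub_id_le (x := Complex.I * x) (by rw [hn]; exact h)
    rw [hn, sq_abs] at this
    exact this.trans (by nlinarith [sq_nonneg x])
  · refine (norm_sub_le _ _).trans ?_
    rw [hn]
    have := norm_unitExp_sub_one_le x
    rw [← sq_abs]
    nlinarith

lemma tendsto_sq_mul_unitExp_sub {l : Filter ℕ} {r v : ℕ → ℝ} {v₀ : ℝ} (hr : Tendsto r l atTop)
    (hv : Tendsto v l (𝓝 v₀)) :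
    Tendsto (fun n => ((r n) ^ 2 : ℂ) * (unitExp (v n / r n) - 1 - Complex.I * (v n / r n : ℝ))) l
      (𝓝 (-(v₀ ^ 2 : ℝ) / 2)) := by
  have hx : Tendsto (fun n => v n / r n) l (𝓝 0) := hv.div_atTop hr
  have hsq : Tendsto (fun n => -((v n) ^ 2 : ℝ) / 2 : ℕ → ℂ) l (𝓝 (-(v₀ ^ 2 : ℝ) / 2)) :=
    (((Complex.continuous_ofReal.tendsto _).comp (hv.pow 2)).neg).div_const 2
  have herr : Tendsto (fun n => ((r n) ^ 2 : ℂ) *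
      (unitExp (v n / r n) - 1 - Complex.I * (v n / r n : ℝ)) - (-((v n) ^ 2 : ℝ) / 2)) l
      (𝓝 0) := by
    have hb : Tendsto (fun n => v n ^ 2 * |v n / r n| * Real.exp |v n / r n|) l (𝓝 0) := by
      have := ((hv.pow 2).mul hx.abs).mul ((Real.continuous_exp.tendsto _).comp hx.abs)
      simpa using this
    refine squeeze_zero_norm' ?_ hb
    filter_upwards [hr.eventually_gt_atTop 0] with n hn
    have h1 := Complex.norm_exp_sub_sum_le_norm_mul_exp (Complex.I * (v n / r n : ℝ)) 3
    have hn' : ‖Complex.I * ((v n / r n : ℝ) : ℂ)‖ = |v n / r n| := by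
      rw [norm_mul, Complex.norm_I, one_mul, Complex.norm_real, Real.norm_eq_abs]
    rw [hn'] at h1
    have hrc : (r n : ℂ) ≠ 0 := by exact_mod_cast hn.ne'
    have e : ((r n) ^ 2 : ℂ) * (unitExp (v n / r n) - 1 - Complex.I * (v n / r n : ℝ)) -
        (-((v n) ^ 2 : ℝ) / 2) = (r n : ℂ) ^ 2 * (Complex.exp (Complex.I * (v n / r n : ℝ)) -
          ∑ i ∈ Finset.range 3, (Complex.I * (v n / r n : ℝ)) ^ i / (i.factorial : ℂ)) := by
      rw [Finset.sum_range_succ, Finset.sum_range_succ, Finset.sum_range_succ]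
      simp only [Finset.range_zero, Finset.sum_empty, unitExp, pow_zero, pow_one,
        Nat.factorial, mul_pow, Complex.I_sq]
      push_cast
      field_simp
      ring
    rw [e, norm_mul, norm_pow, Complex.norm_real, Real.norm_of_nonneg hn.le]
    calc r n ^ 2 * _ ≤ r n ^ 2 * (|v n / r n| ^ 3 * Real.exp |v n / r n|) := by gcongr
      _ = _ := by
        have : r n ^ 2 * |v n / r n| ^ 2 = v n ^ 2 := by
          rw [sq_abs, div_pow]; field_simp
        rw [← this]; ring
  simpa using herr.add hsq

lemma tendsto_one_add_pow_exp {S : Set ℕ} {g : ℕ → ℂ} {t : ℂ}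
    (h : Tendsto (fun n : ℕ => (n : ℂ) * g n) (atTop ⊓ 𝓟 S) (𝓝 t)) :
    Tendsto (fun n : ℕ => (1 + g n) ^ n) (atTop ⊓ 𝓟 S) (𝓝 (Complex.exp t)) := by
  classical
  -- Off `S` the value `t / n` keeps `n * g' n` equal to `t` for `n ≠ 0`, which turns the limit
  -- along `S` into one along all `n`.
  set g' : ℕ → ℂ := fun n => if n ∈ S then g n else t / n
  have h1 : Tendsto (fun n : ℕ => (n : ℂ) * g' n) atTop (𝓝 t) := by
    intro U hU
    have h2 := h hU
    rw [mem_map, mem_inf_principal] at h2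
    rw [mem_map]
    filter_upwards [h2, eventually_ne_atTop 0] with n hn hn0
    by_cases hS : n ∈ S
    · simpa [g', hS] using hn hS
    · have : (n : ℂ) ≠ 0 := by exact_mod_cast hn0
      simpa [g', hS, mul_div_cancel₀ _ this] using mem_of_mem_nhds hU
  refine ((Complex.tendsto_one_add_pow_exp_of_tendsto h1).mono_left inf_le_left).congr' ?_
  filter_upwards [mem_inf_of_right (mem_principal_self S)] with n hn
  simp [g', hn]

/-- A local limit theorem of which only the lower bound is kept. After substituting `t = u / √n`,
the integrand tends to `e^{-bu²}` with `b = V / (2d²)`, dominated by `e^{-cu²}`. So `√n` times the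
local probability tends to `√(π/b) / (2π)`, and `L` is half of that. -/
theorem DominatedLaws.exists_le_norm_locProb {S : Set ℕ} [(atTop ⊓ 𝓟 S : Filter ℕ).NeBot]
    {μ : ℕ → Measure ℕ} {μ₀ : Measure ℕ} {q : ℕ → ℝ}
    (H : DominatedLaws (atTop ⊓ 𝓟 S) μ μ₀ q) {d : ℕ} (hd : 0 < d)
    {c : ℝ} (hc : 0 < c) (hdec : ∀ᶠ n in atTop ⊓ 𝓟 S, ∀ t : ℝ, |t| ≤ Real.pi →
      ‖latticeChar d (μ n) t‖ ≤ Real.exp (-(c * t ^ 2)))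
    (hvar : 0 < ∫ k : ℕ, ((k : ℝ) - ∫ k : ℕ, (k : ℝ) ∂μ₀) ^ 2 ∂μ₀)
    {m : ℕ → ℕ} (hm : (fun n : ℕ => (m n : ℝ) - n * ∫ k : ℕ, (k : ℝ) ∂(μ n))
      =o[atTop ⊓ 𝓟 S] (fun n : ℕ => √(n : ℝ))) :
    ∃ L > 0, ∀ᶠ n : ℕ in atTop ⊓ 𝓟 S, L ≤ √(n : ℝ) * ‖locProb d (μ n) n (m n)‖ := by
  set l : Filter ℕ := atTop ⊓ 𝓟 S
  have hp₀ := H.prob_limit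
  have hl : l ≤ atTop := inf_le_left
  set a : ℕ → ℝ := fun n => ∫ k : ℕ, (k : ℝ) ∂(μ n)
  set a₀ : ℝ := ∫ k : ℕ, (k : ℝ) ∂μ₀
  have hid : ∀ k : ℕ, ‖(k : ℝ)‖ ≤ 1 * ((k : ℝ) ^ 2 + 1) := fun k => by
    rw [Real.norm_of_nonneg (by positivity)]; nlinarith [sq_nonneg ((k : ℝ) - 1)]
  have ha : Tendsto a l (𝓝 a₀) :=
    H.tendsto_integral (f := fun _ k => (k : ℝ)) (Eventually.of_forall fun _ => hid)
      fun k => tendsto_const_nhds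
  have hsqrt : Tendsto (fun n : ℕ => √(n : ℝ)) l atTop :=
    (Real.tendsto_sqrt_atTop.comp tendsto_natCast_atTop_atTop).mono_left hl
  have hd0 : (0 : ℝ) < d := by exact_mod_cast hd
  set V : ℝ := ∫ k : ℕ, ((k : ℝ) - a₀) ^ 2 ∂μ₀ with hV
  set b : ℝ := V / (2 * d ^ 2) with hb
  have hb0 : 0 < b := by positivity
  set F : ℕ → ℝ → ℂ := fun n u => latticeChar d (μ n) (u / √n) ^ n * unitExp (-(u / √n * (m n / d)))
  have hpt : ∀ u : ℝ, Tendsto (fun n => F n u) l (𝓝 (Complex.exp ((-(b * u ^ 2) : ℝ) : ℂ))) := by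
    intro u
    -- This is the centred characteristic function minus `1`. The linear term integrates to zero,
    -- but subtracting it gives the integrand, multiplied by `n`, a pointwise limit and a quadratic
    -- bound.
    set g : ℕ → ℂ := fun n => ∫ k : ℕ, (unitExp (u * (k - a n) / d / √n) - 1
      - Complex.I * (u * (k - a n) / d / √n : ℝ)) ∂(μ n)
    have hg : Tendsto (fun n : ℕ => (n : ℂ) * g n) l (𝓝 ((-(b * u ^ 2) : ℝ) : ℂ)) := by
      have hlim : ∀ k : ℕ, Tendsto (fun n : ℕ => ((√n) ^ 2 : ℂ) *
          (unitExp (u * (k - a n) / d / √n) - 1 - Complex.I * (u * (k - a n) / d / √n : ℝ))) l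
          (𝓝 (-((u * (k - a₀) / d) ^ 2 : ℝ) / 2)) := fun k =>
        tendsto_sq_mul_unitExp_sub hsqrt
          (((tendsto_const_nhds.sub ha).const_mul u).div_const _)
      have hbd : ∀ᶠ n : ℕ in l, ∀ k : ℕ, ‖((√n) ^ 2 : ℂ) *
          (unitExp (u * (k - a n) / d / √n) - 1 - Complex.I * (u * (k - a n) / d / √n : ℝ))‖ ≤
          (3 * u ^ 2 / d ^ 2 * (2 * ((a₀ + 1) ^ 2 + 1))) * ((k : ℝ) ^ 2 + 1) := by
        filter_upwards [ha.eventually_le_const (lt_add_one a₀), hl (eventually_gt_atTop 0)]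
          with n hn hn0 k
        have ha0 : 0 ≤ a n := integral_nonneg fun k => by positivity
        have hn0' : (0 : ℝ) < √n := Real.sqrt_pos.2 (by exact_mod_cast hn0)
        rw [norm_mul, norm_pow, Complex.norm_real, Real.norm_of_nonneg hn0'.le]
        have h1 := norm_unitExp_sub_sub_le (u * (k - a n) / d / √n)
        calc (√n) ^ 2 * _ ≤ (√n) ^ 2 * (3 * (u * (k - a n) / d / √n) ^ 2) := by gcongr
          _ = 3 * u ^ 2 / d ^ 2 * (k - a n) ^ 2 := by field_simp
          _ ≤ 3 * u ^ 2 / d ^ 2 * ((2 * ((a₀ + 1) ^ 2 + 1)) * ((k : ℝ) ^ 2 + 1)) := by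
            gcongr
            have h2 : (a n) ^ 2 ≤ (a₀ + 1) ^ 2 := by gcongr
            nlinarith [sq_nonneg ((k : ℝ) + a n), mul_nonneg (sq_nonneg (a₀ + 1)) (sq_nonneg (k : ℝ))]
          _ = _ := by ring
      have h1 := H.tendsto_integral hbd hlim
      have h2 : ∫ k : ℕ, (-((u * (k - a₀) / d) ^ 2 : ℝ) / 2 : ℂ) ∂μ₀ = ((-(b * u ^ 2) : ℝ) : ℂ) := by
        have : ∀ k : ℕ, (-((u * (k - a₀) / d) ^ 2 : ℝ) / 2 : ℂ) =
            ((-(u ^ 2 / (2 * d ^ 2)) * (k - a₀) ^ 2 : ℝ) : ℂ) := by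
          intro k; push_cast; field_simp
        simp_rw [this]
        rw [integral_complex_ofReal, integral_const_mul, ← hV, hb]
        congr 1; ring
      rw [h2] at h1
      refine h1.congr fun n => ?_
      rw [integral_const_mul]
      congr 1
      rw [← Complex.ofReal_pow, Real.sq_sqrt (by positivity)]
      simp
    have h1 := tendsto_one_add_pow_exp hg
    -- The phase left over after centring; this is the place where `m - n E ξ = o(√n)` is used.
    have h2 : Tendsto (fun n : ℕ => unitExp (-(u / d * ((m n - n * a n) / √n)))) l (𝓝 1) := by
      have h3 : Tendsto (fun n : ℕ => (m n - n * a n) / √n) l (𝓝 0) := hm.tendsto_div_nhds_zero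
      have := (continuous_unitExp.tendsto _).comp (h3.const_mul (u / d)).neg
      rw [mul_zero, neg_zero, unitExp_zero] at this
      exact this
    have h3 := h1.mul h2
    rw [mul_one] at h3
    refine h3.congr' ?_
    filter_upwards [H.prob, H.le, hl (eventually_gt_atTop 0)] with n hp hle hn0
    have hint : Integrable (fun k : ℕ => (k : ℝ)) (μ n) := integrable_of_le H.summable hle hid
    have hn0' : (0 : ℝ) < √n := Real.sqrt_pos.2 (by exact_mod_cast hn0)
    have hgn : 1 + g n = latticeChar d (μ n) (u / √n) * unitExp (-(u / √n * (a n / d))) := by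
      have hI : Integrable (fun k : ℕ => u * (k - a n) / d / √n) (μ n) :=
        (((hint.sub (integrable_const _)).const_mul u).div_const _).div_const _
      have h0 : ∫ k : ℕ, u * (k - a n) / d / √n ∂(μ n) = 0 := by
        rw [integral_div, integral_div, integral_const_mul,
          integral_sub hint (integrable_const _)]
        simp [a]
      have hU := integrable_unitExp (μ n) (fun k : ℕ => u * (k - a n) / d / √n)
      have : g n = ∫ k : ℕ, unitExp (u * (k - a n) / d / √n) ∂(μ n) - 1 := by
        have hU1 : Integrable (fun k : ℕ => unitExp (u * (k - a n) / d / √n) - 1) (μ n) :=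
          hU.sub (integrable_const _)
        have hI' : Integrable (fun k : ℕ => Complex.I * (u * (k - a n) / d / √n : ℝ)) (μ n) :=
          hI.ofReal.const_mul _
        simp only [g]
        rw [integral_sub hU1 hI',
          integral_sub hU (integrable_const _), integral_const_mul, integral_complex_ofReal, h0]
        simp
      rw [this, latticeChar, ← integral_mul_const]
      simp_rw [← unitExp_add]
      rw [add_sub_cancel]
      congr 1; ext k; congr 1
      field_simp; ring
    rw [hgn, mul_pow, mul_assoc]
    congr 1
    have : ∀ x : ℝ, unitExp x ^ n = unitExp (n * x) := by
      intro x
      simp only [unitExp, ← Complex.exp_nat_mul]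
      congr 1; push_cast; ring
    rw [this, ← unitExp_add]
    congr 1
    field_simp; ring
  have hint : Tendsto (fun n : ℕ => ∫ u : ℝ, (Set.Ioc (-(Real.pi * √n)) (Real.pi * √n)).indicator
      (F n) u) l (𝓝 (∫ u : ℝ, Complex.exp ((-(b * u ^ 2) : ℝ) : ℂ))) := by
    refine tendsto_integral_filter_of_dominated_convergence (fun u => Real.exp (-c * u ^ 2))
      ?_ ?_ (integrable_exp_neg_mul_sq hc) (ae_of_all _ fun u => ?_)
    · filter_upwards [H.prob] with n hp
      refine (Continuous.aestronglyMeasurable ?_).indicator measurableSet_Ioc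
      exact (((continuous_latticeChar d (μ n)).comp (by fun_prop)).pow n).mul
        (continuous_unitExp.comp (by fun_prop))
    · filter_upwards [hdec, hl (eventually_gt_atTop 0)] with n hn hn0
      refine ae_of_all _ fun u => ?_
      have hn0' : (0 : ℝ) < √n := Real.sqrt_pos.2 (by exact_mod_cast hn0)
      by_cases hu : u ∈ Set.Ioc (-(Real.pi * √n)) (Real.pi * √n)
      · rw [Set.indicator_of_mem hu, norm_mul, norm_unitExp, mul_one, norm_pow]
        have h1 : |u / √n| ≤ Real.pi := by
          rw [abs_div, abs_of_pos hn0', div_le_iff₀ hn0']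
          exact abs_le.2 ⟨hu.1.le, hu.2⟩
        refine (pow_le_pow_left₀ (norm_nonneg _) (hn _ h1) n).trans (le_of_eq ?_)
        rw [← Real.exp_nat_mul]
        congr 1
        have : (n : ℝ) = √n ^ 2 := (Real.sq_sqrt (by positivity)).symm
        rw [div_pow, ← this]
        have : (n : ℝ) ≠ 0 := by exact_mod_cast hn0.ne'
        field_simp
      · rw [Set.indicator_of_notMem hu, norm_zero]; positivity
    · refine (hpt u).congr' ?_
      have : Tendsto (fun n : ℕ => Real.pi * √(n : ℝ)) l atTop :=
        hsqrt.const_mul_atTop Real.pi_pos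
      filter_upwards [this.eventually_gt_atTop |u|] with n hn
      rw [Set.indicator_of_mem]
      exact ⟨(abs_lt.1 hn).1, (abs_lt.1 hn).2.le⟩
  have hloc : ∀ᶠ n : ℕ in l, √(n : ℝ) * ‖locProb d (μ n) n (m n)‖ = (2 * Real.pi)⁻¹ *
      ‖∫ u : ℝ, (Set.Ioc (-(Real.pi * √n)) (Real.pi * √n)).indicator (F n) u‖ := by
    filter_upwards [hl (eventually_gt_atTop 0)] with n hn0
    have hn0' : (0 : ℝ) < √n := Real.sqrt_pos.2 (by exact_mod_cast hn0)
    have h1 := intervalIntegral.integral_comp_div (a := -(Real.pi * √n)) (b := Real.pi * √n)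
      (fun t : ℝ => latticeChar d (μ n) t ^ n * unitExp (-(t * (m n / d)))) hn0'.ne'
    rw [neg_div, mul_div_cancel_right₀ _ hn0'.ne'] at h1
    rw [integral_indicator measurableSet_Ioc, ← intervalIntegral.integral_of_le
      (by have := Real.pi_pos; nlinarith), h1, locProb, norm_smul, norm_smul,
      Real.norm_of_nonneg hn0'.le, Real.norm_of_nonneg (by positivity)]
    simp only [Int.cast_natCast]
    ring
  have hval : ∫ u : ℝ, Complex.exp ((-(b * u ^ 2) : ℝ) : ℂ) = ((√(Real.pi / b) : ℝ) : ℂ) := by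
    rw [← integral_gaussian, ← integral_complex_ofReal]
    congr 1; ext u
    rw [Complex.ofReal_exp, neg_mul]
  rw [hval] at hint
  have hfin : Tendsto (fun n : ℕ => √(n : ℝ) * ‖locProb d (μ n) n (m n)‖) l
      (𝓝 ((2 * Real.pi)⁻¹ * √(Real.pi / b))) := by
    refine Tendsto.congr' (hloc.mono fun n h => h.symm) ?_
    have := (hint.norm).const_mul (2 * Real.pi)⁻¹
    rwa [Complex.norm_real, Real.norm_of_nonneg (Real.sqrt_nonneg _)] at this
  have hpos : 0 < (2 * Real.pi)⁻¹ * √(Real.pi / b) := by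
    have := Real.pi_pos
    positivity
  exact ⟨_, half_pos hpos, hfin.eventually_const_le (half_lt_self hpos)⟩

/-! ### Comparison of local probabilities -/

/-- `μ` is the exponential tilt of the weight sequence `w` at some parameter `t > 0`. -/
def IsTilt (w : ℕ → ℝ≥0) (μ : Measure ℕ) : Prop :=
  ∃ t φ : ℝ, 0 < t ∧ 0 < φ ∧ ∀ k, μ.real {k} = w k * t ^ k / φ

lemma IsTilt.pos {w : ℕ → ℝ≥0} {μ : Measure ℕ} (h : IsTilt w μ) {k : ℕ} (hk : 0 < w k) :
    0 < μ.real {k} := by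
  obtain ⟨t, φ, ht, hφ, h⟩ := h
  rw [h]
  have : (0 : ℝ) < w k := by exact_mod_cast hk
  positivity

lemma IsTilt.ae_pos {w : ℕ → ℝ≥0} {μ : Measure ℕ} [IsFiniteMeasure μ] (h : IsTilt w μ) :
    ∀ᵐ k ∂μ, 0 < w k := by
  obtain ⟨t, φ, -, -, h⟩ := h
  rw [ae_iff_of_countable]
  intro k hk
  by_contra h0
  have : w k = 0 := by simpa using h0
  exact hk ((measureReal_eq_zero_iff).1 (by rw [h, this]; simp))

lemma norm_locProb_le_one (d : ℕ) (μ : Measure ℕ) [IsProbabilityMeasure μ] (j : ℕ) (s : ℤ) :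
    ‖locProb d μ j s‖ ≤ 1 := by
  have hpi := Real.pi_pos
  have h := intervalIntegral.norm_integral_le_of_norm_le_const (C := 1)
    (f := fun t => latticeChar d μ t ^ j * unitExp (-(t * (s / d)))) (a := -Real.pi) (b := Real.pi)
    fun t _ => by
      rw [norm_mul, norm_unitExp, mul_one, norm_pow]
      exact pow_le_one₀ (norm_nonneg _) (norm_latticeChar_le_one d μ t)
  rw [locProb, norm_smul, Real.norm_of_nonneg (by positivity)]
  calc _ ≤ (2 * Real.pi)⁻¹ * (1 * |Real.pi - -Real.pi|) := by gcongr
    _ = 1 := by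
      rw [abs_of_pos (by linarith)]; field_simp; ring

lemma DominatedLaws.tendsto_mean {l : Filter ℕ} [l.NeBot] {μ : ℕ → Measure ℕ}
    {μ₀ : Measure ℕ} {q : ℕ → ℝ} (H : DominatedLaws l μ μ₀ q) :
    Tendsto (fun n => ∫ k : ℕ, (k : ℝ) ∂(μ n)) l (𝓝 (∫ k : ℕ, (k : ℝ) ∂μ₀)) :=
  H.tendsto_integral (f := fun _ k => (k : ℝ)) (C := 1) (Eventually.of_forall fun _ k => by
    rw [Real.norm_of_nonneg (by positivity)]; nlinarith [sq_nonneg ((k : ℝ) - 1)])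
      fun k => tendsto_const_nhds

lemma integrable_id_of_le {μ : Measure ℕ} [IsFiniteMeasure μ] {q : ℕ → ℝ}
    (hq : Summable fun k : ℕ => ((k : ℝ) ^ 2 + 1) * q k) (hle : ∀ k, μ.real {k} ≤ q k) :
    Integrable (fun k : ℕ => (k : ℝ)) μ :=
  integrable_of_le hq hle (C := 1) fun k => by
    rw [Real.norm_of_nonneg (by positivity)]; nlinarith [sq_nonneg ((k : ℝ) - 1)]

/-- Both `0` and `k₁` are atoms, and at most one of them equals `a`. -/
lemma integral_sub_sq_pos {μ : Measure ℕ} [IsProbabilityMeasure μ] {q : ℕ → ℝ}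
    (hq : Summable fun k : ℕ => ((k : ℝ) ^ 2 + 1) * q k) (hle : ∀ k, μ.real {k} ≤ q k)
    {k₁ : ℕ} (hk₁ : k₁ ≠ 0) (h0 : 0 < μ.real {0}) (h1 : 0 < μ.real {k₁}) (a : ℝ) :
    0 < ∫ k : ℕ, ((k : ℝ) - a) ^ 2 ∂μ := by
  have hint : Integrable (fun k : ℕ => ((k : ℝ) - a) ^ 2) μ :=
    integrable_of_le hq hle (C := 2 * (a ^ 2 + 1)) fun k => by
      rw [Real.norm_of_nonneg (by positivity)]
      nlinarith [sq_nonneg ((k : ℝ) + a), mul_nonneg (sq_nonneg a) (sq_nonneg (k : ℝ))]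
  rw [integral_pos_iff_support_of_nonneg (fun k => by positivity) hint]
  have key : ∀ k : ℕ, (k : ℝ) ≠ a → 0 < μ.real {k} →
      0 < μ (Function.support fun k : ℕ => ((k : ℝ) - a) ^ 2) := by
    intro k hk hpos
    refine lt_of_lt_of_le ?_ (measure_mono (Set.singleton_subset_iff.2 (?_ : k ∈ _)))
    · exact (ENNReal.toReal_pos_iff.1 hpos).1
    · simpa [Function.mem_support, sub_eq_zero] using hk
  by_cases ha : (0 : ℝ) = a
  · exact key k₁ (by rw [← ha]; exact_mod_cast hk₁) h1
  · exact key 0 (by simpa using ha) h0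

/-- The absolute error `O((s + k)/n)` is divided by the lower bound `L/√n`. The former needs `n - k`
comparable with `n`; for `k > n/2` the claimed bound is at least `2` and hence trivial. -/
theorem DominatedLaws.exists_norm_locProb_sub_le {S : Set ℕ} [(atTop ⊓ 𝓟 S : Filter ℕ).NeBot]
    {w : ℕ → ℝ≥0} (hw0 : 0 < w 0) {k₁ : ℕ} (hk₁ : k₁ ≠ 0) (hwk₁ : 0 < w k₁)
    {μ : ℕ → Measure ℕ} {μ₀ : Measure ℕ} {q : ℕ → ℝ}
    (H : DominatedLaws (atTop ⊓ 𝓟 S) μ μ₀ q) (hμ₀ : IsTilt w μ₀)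
    {m : ℕ → ℕ} (hm : (fun n : ℕ => (m n : ℝ) - n * ∫ k : ℕ, (k : ℝ) ∂(μ n))
      =o[atTop ⊓ 𝓟 S] (fun n : ℕ => √(n : ℝ))) :
    ∃ d : ℕ, 0 < d ∧ (∀ k, 0 < w k → d ∣ k) ∧ ∃ C > 0, ∀ᶠ n in atTop ⊓ 𝓟 S,
      0 < ‖locProb d (μ n) n (m n)‖ ∧ ∀ k ≤ n, ∀ s : ℕ,
      ‖locProb d (μ n) (n - k) (m n - s) - locProb d (μ n) n (m n)‖ ≤
        C * (s + k) / √(n : ℝ) * ‖locProb d (μ n) n (m n)‖ := by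
  have := H.prob_limit
  obtain ⟨d, hd, hdvd, K, hK, C, hC, hspan⟩ :=
    exists_lattice_span (s := {k | 0 < w k}) (k₀ := k₁) hwk₁ hk₁
  obtain ⟨c, hc, hdec⟩ := exists_norm_latticeChar_le_exp hC hspan H.prob fun k hk => by
    have hwk : 0 < w k := by
      rcases Finset.mem_insert.1 hk with rfl | hk
      · exact hw0
      · exact hK hk
    have := hμ₀.pos hwk
    exact ⟨_, half_pos this, (H.tendsto k).eventually_const_le (half_lt_self this)⟩
  obtain ⟨L, hL, hlow⟩ := H.exists_le_norm_locProb hd hc hdec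
    (integral_sub_sq_pos H.summable H.limit_le hk₁ (hμ₀.pos hw0) (hμ₀.pos hwk₁) _) hm
  set M : ℝ := (∫ k : ℕ, (k : ℝ) ∂μ₀) + 1
  have hM0 : 0 < M := by
    have : 0 ≤ ∫ k : ℕ, (k : ℝ) ∂μ₀ := integral_nonneg fun k => by positivity
    positivity
  -- The term `2(1 + M)/c` serves `k ≤ n/2`, the `4` serves `k > n/2`, and `M` eventually bounds the
  -- means of all `μ n`.
  refine ⟨d, hd, hdvd, (2 * (1 + M) / c + 4) / L, by positivity, ?_⟩
  filter_upwards [hdec, hlow, H.prob, H.le, H.tendsto_mean.eventually_le_const (lt_add_one _),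
    mem_inf_of_left (Ioi_mem_atTop 0)] with n hn hLn hp hle hMn hn0
  have hn1 : (1 : ℝ) ≤ n := by exact_mod_cast (hn0 : 0 < n)
  have hs1 : 1 ≤ √(n : ℝ) := Real.one_le_sqrt.2 hn1
  have hs0 : 0 < √(n : ℝ) := by linarith
  have hsq : √(n : ℝ) * √(n : ℝ) = n := Real.mul_self_sqrt (by positivity)
  set Q := ‖locProb d (μ n) n (m n)‖
  have hQ : 1 ≤ √(n : ℝ) * Q / L := by rwa [one_le_div hL]
  refine ⟨by
    by_contra h
    have : √(n : ℝ) * Q ≤ 0 := mul_nonpos_of_nonneg_of_nonpos hs0.le (not_lt.1 h)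
    linarith, fun k hk s => ?_⟩
  have hsk : (0 : ℝ) ≤ s + k := by positivity
  have e : (2 * (1 + M) / c + 4) / L * (s + k) / √(n : ℝ) * Q =
      (2 * (1 + M) / c + 4) * (s + k) / n * (√(n : ℝ) * Q / L) := by
    have : (n : ℝ) ≠ 0 := by positivity
    field_simp
    rw [Real.sq_sqrt (by positivity)]
    ring
  rw [e]
  have e2 : (2 * (1 + M) / c + 4) * (s + k) / n ≤
      (2 * (1 + M) / c + 4) * (s + k) / n * (√(n : ℝ) * Q / L) :=
    le_mul_of_one_le_right (by positivity) hQ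
  rcases le_or_gt (2 * k) n with h2 | h2
  · have hj : 0 < n - k := by have : 0 < n := hn0; omega
    have h1 := norm_locProb_sub_le hd (μ n) (integrable_id_of_le H.summable hle) hc hn hj k s (m n)
    rw [Nat.sub_add_cancel hk] at h1
    refine (h1.trans ?_).trans e2
    have hjn : (n : ℝ) / 2 ≤ (n - k : ℕ) := by
      rw [Nat.cast_sub hk]
      have : (2 : ℝ) * k ≤ n := by exact_mod_cast h2
      linarith
    have hnum : (s + k * ∫ k : ℕ, (k : ℝ) ∂(μ n)) ≤ (1 + M) * (s + k) := by
      have h3 : (k : ℝ) * ∫ k : ℕ, (k : ℝ) ∂(μ n) ≤ k * M := by gcongr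
      have : (0 : ℝ) ≤ M * s := by positivity
      have : (0 : ℝ) ≤ k := by positivity
      linarith
    calc (s + k * ∫ k : ℕ, (k : ℝ) ∂(μ n)) / (c * (n - k : ℕ)) ≤
          ((1 + M) * (s + k)) / (c * (n / 2)) := by gcongr
      _ = 2 * (1 + M) / c * (s + k) / n := by field_simp
      _ ≤ _ := by gcongr; linarith
  · refine le_trans ?_ (mul_le_mul_of_nonneg_left hQ (by positivity) |>.trans' (le_of_eq
      (mul_one _).symm))
    have h3 : ‖locProb d (μ n) (n - k) (m n - s) - locProb d (μ n) n (m n)‖ ≤ 2 := by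
      refine (norm_sub_le _ _).trans ?_
      linarith [norm_locProb_le_one d (μ n) (n - k) (m n - s), norm_locProb_le_one d (μ n) n (m n)]
    refine h3.trans ?_
    rw [le_div_iff₀ (by positivity)]
    have h4 : (n : ℝ) ≤ 2 * k := by exact_mod_cast h2.le
    have h5 : 0 ≤ 2 * (1 + M) / c * (s + k) := by positivity
    have : (0 : ℝ) ≤ s := by positivity
    nlinarith

/-! ### Random allocations as conditioned i.i.d. variables -/

lemma measureReal_pi_singleton {ι : Type*} [Fintype ι] (μ : Measure ℕ) [IsProbabilityMeasure μ]
    (y : ι → ℕ) : (Measure.pi fun _ : ι => μ).real {y} = ∏ i, μ.real {y i} := by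
  rw [← Set.univ_pi_singleton, measureReal_def, Measure.pi_pi, ENNReal.toReal_prod]
  rfl

instance (μ : Measure ℕ) [IsProbabilityMeasure μ] (n : ℕ) : IsProbabilityMeasure (iidLaw μ n) := by
  unfold iidLaw; infer_instance

/-- Under i.i.d. tilted variables an allocation with sum `m` has probability `t^m / φ^n · ∏
w_{y_i}`. The prefactor is common to all such allocations and cancels in the quotient. -/
lemma allocLaw_real_eq {w : ℕ → ℝ≥0} {m n : ℕ} (hZ : 0 < partitionFn w m n) {μ : Measure ℕ}
    [IsProbabilityMeasure μ] (hμ : IsTilt w μ) (E : Set (Fin n → ℕ)) :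
    (allocLaw w m n).real E = (iidLaw μ n).real (E ∩ {y | ∑ i, (y i : ℤ) = m}) /
      (iidLaw μ n).real {y | ∑ i, (y i : ℤ) = m} := by
  classical
  obtain ⟨t, φ, ht, hφ, h⟩ := hμ
  have hiid : ∀ E : Set (Fin n → ℕ), (iidLaw μ n).real (E ∩ {y | ∑ i, (y i : ℤ) = m}) =
      t ^ m / φ ^ n * ∑ y ∈ Finset.Nat.antidiagonalTuple n m with y ∈ E, ∏ i, (w (y i) : ℝ) := by
    intro E
    have : E ∩ {y | ∑ i, (y i : ℤ) = m} =
        ↑({y ∈ Finset.Nat.antidiagonalTuple n m | y ∈ E}) := by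
      ext y
      simp only [Set.mem_inter_iff, Set.mem_ofPred_eq, Finset.coe_filter,
        Finset.Nat.mem_antidiagonalTuple]
      rw [and_comm]
      have : ∑ i, (y i : ℤ) = m ↔ ∑ i, y i = m := by norm_cast
      rw [this]
    rw [this, ← sum_measureReal_singleton, Finset.mul_sum]
    refine Finset.sum_congr rfl fun y hy => ?_
    rw [iidLaw, measureReal_pi_singleton]
    simp_rw [h]
    have hsum : ∑ i, y i = m := Finset.Nat.mem_antidiagonalTuple.1 (Finset.mem_filter.1 hy).1
    rw [Finset.prod_div_distrib, Finset.prod_mul_distrib, Finset.prod_pow_eq_pow_sum, hsum]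
    simp
    ring
  have halloc : (allocLaw w m n).real E =
      (∑ y ∈ Finset.Nat.antidiagonalTuple n m with y ∈ E, ∏ i, (w (y i) : ℝ)) /
        partitionFn w m n := by
    rw [allocLaw, measureReal_def, Measure.finsetSum_apply, ENNReal.toReal_sum]
    · rw [Finset.sum_filter, Finset.sum_div]
      refine Finset.sum_congr rfl fun y _ => ?_
      rw [Measure.smul_apply, Measure.dirac_apply]
      by_cases hy : y ∈ E
      · simp [hy, ENNReal.smul_def]
      · simp [hy]
    · intro y _
      exact measure_ne_top _ _
  have h1 : (iidLaw μ n).real {y | ∑ i, (y i : ℤ) = m} = t ^ m / φ ^ n * partitionFn w m n := by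
    have h2 := hiid Set.univ
    rw [Set.univ_inter] at h2
    rw [h2]
    congr 1
    simp [partitionFn]
  rw [halloc, h1, hiid E]
  have : (0 : ℝ) < partitionFn w m n := by exact_mod_cast hZ
  have : 0 < t ^ m / φ ^ n := by positivity
  rw [mul_div_mul_left _ _ this.ne']

/-- An event on `ι → ℕ` that depends only on the pairs `(i, y i)` with `i ∈ B` and `y i ∈ A`. -/
def DeterminedBy {ι : Type*} (B : Finset ι) (A : Set ℕ) (E : Set (ι → ℕ)) : Prop :=
  ∀ y ∈ E, ∀ y' : ι → ℕ, (∀ i ∈ B, y i ∈ A ∨ y' i ∈ A → y i = y' i) → y' ∈ E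

/-- Möbius inversion on the Boolean lattice, with the sign of `|I \ K|` written through `|I| + |K|`.
The induction applies the claim both to `F` and to `F ∘ insert a`. -/
lemma sum_powerset_moebius {ι : Type*} [DecidableEq ι] (F : Finset ι → ℝ) (J : Finset ι) :
    ∑ I ∈ J.powerset, ∑ K ∈ I.powerset, (-1) ^ (I.card + K.card) * F K = F J := by
  induction J using Finset.induction_on generalizing F with
  | empty => simp
  | insert a J ha ih =>
    rw [Finset.sum_powerset_insert ha, ih]
    have : ∀ I ∈ J.powerset, ∑ K ∈ (insert a I).powerset,
        (-1) ^ ((insert a I).card + K.card) * F K =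
        -∑ K ∈ I.powerset, (-1) ^ (I.card + K.card) * F K +
        ∑ K ∈ I.powerset, (-1) ^ (I.card + K.card) * F (insert a K) := by
      intro I hI
      have haI : a ∉ I := fun h => ha (Finset.mem_powerset.1 hI h)
      rw [Finset.sum_powerset_insert haI, ← Finset.sum_neg_distrib]
      congr 1
      · refine Finset.sum_congr rfl fun K _ => ?_
        rw [Finset.card_insert_of_notMem haI]; ring
      · refine Finset.sum_congr rfl fun K hK => ?_
        have haK : a ∉ K := fun h => haI (Finset.mem_powerset.1 hK h)
        rw [Finset.card_insert_of_notMem haI, Finset.card_insert_of_notMem haK]; ring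
    rw [Finset.sum_congr rfl this, Finset.sum_add_distrib, Finset.sum_neg_distrib, ih,
      ih (fun K => F (insert a K))]
    ring

open Classical in
/-- An indicator of an event determined by a configuration is a combination of functions, each
of which depends on few coordinates. -/
lemma DeterminedBy.exists_expansion {ι : Type*} {B : Finset ι} {A : Set ℕ} {E : Set (ι → ℕ)}
    (hE : DeterminedBy B A E) : ∃ G : Finset ι → (ι → ℕ) → ℝ,
      (∀ I y, |G I y| ≤ 2 ^ I.card) ∧
      (∀ I y y', (∀ i ∈ I, y i = y' i) → G I y = G I y') ∧
      ∀ y, E.indicator (fun _ => (1 : ℝ)) y =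
        ∑ I ∈ B.powerset, if ∀ i ∈ I, y i ∈ A then G I y else 0 := by
  -- `F J y` asks whether `E` is compatible with the contents `y` on `J` and with no other box of
  -- `B` in `A`. It sees `y` only on `J`, and for `J = {i ∈ B | y i ∈ A}` it is the indicator of `E`
  -- because `E` is determined by these data.
  set F : Finset ι → (ι → ℕ) → ℝ := fun J y =>
    if ∃ y' ∈ E, (∀ i ∈ J, y' i = y i) ∧ ∀ i ∈ B, i ∉ J → y' i ∉ A then 1 else 0
  have hF : ∀ J y, |F J y| ≤ 1 := fun J y => by
    simp only [F]; split_ifs <;> simp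
  refine ⟨fun I y => ∑ K ∈ I.powerset, (-1) ^ (I.card + K.card) * F K y, fun I y => ?_,
    fun I y y' h => ?_, fun y => ?_⟩
  · refine (Finset.abs_sum_le_sum_abs _ _).trans ?_
    have : ∀ K ∈ I.powerset, |(-1) ^ (I.card + K.card) * F K y| ≤ 1 := fun K _ => by
      rw [abs_mul, abs_pow, abs_neg, abs_one, one_pow, one_mul]; exact hF K y
    refine (Finset.sum_le_card_nsmul _ _ 1 this).trans ?_
    simp
  · refine Finset.sum_congr rfl fun K hK => ?_
    have hKI := Finset.mem_powerset.1 hK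
    have : F K y = F K y' := by
      simp only [F]
      congr 1
      refine propext (exists_congr fun z => and_congr_right fun _ => and_congr_left fun _ => ?_)
      exact forall₂_congr fun i hi => by rw [h i (hKI hi)]
    rw [this]
  · set J := {i ∈ B | y i ∈ A} with hJ
    have h1 : ∑ I ∈ B.powerset, (if ∀ i ∈ I, y i ∈ A then
        ∑ K ∈ I.powerset, (-1) ^ (I.card + K.card) * F K y else 0) = F J y := by
      rw [← Finset.sum_filter, ← sum_powerset_moebius (fun K => F K y) J]
      refine Finset.sum_congr ?_ fun _ _ => rfl
      ext I
      simp only [Finset.mem_filter, Finset.mem_powerset, hJ, Finset.subset_iff]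
      exact ⟨fun h i hi => ⟨h.1 hi, h.2 i hi⟩, fun h => ⟨fun i hi => (h hi).1, fun i hi => (h hi).2⟩⟩
    rw [h1, Set.indicator_apply]
    simp only [F]
    congr 1
    refine propext ⟨fun hy => ⟨y, hy, fun _ _ => rfl, fun i hi hiJ hA => ?_⟩, ?_⟩
    · exact hiJ (by simp [hJ, hi, hA])
    · rintro ⟨z, hz, hzJ, hzB⟩
      refine hE z hz y fun i hi h => ?_
      by_cases hiJ : i ∈ J
      · exact hzJ i hiJ
      · exact (h.elim (hzB i hi hiJ) fun hA => hiJ (by simp [hJ, hi, hA])).elim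

/-! ### Total variation distance of configurations -/

/-- Fubini for the splitting into the boxes of `I` and the others: `H` sees only the former, so the
inner integral is the probability that the others hold the remaining balls. -/
lemma integral_mul_indicator_sum_eq {ι : Type*} [Fintype ι] [DecidableEq ι] (μ : Measure ℕ)
    [IsProbabilityMeasure μ] (I : Finset ι) {H : (ι → ℕ) → ℝ} {b : ℝ} (hb : ∀ y, |H y| ≤ b)
    (hH : ∀ y y', (∀ i ∈ I, y i = y' i) → H y = H y') (m : ℤ) :
    ∫ y, H y * Set.indicator {y : ι → ℕ | ∑ i, (y i : ℤ) = m} (fun _ => (1 : ℝ)) y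
        ∂(Measure.pi fun _ : ι => μ) =
      ∫ y, H y * (Measure.pi fun _ : {i // i ∉ I} => μ).real
        {z | ∑ i, (z i : ℤ) = m - ∑ i ∈ I, (y i : ℤ)} ∂(Measure.pi fun _ : ι => μ) := by
  set e := MeasurableEquiv.piEquivPiSubtypeProd (fun _ : ι => ℕ) (· ∈ I)
  have mp : MeasurePreserving e (Measure.pi fun _ : ι => μ)
      ((Measure.pi fun _ : {i // i ∈ I} => μ).prod (Measure.pi fun _ : {i // i ∉ I} => μ)) :=
    by convert! measurePreserving_piEquivPiSubtypeProd (fun _ : ι => μ) (· ∈ I)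
  have hI : ∀ (f : (ι → ℕ) → ℝ) (c : ℝ), (∀ y, |f y| ≤ c) →
      ∫ y, f y ∂(Measure.pi fun _ : ι => μ) =
      ∫ u, ∫ v, f (e.symm (u, v)) ∂(Measure.pi fun _ : {i // i ∉ I} => μ)
        ∂(Measure.pi fun _ : {i // i ∈ I} => μ) := by
    intro f c hc
    rw [← integral_prod (fun z => f (e.symm z))
      (Integrable.of_bound Measurable.of_discrete.aestronglyMeasurable c
        (ae_of_all _ fun z => hc _)), ← mp.integral_comp']
    simp
  have hsymm1 : ∀ u v i, (hi : i ∈ I) → e.symm (u, v) i = u ⟨i, hi⟩ := by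
    intro u v i hi
    simp [e, MeasurableEquiv.piEquivPiSubtypeProd, Equiv.piEquivPiSubtypeProd, hi]
  have hsymm2 : ∀ u v i, (hi : i ∉ I) → e.symm (u, v) i = v ⟨i, hi⟩ := by
    intro u v i hi
    simp [e, MeasurableEquiv.piEquivPiSubtypeProd, Equiv.piEquivPiSubtypeProd, hi]
  have hsumI : ∀ u v, ∑ i ∈ I, (e.symm (u, v) i : ℤ) = ∑ i, (u i : ℤ) := by
    intro u v
    rw [← Finset.sum_coe_sort I]
    exact Finset.sum_congr rfl fun i _ => by rw [hsymm1 u v i.1 i.2]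
  have hsum : ∀ u v, ∑ i, (e.symm (u, v) i : ℤ) = ∑ i, (u i : ℤ) + ∑ i, (v i : ℤ) := by
    intro u v
    rw [← Fintype.sum_subtype_add_sum_subtype (· ∈ I)]
    congr 1
    · exact Finset.sum_congr (by ext; simp) fun i _ => by rw [hsymm1 u v i.1 i.2]
    · exact Finset.sum_congr rfl fun i _ => by rw [hsymm2 u v i.1 i.2]
  have hHuv : ∀ u v, H (e.symm (u, v)) = H (e.symm (u, 0)) := fun u v =>
    hH _ _ fun i hi => by rw [hsymm1 _ _ i hi, hsymm1 _ _ i hi]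
  have hb0 : 0 ≤ b := (abs_nonneg _).trans (hb 0)
  rw [hI _ b, hI _ b]
  · refine integral_congr_ae (ae_of_all _ fun u => ?_)
    simp only [hsumI, hHuv u]
    rw [integral_const_mul, integral_const, probReal_univ, one_smul]
    congr 1
    rw [← integral_indicator_one (Set.to_countable _).measurableSet]
    congr 1; ext v
    simp only [Set.indicator_apply, Set.mem_ofPred_eq, hsum, eq_sub_iff_add_eq, Pi.one_apply]
    rw [add_comm]
  · intro y
    rw [abs_mul]
    refine (mul_le_mul (hb y) (abs_le.2 ⟨?_, ?_⟩) (abs_nonneg _) hb0).trans (mul_one b).le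
    · linarith [measureReal_nonneg (μ := Measure.pi fun _ : {i // i ∉ I} => μ)
        (s := {z | ∑ i, (z i : ℤ) = m - ∑ i ∈ I, (y i : ℤ)})]
    · exact measureReal_le_one
  · intro y
    rw [abs_mul]
    refine (mul_le_mul (hb y) ?_ (abs_nonneg _) hb0).trans (mul_one b).le
    rw [Set.indicator_apply]; split_ifs <;> simp

-- This is the expected size of the error term for one `I`. The integrand is a sum over `j ∈ I` of
-- products over coordinates, so independence gives one factor `E[ξ + 1; A]` and `|I| - 1` factors
-- `P(A)`.
open Classical in
lemma integral_configuration_sum {ι : Type*} [Fintype ι] (μ : Measure ℕ)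
    [IsProbabilityMeasure μ] (hint : Integrable (fun k : ℕ => (k : ℝ)) μ) (I : Finset ι)
    (A : Set ℕ) :
    Integrable (fun y : ι → ℕ => if ∀ i ∈ I, y i ∈ A then ∑ i ∈ I, (y i : ℝ) + I.card else 0)
      (Measure.pi fun _ : ι => μ) ∧
    ∫ y, (if ∀ i ∈ I, y i ∈ A then ∑ i ∈ I, (y i : ℝ) + I.card else 0)
        ∂(Measure.pi fun _ : ι => μ) =
      I.card * (∫ k in A, ((k : ℝ) + 1) ∂μ) * μ.real A ^ (I.card - 1) := by
  have hA : MeasurableSet A := A.to_countable.measurableSet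
  set f : ι → ι → ℕ → ℝ := fun j i k =>
    if i = j then A.indicator (fun k => (k : ℝ) + 1) k
    else if i ∈ I then A.indicator (fun _ => 1) k else 1
  have hf : ∀ j i, Integrable (f j i) μ := by
    intro j i
    simp only [f]
    split_ifs
    · exact (hint.add (integrable_const _)).indicator hA
    · exact (integrable_const _).indicator hA
    · exact integrable_const _
  have hprod : ∀ j, Integrable (fun y : ι → ℕ => ∏ i, f j i (y i)) (Measure.pi fun _ : ι => μ) :=
    fun j => Integrable.fintype_prod (hf j)
  have hval : ∀ j ∈ I, ∫ y, ∏ i, f j i (y i) ∂(Measure.pi fun _ : ι => μ) =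
      (∫ k in A, ((k : ℝ) + 1) ∂μ) * μ.real A ^ (I.card - 1) := by
    intro j hj
    rw [integral_fintype_prod_eq_prod, ← Finset.mul_prod_erase _ _ (Finset.mem_univ j)]
    congr 1
    · simp only [f, if_true]
      rw [integral_indicator hA]
    · rw [← Finset.card_erase_of_mem hj, ← Finset.prod_const]
      rw [← Finset.prod_subset (Finset.erase_subset_erase j (Finset.subset_univ I))]
      · refine Finset.prod_congr rfl fun i hi => ?_
        obtain ⟨h1, h2⟩ := Finset.mem_erase.1 hi
        simp only [f, h1, h2, if_true, if_false]
        rw [integral_indicator_const _ hA]; simp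
      · intro i hi hi'
        have h1 := (Finset.mem_erase.1 hi).1
        have h2 : i ∉ I := fun h => hi' (Finset.mem_erase.2 ⟨h1, h⟩)
        simp [f, h1, h2]
  have heq : (fun y : ι → ℕ => if ∀ i ∈ I, y i ∈ A then ∑ i ∈ I, (y i : ℝ) + I.card else 0) =
      fun y => ∑ j ∈ I, ∏ i, f j i (y i) := by
    ext y
    have hone : ∀ i j, i ∉ I → j ∈ I → f j i (y i) = 1 := fun i j hi hj => by
      have : i ≠ j := fun h => hi (h ▸ hj)
      simp [f, this, hi]
    have hp : ∀ j ∈ I, ∏ i, f j i (y i) = ∏ i ∈ I, f j i (y i) := fun j hj =>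
      (Finset.prod_subset (Finset.subset_univ I) fun i _ hi => hone i j hi hj).symm
    split_ifs with h
    · have : ∀ j ∈ I, ∏ i, f j i (y i) = (y j : ℝ) + 1 := by
        intro j hj
        rw [hp j hj, ← Finset.mul_prod_erase _ _ hj, Finset.prod_eq_one, mul_one]
        · simp [f, h j hj]
        · intro i hi
          obtain ⟨h1, h2⟩ := Finset.mem_erase.1 hi
          simp [f, h1, h2, h i h2]
      rw [Finset.sum_congr rfl this, Finset.sum_add_distrib]
      simp
    · push Not at h
      obtain ⟨i, hi, hiA⟩ := h
      refine (Finset.sum_eq_zero fun j hj => ?_).symm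
      rw [hp j hj]
      refine Finset.prod_eq_zero hi ?_
      simp only [f]
      split_ifs <;> simp [hiA]
  rw [heq]
  refine ⟨integrable_finsetSum _ fun j _ => hprod j, ?_⟩
  rw [integral_finsetSum _ fun j _ => hprod j, Finset.sum_congr rfl hval, Finset.sum_const,
    nsmul_eq_mul, mul_assoc]

/-- Group by cardinality, use `(k+1) C(b+1, k+1) = (b+1) C(b, k)` and the binomial theorem, and
bound `(1 + 2p)^b` by `e^{2bp}`. -/
lemma sum_powerset_two_pow_mul_le {ι : Type*} (B : Finset ι) {e p : ℝ} (he : 0 ≤ e)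
    (hp : 0 ≤ p) : ∑ I ∈ B.powerset, 2 ^ I.card * (I.card * e * p ^ (I.card - 1)) ≤
      2 * e * B.card * Real.exp (2 * (B.card * p)) := by
  rw [Finset.sum_powerset_apply_card (fun k : ℕ => (2 : ℝ) ^ k * (k * e * p ^ (k - 1)))]
  rcases Nat.eq_zero_or_pos B.card with h | h
  · simp [h]
  obtain ⟨b, hb⟩ := Nat.exists_eq_succ_of_ne_zero h.ne'
  rw [hb, Finset.sum_range_succ']
  simp only [Nat.cast_zero, zero_mul, mul_zero, smul_zero, add_zero, nsmul_eq_mul]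
  have h1 : ∀ k ∈ Finset.range b.succ, ((b.succ.choose (k + 1) : ℕ) : ℝ) *
      (2 ^ (k + 1) * (((k + 1 : ℕ) : ℝ) * e * p ^ (k + 1 - 1))) =
      (2 * e * (b.succ : ℕ)) * ((2 * p) ^ k * 1 ^ (b - k) * (b.choose k : ℕ)) := by
    intro k _
    have : ((b.succ.choose (k + 1) : ℕ) : ℝ) * ((k + 1 : ℕ) : ℝ) =
        (b.succ : ℕ) * (b.choose k : ℕ) := by
      exact_mod_cast (Nat.add_one_mul_choose_eq b k).symm
    rw [Nat.add_sub_cancel, mul_pow, one_pow]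
    linear_combination (2 ^ (k + 1) * e * p ^ k) * this
  rw [Finset.sum_congr rfl h1, ← Finset.mul_sum, ← add_pow]
  gcongr
  calc (2 * p + 1) ^ b ≤ Real.exp (2 * p) ^ b := by
        gcongr; exact Real.add_one_le_exp _
    _ = Real.exp (b * (2 * p)) := by rw [← Real.exp_nat_mul]
    _ ≤ _ := by
      rw [Real.exp_le_exp]
      have : ((b.succ : ℕ) : ℝ) = b + 1 := by push_cast; ring
      rw [this]; nlinarith

/-- Both terms are expanded over `I ⊆ B`. They differ in the term of `I` only by having the local
probability of the boxes outside `I` in place of `P`, and the hypothesis bounds that difference by a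
quantity of known mean. In the application `P = P(S_n = m)` and `c` is of order `P/√n`. -/
lemma abs_measureReal_inter_sub_le {ι : Type*} [Fintype ι] [DecidableEq ι] (μ : Measure ℕ)
    [IsProbabilityMeasure μ] (hint : Integrable (fun k : ℕ => (k : ℝ)) μ) {B : Finset ι}
    {A : Set ℕ} {E : Set (ι → ℕ)} (hE : DeterminedBy B A E) (m : ℤ) {c P : ℝ}
    (hc : ∀ I : Finset ι, ∀ᵐ y ∂(Measure.pi fun _ : ι => μ),
      |(Measure.pi fun _ : {i // i ∉ I} => μ).real
        {z | ∑ i, (z i : ℤ) = m - ∑ i ∈ I, (y i : ℤ)} - P| ≤ c * (∑ i ∈ I, (y i : ℝ) + I.card)) :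
    |(Measure.pi fun _ : ι => μ).real (E ∩ {y | ∑ i, (y i : ℤ) = m}) -
      (Measure.pi fun _ : ι => μ).real E * P| ≤
      c * (2 * (∫ k in A, ((k : ℝ) + 1) ∂μ) * B.card *
        Real.exp (2 * (B.card * μ.real A))) := by
  classical
  set π := Measure.pi fun _ : ι => μ
  have hms : ∀ E : Set (ι → ℕ), MeasurableSet E := fun E => E.to_countable.measurableSet
  obtain ⟨G, hGb, hGI, hexp⟩ := hE.exists_expansion
  set H : Finset ι → (ι → ℕ) → ℝ := fun I y => if ∀ i ∈ I, y i ∈ A then G I y else 0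
  have hexp' : ∀ y, E.indicator (fun _ => (1 : ℝ)) y = ∑ I ∈ B.powerset, H I y := fun y => by
    convert! hexp y
  have hHb : ∀ I y, |H I y| ≤ 2 ^ I.card := by
    intro I y
    simp only [H]
    split_ifs
    · exact hGb I y
    · simp
  have hHI : ∀ I y y', (∀ i ∈ I, y i = y' i) → H I y = H I y' := by
    intro I y y' h
    simp only [H]
    rw [hGI I y y' h]
    have : (∀ i ∈ I, y i ∈ A) ↔ ∀ i ∈ I, y' i ∈ A := forall₂_congr fun i hi => by rw [h i hi]
    simp only [this]
  have hbdd : ∀ (f : (ι → ℕ) → ℝ) (b : ℝ), (∀ y, |f y| ≤ b) → Integrable f π := fun f b hb =>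
    Integrable.of_bound Measurable.of_discrete.aestronglyMeasurable b (ae_of_all _ hb)
  set χ : (ι → ℕ) → ℝ := Set.indicator {y : ι → ℕ | ∑ i, (y i : ℤ) = m} (fun _ => (1 : ℝ))
  have hχ : ∀ y, |χ y| ≤ 1 := fun y => by
    simp only [χ, Set.indicator_apply]; split_ifs <;> simp
  have hHχ : ∀ I, Integrable (fun y => H I y * χ y) π := fun I =>
    hbdd _ (2 ^ I.card) fun y => by
      rw [abs_mul]
      exact (mul_le_mul (hHb I y) (hχ y) (abs_nonneg _) (by positivity)).trans (mul_one _).le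
  have h1 : π.real (E ∩ {y | ∑ i, (y i : ℤ) = m}) =
      ∑ I ∈ B.powerset, ∫ y, H I y * χ y ∂π := by
    rw [← integral_finsetSum _ fun I _ => hHχ I, ← integral_indicator_one (hms _)]
    congr 1; ext y
    rw [← Finset.sum_mul, ← hexp' y]
    simp only [χ, Set.indicator_apply, Set.mem_inter_iff, Pi.one_apply]
    split_ifs <;> simp_all
  have h2 : π.real E * P = ∑ I ∈ B.powerset, ∫ y, H I y * P ∂π := by
    rw [← integral_finsetSum _ fun I _ => (hbdd _ _ (hHb I)).mul_const P,
      ← integral_indicator_one (hms _), ← integral_mul_const]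
    congr 1; ext y
    rw [← Finset.sum_mul, ← hexp' y]
    rfl
  rw [h1, h2, ← Finset.sum_sub_distrib]
  refine (Finset.abs_sum_le_sum_abs _ _).trans ?_
  have h3 : ∀ I ∈ B.powerset, |∫ y, H I y * χ y ∂π - ∫ y, H I y * P ∂π| ≤
      c * (2 ^ I.card * (I.card * (∫ k in A, ((k : ℝ) + 1) ∂μ) * μ.real A ^ (I.card - 1))) := by
    intro I _
    obtain ⟨hci, hcv⟩ := integral_configuration_sum (ι := ι) μ hint I A
    rw [integral_mul_indicator_sum_eq μ I (hHb I) (hHI I) m, ← integral_sub, ← hcv,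
      ← integral_const_mul, ← integral_const_mul, ← Real.norm_eq_abs]
    · refine norm_integral_le_of_norm_le ((hci.const_mul _).const_mul _) ?_
      filter_upwards [hc I] with y hy
      rw [← mul_sub, norm_mul, Real.norm_eq_abs, Real.norm_eq_abs]
      have := hHb I y
      simp only [H] at this ⊢
      split_ifs at this ⊢ with h
      · calc _ ≤ 2 ^ I.card * (c * (∑ i ∈ I, (y i : ℝ) + I.card)) := by gcongr
          _ = _ := by ring
      · simp
    · refine hbdd _ (2 ^ I.card) fun y => ?_
      rw [abs_mul, abs_of_nonneg (measureReal_nonneg (μ := Measure.pi fun _ : {i // i ∉ I} => μ))]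
      exact (mul_le_mul (hHb I y) measureReal_le_one measureReal_nonneg (by positivity)).trans
        (mul_one _).le
    · exact (hbdd _ _ (hHb I)).mul_const P
  refine (Finset.sum_le_sum h3).trans ?_
  rw [← Finset.mul_sum]
  -- The hypothesis at a singleton forces `c ≥ 0`, so a negative `c` is possible only if there are
  -- no boxes.
  have hc0 : 0 ≤ c ∨ B = ∅ := by
    by_contra! h
    obtain ⟨i, hi⟩ := h.2
    obtain ⟨y, hy⟩ := (hc {i}).exists
    have := (abs_nonneg _).trans hy
    have h4 : (0 : ℝ) < ∑ i ∈ {i}, (y i : ℝ) + ({i} : Finset ι).card := by simp; positivity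
    nlinarith [h.1]
  have he : 0 ≤ ∫ k in A, ((k : ℝ) + 1) ∂μ := integral_nonneg fun k => by positivity
  rcases hc0 with hc0 | rfl
  · exact mul_le_mul_of_nonneg_left (sum_powerset_two_pow_mul_le B he measureReal_nonneg) hc0
  · simp

/-- Any configuration of few boxes of the random allocation is close in total variation to the same
configuration for i.i.d. variables with law `μ n`. -/
def ConfigurationsClose (w : ℕ → ℝ≥0) (m : ℕ → ℕ) (S : Set ℕ) (μ : ℕ → Measure ℕ) : Prop :=
  ∀ C ε : ℝ, 0 < ε → ∀ᶠ n in atTop ⊓ 𝓟 S, ∀ (B : Finset (Fin n)) (A : Set ℕ),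
    B.card * (μ n).real A ≤ C → ∀ E : Set (Fin n → ℕ), DeterminedBy B A E →
      |(allocLaw w (m n) n).real E - (iidLaw (μ n) n).real E| ≤ ε

lemma dvd_of_partitionFn_pos {w : ℕ → ℝ≥0} {d m n : ℕ} (hd : ∀ k, 0 < w k → d ∣ k)
    (hZ : 0 < partitionFn w m n) : d ∣ m := by
  obtain ⟨y, hy, hpos⟩ := Finset.exists_ne_zero_of_sum_ne_zero hZ.ne'
  rw [← Finset.Nat.mem_antidiagonalTuple.1 hy]
  exact Finset.dvd_sum fun i _ => hd _
    (pos_iff_ne_zero.2 fun h => hpos (Finset.prod_eq_zero (Finset.mem_univ i) h))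

lemma tendsto_tail_zero {l : Filter ℕ} {q : ℕ → ℝ} (hq0 : ∀ k, 0 ≤ q k)
    (hq : Summable q) {x : ℕ → ℝ} (hx : Tendsto x l atTop) :
    Tendsto (fun n => ∑' k : ℕ, if x n < k then q k else 0) l (𝓝 0) := by
  have h := tendsto_tsum_of_dominated_convergence (𝓕 := l)
    (f := fun n (k : ℕ) => if x n < k then q k else 0) (g := fun _ => 0) hq
    (fun k => by
      refine tendsto_const_nhds.congr' ?_
      filter_upwards [hx.eventually_ge_atTop (k : ℝ)] with n hn
      rw [if_neg (not_lt.2 hn)])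
    (Eventually.of_forall fun n k => by
      split_ifs
      · exact (Real.norm_of_nonneg (hq0 k)).le
      · simpa using hq0 k)
  simpa using h

/-- Truncation at `x`: small values cost at most `x + 1` each, and for `k > x` the value `k` is at
most `(2/x)(k² + 1)`, so that large values are paid for by the tail of the second moment with a
factor `1/x`. -/
lemma setIntegral_add_one_le {μ : Measure ℕ} [IsProbabilityMeasure μ] {q : ℕ → ℝ}
    (hq : Summable fun k : ℕ => ((k : ℝ) ^ 2 + 1) * q k) (hle : ∀ k, μ.real {k} ≤ q k)
    (A : Set ℕ) {x : ℝ} (hx : 0 < x) :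
    ∫ k in A, ((k : ℝ) + 1) ∂μ ≤ (x + 1) * μ.real A +
      2 / x * ∑' k : ℕ, if x < k then ((k : ℝ) ^ 2 + 1) * q k else 0 := by
  have hq0 : ∀ k, 0 ≤ q k := fun k => measureReal_nonneg.trans (hle k)
  set f : ℕ → ℝ := fun k => if x < k then (k : ℝ) ^ 2 + 1 else 0
  have hf0 : ∀ k, 0 ≤ f k := fun k => by simp only [f]; split_ifs <;> positivity
  have hf : Integrable f μ := integrable_of_le hq hle (C := 1) fun k => by
    rw [Real.norm_of_nonneg (hf0 k), one_mul]
    simp only [f]; split_ifs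
    · exact le_rfl
    · positivity
  have h1 : ∀ k : ℕ, (k : ℝ) + 1 ≤ (x + 1) + 2 / x * f k := by
    intro k
    simp only [f]
    split_ifs with h
    · have : (k : ℝ) * x ≤ 2 * ((k : ℝ) ^ 2 + 1) := by nlinarith
      have : (k : ℝ) ≤ 2 / x * ((k : ℝ) ^ 2 + 1) := by
        rw [div_mul_eq_mul_div, le_div_iff₀ hx]; exact this
      linarith
    · push Not at h; linarith
  have hid := integrable_id_of_le hq hle
  calc ∫ k in A, ((k : ℝ) + 1) ∂μ ≤ ∫ k in A, ((x + 1) + 2 / x * f k) ∂μ :=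
        setIntegral_mono (hid.add (integrable_const _)).integrableOn
          ((integrable_const _).add (hf.const_mul _)).integrableOn h1
    _ = (x + 1) * μ.real A + 2 / x * ∫ k in A, f k ∂μ := by
        rw [integral_add (integrable_const _).integrableOn (hf.const_mul _).integrableOn,
          integral_const_mul]
        simp [mul_comm]
    _ ≤ _ := by
        gcongr
        refine (setIntegral_le_integral hf (ae_of_all _ hf0)).trans ?_
        rw [integral_countable hf]
        have hs2 : Summable fun k : ℕ => if x < k then ((k : ℝ) ^ 2 + 1) * q k else 0 := by
          refine Summable.of_nonneg_of_le (fun k => ?_) (fun k => ?_) hq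
          · have := hq0 k; split_ifs <;> positivity
          · have := hq0 k; split_ifs
            · exact le_rfl
            · positivity
        have h2 : ∀ k : ℕ, μ.real {k} • f k ≤ if x < k then ((k : ℝ) ^ 2 + 1) * q k else 0 := by
          intro k
          simp only [f, smul_eq_mul]
          split_ifs
          · rw [mul_comm]; gcongr; exact hle k
          · simp
        exact Summable.tsum_le_tsum h2
          (Summable.of_nonneg_of_le (fun k => mul_nonneg measureReal_nonneg (hf0 k)) h2 hs2) hs2

/-- The expansion with relative error `C(s + k)/√n` gives a total error at most `D |B| e / √n`,
where `e = E[ξ + 1; A]`. Truncation at `η√n`, `|B| P(A) ≤ C₁` and `|B| ≤ n` turn this into `D (C₁ (η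
+ 1/√n) + (2/η) T n)`, where `T n` is a tail of a convergent series. -/
theorem DominatedLaws.configurationsClose {S : Set ℕ} {w : ℕ → ℝ≥0} (hw0 : 0 < w 0) {k₁ : ℕ}
    (hk₁ : k₁ ≠ 0) (hwk₁ : 0 < w k₁) {m : ℕ → ℕ} (hZ : ∀ n ∈ S, 0 < partitionFn w (m n) n)
    {μ : ℕ → Measure ℕ} {μ₀ : Measure ℕ} {q : ℕ → ℝ}
    (H : DominatedLaws (atTop ⊓ 𝓟 S) μ μ₀ q) (hμ₀ : IsTilt w μ₀)
    (hμ : ∀ᶠ n in atTop ⊓ 𝓟 S, IsTilt w (μ n))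
    (hm : (fun n : ℕ => (m n : ℝ) - n * ∫ k : ℕ, (k : ℝ) ∂(μ n))
      =o[atTop ⊓ 𝓟 S] (fun n : ℕ => √(n : ℝ))) :
    ConfigurationsClose w m S μ := by
  intro C₀ ε hε
  rcases (atTop ⊓ 𝓟 S : Filter ℕ).eq_or_neBot with hbot | hne
  · rw [hbot]; exact eventually_bot
  obtain ⟨d, hd, hdvd, C, hC, hratio⟩ := H.exists_norm_locProb_sub_le hw0 hk₁ hwk₁ hμ₀ hm
  have hq0 : ∀ k, 0 ≤ q k := fun k => by
    obtain ⟨n, hn⟩ := H.le.exists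
    exact measureReal_nonneg.trans (hn k)
  set C₁ := |C₀|
  set D := 2 * C * Real.exp (2 * C₁)
  have hD : 0 < D := by positivity
  -- `D C₁ η` is the only part of the final bound that does not vanish as `n → ∞`, so `η` is fixed
  -- first.
  obtain ⟨η, hη, hηε⟩ : ∃ η > 0, D * (C₁ * η) < ε := by
    refine ⟨ε / (2 * (D * (C₁ + 1))), by positivity, ?_⟩
    have h1 : D * (C₁ * (ε / (2 * (D * (C₁ + 1))))) = ε / 2 * (C₁ / (C₁ + 1)) := by
      field_simp
    have h2 : C₁ / (C₁ + 1) ≤ 1 := div_le_one_of_le₀ (by linarith) (by positivity)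
    rw [h1]; nlinarith
  have hsqrt : Tendsto (fun n : ℕ => √(n : ℝ)) (atTop ⊓ 𝓟 S) atTop :=
    (Real.tendsto_sqrt_atTop.comp tendsto_natCast_atTop_atTop).mono_left inf_le_left
  set T : ℕ → ℝ := fun n => ∑' k : ℕ, if η * √(n : ℝ) < k then ((k : ℝ) ^ 2 + 1) * q k else 0
  have hT : Tendsto T (atTop ⊓ 𝓟 S) (𝓝 0) :=
    tendsto_tail_zero (fun k => mul_nonneg (by positivity) (hq0 k)) H.summable
      (hsqrt.const_mul_atTop hη)
  have hT0 : ∀ n, 0 ≤ T n := fun n => tsum_nonneg fun k => by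
    have := hq0 k
    split_ifs <;> positivity
  have hlim : Tendsto (fun n : ℕ => D * (C₁ * (η + 1 / √(n : ℝ)) + 2 / η * T n)) (atTop ⊓ 𝓟 S)
      (𝓝 (D * (C₁ * (η + 0) + 2 / η * 0))) :=
    (((tendsto_const_nhds.add (hsqrt.const_div_atTop 1)).const_mul _).add
      (hT.const_mul _)).const_mul _
  rw [add_zero, mul_zero, add_zero] at hlim
  filter_upwards [hratio, hlim.eventually_le_const hηε, H.prob, H.le, hμ,
    mem_inf_of_left (Ioi_mem_atTop 0), mem_inf_of_right (mem_principal_self S)]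
    with n hn hnε hp hle htilt hn0 hnS B A hBA E hE
  have hn1 : (0 : ℝ) < n := by exact_mod_cast (hn0 : 0 < n)
  have hs0 : 0 < √(n : ℝ) := Real.sqrt_pos.2 hn1
  have hae : ∀ᵐ k ∂(μ n), d ∣ k := htilt.ae_pos.mono hdvd
  have hdm : d ∣ m n := dvd_of_partitionFn_pos hdvd (hZ n hnS)
  set P := (iidLaw (μ n) n).real {y | ∑ i, (y i : ℤ) = m n}
  have hP : ((P : ℝ) : ℂ) = locProb d (μ n) n (m n) := by
    have := measureReal_sum_eq_locProb hd (μ n) hae (ι := Fin n) (s := m n)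
      (by exact_mod_cast hdm)
    rwa [Fintype.card_fin] at this
  have hPn : ‖locProb d (μ n) n (m n)‖ = P := by
    rw [← hP, Complex.norm_real, Real.norm_of_nonneg measureReal_nonneg]
  rw [hPn] at hn
  have hP0 : 0 < P := hn.1
  have key := abs_measureReal_inter_sub_le (μ n) (integrable_id_of_le H.summable hle) hE (m n)
    (c := C / √(n : ℝ) * P) (P := P) fun I => by
      filter_upwards [ae_pi_forall (ι := Fin n) (μ n) hae] with y hy
      have hds : d ∣ ∑ i ∈ I, y i := Finset.dvd_sum fun i _ => hy i
      have h1 := measureReal_sum_eq_locProb hd (μ n) hae (ι := {i : Fin n // i ∉ I})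
        (s := m n - ∑ i ∈ I, (y i : ℤ)) (dvd_sub (by exact_mod_cast hdm) (by exact_mod_cast hds))
      have hcard : Fintype.card {i : Fin n // i ∉ I} = n - I.card := by
        rw [Fintype.card_subtype_compl]; simp
      have h2 := hn.2 I.card (by simpa using I.card_le_univ) (∑ i ∈ I, y i)
      rw [hcard] at h1
      push_cast at h2
      rw [← h1, ← hP, ← Complex.ofReal_sub, Complex.norm_real, Real.norm_eq_abs] at h2
      refine h2.trans (le_of_eq ?_)
      ring
  set e := ∫ k in A, ((k : ℝ) + 1) ∂(μ n)
  have he0 : 0 ≤ e := integral_nonneg fun k => by positivity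
  rw [allocLaw_real_eq (hZ n hnS) htilt]
  have h1 : (iidLaw (μ n) n).real (E ∩ {y | ∑ i, (y i : ℤ) = m n}) / P -
      (iidLaw (μ n) n).real E = ((iidLaw (μ n) n).real (E ∩ {y | ∑ i, (y i : ℤ) = m n}) -
        (iidLaw (μ n) n).real E * P) / P := by
    field_simp
  rw [h1, abs_div, abs_of_pos hP0, div_le_iff₀ hP0]
  refine key.trans ?_
  have hb : (B.card : ℝ) ≤ n := by exact_mod_cast (by simpa using B.card_le_univ)
  have hBA1 : B.card * (μ n).real A ≤ C₁ := hBA.trans (le_abs_self _)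
  have he := setIntegral_add_one_le H.summable hle A (x := η * √(n : ℝ)) (by positivity)
  have h2 : B.card * e / √(n : ℝ) ≤ C₁ * (η + 1 / √(n : ℝ)) + 2 / η * T n := by
    rw [div_le_iff₀ hs0]
    calc B.card * e ≤ B.card * ((η * √(n : ℝ) + 1) * (μ n).real A +
            2 / (η * √(n : ℝ)) * T n) := by gcongr
      _ = (B.card * (μ n).real A) * (η * √(n : ℝ) + 1) + B.card * (2 / (η * √(n : ℝ)) * T n) := by
          ring
      _ ≤ C₁ * (η * √(n : ℝ) + 1) + n * (2 / (η * √(n : ℝ)) * T n) := by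
          have := hT0 n
          gcongr
      _ = _ := by
          have : (n : ℝ) = √(n : ℝ) ^ 2 := (Real.sq_sqrt hn1.le).symm
          rw [this]
          field_simp
          rw [Real.sqrt_sq hs0.le]
          ring
  have hDle : 2 * C * Real.exp (2 * (B.card * (μ n).real A)) ≤ D := by
    simp only [D]
    gcongr
  calc C / √(n : ℝ) * P * (2 * e * B.card * Real.exp (2 * (B.card * (μ n).real A)))
      = 2 * C * Real.exp (2 * (B.card * (μ n).real A)) * (B.card * e / √(n : ℝ)) * P := by ring
    _ ≤ D * (C₁ * (η + 1 / √(n : ℝ)) + 2 / η * T n) * P :=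
        mul_le_mul_of_nonneg_right (mul_le_mul hDle h2 (by positivity) hD.le) hP0.le
    _ ≤ ε * P := by gcongr

/-! ### Changing the law of the i.i.d. variables -/

/-- With the other coordinates fixed, the section of `E` treats all values outside `A` alike. So the
section or its complement lies in `A`, and complementary sets have the same discrepancy. -/
lemma abs_measureReal_pi_sub_le_of_eq_off {n : ℕ} {ν ν' : Fin n → Measure ℕ}
    [∀ i, IsProbabilityMeasure (ν i)] [∀ i, IsProbabilityMeasure (ν' i)] {i : Fin n}
    (hνν' : ∀ j ≠ i, ν j = ν' j) {A : Set ℕ} {E : Set (Fin n → ℕ)}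
    (hE : ∀ y ∈ E, ∀ x, y i ∉ A → x ∉ A → Function.update y i x ∈ E) {δ : ℝ}
    (hδ : ∀ F ⊆ A, |(ν i).real F - (ν' i).real F| ≤ δ) :
    |(Measure.pi ν).real E - (Measure.pi ν').real E| ≤ δ := by
  classical
  obtain ⟨n, rfl⟩ : ∃ k, n = k + 1 := ⟨n - 1, by have := i.pos; omega⟩
  have hms : ∀ F : Set ℕ, MeasurableSet F := fun F => F.to_countable.measurableSet
  set e := MeasurableEquiv.piFinSuccAbove (fun _ : Fin (n + 1) => ℕ) i
  have hrest : (fun j => ν (i.succAbove j)) = fun j => ν' (i.succAbove j) := by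
    ext1 j; exact hνν' _ (Fin.succAbove_ne i j)
  set ρ := Measure.pi fun j => ν (i.succAbove j)
  have hval : ∀ (ν₁ : Fin (n + 1) → Measure ℕ) [∀ i, IsProbabilityMeasure (ν₁ i)],
      (Measure.pi fun j => ν₁ (i.succAbove j)) = ρ →
      (Measure.pi ν₁).real E = ∫ v, (ν₁ i).real {x | i.insertNth x v ∈ E} ∂ρ := by
    intro ν₁ _ hρ
    have mp : MeasurePreserving e (Measure.pi ν₁) ((ν₁ i).prod ρ) :=
      hρ ▸ measurePreserving_piFinSuccAbove ν₁ i
    rw [← integral_indicator_one E.to_countable.measurableSet]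
    have : ∀ y, E.indicator (1 : (Fin (n + 1) → ℕ) → ℝ) y =
        (fun z => E.indicator (1 : (Fin (n + 1) → ℕ) → ℝ) (e.symm z)) (e y) := by
      intro y; simp
    rw [integral_congr_ae (ae_of_all _ this)]
    refine (mp.integral_comp' (f := e)
      (fun z => E.indicator (1 : (Fin (n + 1) → ℕ) → ℝ) (e.symm z))).trans ?_
    rw [integral_prod_symm]
    · congr 1; ext v
      rw [← integral_indicator_one (hms _)]
      congr 1
    · exact Integrable.of_bound Measurable.of_discrete.aestronglyMeasurable 1
        (ae_of_all _ fun z => by rw [Set.indicator_apply]; split_ifs <;> simp)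
  have hI : ∀ (ν₁ : Measure ℕ) [IsProbabilityMeasure ν₁],
      Integrable (fun v => ν₁.real {x | i.insertNth (α := fun _ => ℕ) x v ∈ E}) ρ := fun ν₁ _ =>
    Integrable.of_bound Measurable.of_discrete.aestronglyMeasurable 1
      (ae_of_all _ fun z => by
        rw [Real.norm_of_nonneg measureReal_nonneg]; exact measureReal_le_one)
  rw [hval ν rfl, hval ν' (by rw [← hrest]), ← integral_sub (hI _) (hI _), ← Real.norm_eq_abs]
  refine (norm_integral_le_of_norm_le_const (C := δ) (ae_of_all _ fun v => ?_)).trans (by simp)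
  rw [Real.norm_eq_abs]
  set F := {x | i.insertNth (α := fun _ => ℕ) x v ∈ E}
  have hF : ∀ x x', x ∉ A → x' ∉ A → x ∈ F → x' ∈ F := by
    intro x x' hx hx' h
    have := hE _ h x' (by simpa using hx) hx'
    simpa [F, Fin.update_insertNth] using this
  by_cases h : F ⊆ A
  · exact hδ F h
  · obtain ⟨x, hxF, hxA⟩ := Set.not_subset.1 h
    have : Fᶜ ⊆ A := fun x' hx' => by
      by_contra hA
      exact hx' (hF x x' hxA hA hxF)
    have h1 := hδ _ this
    rw [probReal_compl_eq_one_sub (hms _), probReal_compl_eq_one_sub (hms _), abs_sub_comm] at h1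
    convert! h1 using 2
    ring

/-- The law is changed one coordinate at a time. A coordinate in `B` costs `δ`; one outside `B`
costs nothing, since `E` ignores it. -/
lemma abs_iidLaw_sub_le {n : ℕ} (μ μ' : Measure ℕ) [IsProbabilityMeasure μ]
    [IsProbabilityMeasure μ'] {B : Finset (Fin n)} {A : Set ℕ} {E : Set (Fin n → ℕ)}
    (hE : DeterminedBy B A E) {δ : ℝ} (hδ : ∀ F ⊆ A, |μ.real F - μ'.real F| ≤ δ) :
    |(iidLaw μ n).real E - (iidLaw μ' n).real E| ≤ B.card * δ := by
  classical
  set ν : Finset (Fin n) → Fin n → Measure ℕ := fun D i => if i ∈ D then μ' else μ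
  have hprob : ∀ D i, IsProbabilityMeasure (ν D i) := fun D i => by
    simp only [ν]; split_ifs <;> infer_instance
  have key : ∀ D : Finset (Fin n),
      |(iidLaw μ n).real E - (Measure.pi (ν D)).real E| ≤ (D ∩ B).card * δ := by
    intro D
    induction D using Finset.induction_on with
    | empty => simp [ν, iidLaw]
    | insert i D hi ih =>
      have hoff : ∀ j ≠ i, ν D j = ν (insert i D) j := fun j hj => by
        simp [ν, Finset.mem_insert, hj]
      have hνi : ν D i = μ := by simp [ν, hi]
      have hνi' : ν (insert i D) i = μ' := by simp [ν]
      have tri := abs_sub_le ((iidLaw μ n).real E) ((Measure.pi (ν D)).real E)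
        ((Measure.pi (ν (insert i D))).real E)
      by_cases hiB : i ∈ B
      · have h1 : |(Measure.pi (ν D)).real E - (Measure.pi (ν (insert i D))).real E| ≤ δ := by
          refine abs_measureReal_pi_sub_le_of_eq_off hoff (A := A) (fun y hy x hyA hxA => ?_) ?_
          · refine hE y hy _ fun j _ h => ?_
            by_cases hj : j = i
            · subst hj; simp [hyA, hxA] at h
            · simp [Function.update_of_ne hj]
          · rw [hνi, hνi']; exact hδ
        rw [Finset.insert_inter_of_mem hiB, Finset.card_insert_of_notMem (by simp [hi])]
        push_cast
        linarith
      · have h1 : |(Measure.pi (ν D)).real E - (Measure.pi (ν (insert i D))).real E| ≤ 0 := by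
          refine abs_measureReal_pi_sub_le_of_eq_off hoff (A := ∅) (fun y hy x _ _ => ?_) ?_
          · refine hE y hy _ fun j hj _ => ?_
            have : j ≠ i := fun h => hiB (h ▸ hj)
            simp [Function.update_of_ne this]
          · intro F hF
            rw [Set.subset_empty_iff.1 hF]; simp
        rw [Finset.insert_inter_of_notMem hiB]
        linarith
  have h := key Finset.univ
  simpa [ν, iidLaw] using h

/-- On `K` the error is relative to `μ'(A)`, hence at most `ε |B| μ'(A) ≤ ε|C|` over all
coordinates; off `K` the masses, multiplied by `|B| ≤ n`, remain small. -/
theorem ConfigurationsClose.congr_law {w : ℕ → ℝ≥0} {m : ℕ → ℕ} {S : Set ℕ}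
    {μ μ' : ℕ → Measure ℕ} (h : ConfigurationsClose w m S μ)
    (hp : ∀ᶠ n in atTop ⊓ 𝓟 S, IsProbabilityMeasure (μ n))
    (hp' : ∀ᶠ n in atTop ⊓ 𝓟 S, IsProbabilityMeasure (μ' n))
    (hclose : ∀ ε > 0, ∀ᶠ n : ℕ in atTop ⊓ 𝓟 S, ∃ K : Set ℕ,
      (∀ F ⊆ K, |(μ n).real F - (μ' n).real F| ≤ ε * (μ' n).real F) ∧
      n * (μ n).real Kᶜ ≤ ε ∧ n * (μ' n).real Kᶜ ≤ ε) :
    ConfigurationsClose w m S μ' := by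
  intro C ε hε
  set C₁ := |C|
  set η := min 1 (ε / (2 * (C₁ + 2)))
  have hη : 0 < η := lt_min one_pos (by positivity)
  have hη1 : η ≤ 1 := min_le_left _ _
  have hC₁ : 0 < C₁ + 2 := by positivity
  have hηε : (C₁ + 2) * η ≤ ε / 2 := by
    have : η ≤ ε / (2 * (C₁ + 2)) := min_le_right _ _
    calc (C₁ + 2) * η ≤ (C₁ + 2) * (ε / (2 * (C₁ + 2))) := by gcongr
      _ = ε / 2 := by field_simp [hC₁.ne']
  -- The given bound concerns `|B| μ'(A)`; passing to `|B| μ(A)` adds at most `(C₁ + 2)η ≤ C₁ + 2`.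
  filter_upwards [h (2 * C₁ + 2) (ε / 2) (half_pos hε), hp, hp', hclose η hη]
    with n hn hpn hpn' hK B A hBA E hE
  obtain ⟨K, hK1, hK2, hK3⟩ := hK
  have hms : ∀ F : Set ℕ, MeasurableSet F := fun F => F.to_countable.measurableSet
  have hb : (B.card : ℝ) ≤ n := by exact_mod_cast (by simpa using B.card_le_univ)
  have hδ : ∀ F ⊆ A, |(μ n).real F - (μ' n).real F| ≤
      η * (μ' n).real A + ((μ n).real Kᶜ + (μ' n).real Kᶜ) := by
    intro F hF
    have e1 := measureReal_inter_add_sdiff (μ := μ n) (s := F) (hms K)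
    have e2 := measureReal_inter_add_sdiff (μ := μ' n) (s := F) (hms K)
    have b1 : (μ n).real (F \ K) ≤ (μ n).real Kᶜ := measureReal_mono fun x hx => hx.2
    have b2 : (μ' n).real (F \ K) ≤ (μ' n).real Kᶜ := measureReal_mono fun x hx => hx.2
    have b3 := hK1 (F ∩ K) Set.inter_subset_right
    have b4 : (μ' n).real (F ∩ K) ≤ (μ' n).real A :=
      measureReal_mono (Set.inter_subset_left.trans hF)
    have b5 := mul_le_mul_of_nonneg_left b4 hη.le
    have b6 : 0 ≤ (μ n).real (F \ K) := measureReal_nonneg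
    have b7 : 0 ≤ (μ' n).real (F \ K) := measureReal_nonneg
    rw [abs_le] at b3 ⊢
    constructor <;> linarith
  have hBA1 : B.card * (μ' n).real A ≤ C₁ := hBA.trans (le_abs_self _)
  have hBδ : B.card * (η * (μ' n).real A + ((μ n).real Kᶜ + (μ' n).real Kᶜ)) ≤ (C₁ + 2) * η := by
    have h1 : B.card * (μ n).real Kᶜ ≤ n * (μ n).real Kᶜ := by gcongr
    have h2 : B.card * (μ' n).real Kᶜ ≤ n * (μ' n).real Kᶜ := by gcongr
    have h3 := mul_le_mul_of_nonneg_left hBA1 hη.le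
    linarith
  have hA : B.card * (μ n).real A ≤ 2 * C₁ + 2 := by
    have h1 := hδ A subset_rfl
    have h2 := mul_le_mul_of_nonneg_left (abs_le.1 h1).2 (Nat.cast_nonneg (α := ℝ) B.card)
    have h3 : (C₁ + 2) * η ≤ C₁ + 2 := mul_le_of_le_one_right (by positivity) hη1
    linarith
  have h1 := hn B A hA E hE
  have h2 := abs_iidLaw_sub_le (μ n) (μ' n) hE hδ
  have h3 := abs_sub_le ((allocLaw w (m n) n).real E) ((iidLaw (μ n) n).real E)
    ((iidLaw (μ' n) n).real E)
  linarith

/-! ### Counting large boxes -/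

section Counting

variable {n : ℕ}

lemma countIn_eq_card (A : Set ℕ) [DecidablePred (· ∈ A)] (y : Fin n → ℕ) :
    countIn A y = (Finset.univ.filter fun i => y i ∈ A).card := by
  rw [countIn, ← Set.ncard_coe_finset]
  congr 1; ext i; simp

lemma le_jthLargest_iff {j : ℕ} (hj : 1 ≤ j) (hjn : j ≤ n) (x : ℕ) (y : Fin n → ℕ) :
    x ≤ jthLargest j y ↔ j ≤ countIn (Set.Ici x) y := by
  classical
  rw [jthLargest, dif_pos ⟨hj, hjn⟩, countIn_eq_card]
  -- `x = 0` is separate because values below `x` are counted as values `≤ x - 1`, with truncated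
  -- subtraction.
  rcases Nat.eq_zero_or_pos x with rfl | hx
  · simp [hjn]
  have h1 := Tuple.lt_card_le_iff_apply_le_of_monotone (a := x - 1) (j := ⟨n - j, by omega⟩)
    (Tuple.monotone_sort y)
  have h2 : (Finset.univ.filter fun i => (y ∘ Tuple.sort y) i ≤ x - 1).card =
      (Finset.univ.filter fun i => y i ≤ x - 1).card :=
    Finset.card_equiv (Tuple.sort y) fun i => by simp
  have h3 : (Finset.univ.filter fun i => y i ∈ Set.Ici x).card +
      (Finset.univ.filter fun i => y i ≤ x - 1).card = n := by
    have := Finset.card_filter_add_card_filter_not (s := (Finset.univ : Finset (Fin n)))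
      (fun i => y i ∈ Set.Ici x)
    rw [Finset.card_univ, Fintype.card_fin] at this
    refine Eq.trans ?_ this
    congr 2; ext i; simp only [Finset.mem_filter, Set.mem_Ici]; simp; omega
  rw [h2] at h1
  simp only [Function.comp_apply] at h1
  omega

lemma jthLargest_lt_iff {j : ℕ} (hj : 1 ≤ j) (hjn : j ≤ n) (x : ℕ) (y : Fin n → ℕ) :
    jthLargest j y < x ↔ countIn (Set.Ici x) y < j := by
  rw [← not_le, le_jthLargest_iff hj hjn, not_le]

lemma determinedBy_card_filter (B : Finset (Fin n)) (A : Set ℕ) [DecidablePred (· ∈ A)]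
    (Q : ℕ → Prop) : DeterminedBy B A {y | Q (B.filter fun i => y i ∈ A).card} := by
  intro y hy y' h
  have : (B.filter fun i => y i ∈ A) = B.filter fun i => y' i ∈ A := by
    refine Finset.filter_congr fun i hi => ⟨fun hA => ?_, fun hA => ?_⟩
    · rw [← h i hi (Or.inl hA)]; exact hA
    · rw [h i hi (Or.inr hA)]; exact hA
  simpa only [Set.mem_ofPred_eq, this] using hy

lemma determinedBy_countIn (A : Set ℕ) (Q : ℕ → Prop) :
    DeterminedBy (Finset.univ : Finset (Fin n)) A {y | Q (countIn A y)} := by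
  classical
  simp_rw [countIn_eq_card]
  exact determinedBy_card_filter _ A Q

/-- For `z ≥ x`, whether the maximum reaches `z` depends only on contents in `[x, ∞)`, so these
contents determine the maximum once it is at least `x`. -/
lemma determinedBy_max (hn : 1 ≤ n) (x : ℕ) (F : Set ℕ) :
    DeterminedBy (Finset.univ : Finset (Fin n)) (Set.Ici x)
      {y | x ≤ jthLargest 1 y ∧ jthLargest 1 y ∈ F} := by
  intro y hy y' h
  have hz : ∀ z, x ≤ z → (z ≤ jthLargest 1 y ↔ z ≤ jthLargest 1 y') := by
    intro z hz
    rw [le_jthLargest_iff le_rfl hn, le_jthLargest_iff le_rfl hn]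
    have : countIn (Set.Ici z) y = countIn (Set.Ici z) y' := by
      unfold countIn
      congr 1; ext i
      simp only [Set.mem_ofPred_eq, Set.mem_Ici]
      constructor
      · intro hi; rw [← h i (Finset.mem_univ i) (Or.inl (hz.trans hi))]; exact hi
      · intro hi; rw [h i (Finset.mem_univ i) (Or.inr (hz.trans hi))]; exact hi
    rw [this]
  have h1 := (hz _ hy.1).1 le_rfl
  have h2 := (hz _ (hy.1.trans h1)).2 le_rfl
  have h3 : jthLargest 1 y = jthLargest 1 y' := le_antisymm h1 h2
  exact ⟨h3 ▸ hy.1, h3 ▸ hy.2⟩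

/-- A Chernoff bound with base `1/2`: for the count `N`, `1{N < j} ≤ 2^j 2^{-N}` and `E 2^{-N} = (1
- p/2)^{|B|}`, where `p = μ(A)`. -/
lemma iidLaw_card_lt_le (μ : Measure ℕ) [IsProbabilityMeasure μ] (B : Finset (Fin n))
    (A : Set ℕ) [DecidablePred (· ∈ A)] (j : ℕ) :
    (iidLaw μ n).real {y | (B.filter fun i => y i ∈ A).card < j} ≤
      2 ^ j * Real.exp (-(B.card * μ.real A) / 2) := by
  have hA : MeasurableSet A := A.to_countable.measurableSet
  set f : Fin n → ℕ → ℝ := fun i k => if i ∈ B then 1 - A.indicator (fun _ => 1 / 2) k else 1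
  have hf0 : ∀ i k, 0 ≤ f i k := fun i k => by
    simp only [f, Set.indicator_apply]; split_ifs <;> norm_num
  have hfI : ∀ i, Integrable (f i) μ := fun i =>
    Integrable.of_bound Measurable.of_discrete.aestronglyMeasurable 1 (ae_of_all _ fun k => by
      rw [Real.norm_of_nonneg (hf0 i k)]
      simp only [f, Set.indicator_apply]; split_ifs <;> norm_num)
  have hprod : ∀ y : Fin n → ℕ, ∏ i, f i (y i) = (1 / 2) ^ (B.filter fun i => y i ∈ A).card := by
    intro y
    simp only [f]
    rw [Finset.prod_ite_mem, Finset.univ_inter, Finset.card_filter, ← Finset.prod_pow_eq_pow_sum]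
    refine Finset.prod_congr rfl fun i _ => ?_
    by_cases h : y i ∈ A
    · simp [h]; norm_num
    · simp [h]
  have hint : ∫ y : Fin n → ℕ, ∏ i, f i (y i) ∂(iidLaw μ n) = (1 - μ.real A / 2) ^ B.card := by
    rw [iidLaw, integral_fintype_prod_eq_prod]
    have : ∀ i, ∫ k, f i k ∂μ = if i ∈ B then 1 - μ.real A / 2 else 1 := by
      intro i
      simp only [f]
      split_ifs
      · rw [integral_sub (integrable_const _) ((integrable_const _).indicator hA),
          integral_indicator_const _ hA]
        simp; ring
      · simp
    simp_rw [this]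
    rw [Finset.prod_ite_mem, Finset.univ_inter, Finset.prod_const]
  have hle : μ.real A ≤ 1 := measureReal_le_one
  calc (iidLaw μ n).real {y | (B.filter fun i => y i ∈ A).card < j}
      = ∫ y, Set.indicator {y : Fin n → ℕ | (B.filter fun i => y i ∈ A).card < j} 1 y
          ∂(iidLaw μ n) := (integral_indicator_one (Set.to_countable _).measurableSet).symm
    _ ≤ ∫ y, 2 ^ j * ∏ i, f i (y i) ∂(iidLaw μ n) := by
        refine integral_mono_of_nonneg (ae_of_all _ fun y => ?_)
          ((Integrable.fintype_prod hfI).const_mul _) (ae_of_all _ fun y => ?_)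
        · exact Set.indicator_nonneg (fun _ _ => zero_le_one) y
        · simp only [hprod]
          rw [Set.indicator_apply]
          split_ifs with h
          · have h' : (B.filter fun i => y i ∈ A).card ≤ j := le_of_lt h
            calc (1 : ℝ) = 2 ^ (B.filter fun i => y i ∈ A).card *
                  (1 / 2) ^ (B.filter fun i => y i ∈ A).card := by
                    rw [← mul_pow]; norm_num
              _ ≤ _ := by gcongr; norm_num
          · positivity
    _ = 2 ^ j * (1 - μ.real A / 2) ^ B.card := by rw [integral_const_mul, hint]
    _ ≤ 2 ^ j * Real.exp (-(μ.real A / 2)) ^ B.card := by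
        gcongr
        · linarith
        · linarith [Real.add_one_le_exp (-(μ.real A / 2))]
    _ = _ := by rw [← Real.exp_nat_mul]; congr 2; ring

lemma iidLaw_countIn_eq (μ : Measure ℕ) [IsProbabilityMeasure μ] (A : Set ℕ) (k : ℕ) :
    (iidLaw μ n).real {y | countIn A y = k} =
      n.choose k * μ.real A ^ k * (1 - μ.real A) ^ (n - k) := by
  classical
  have hA : MeasurableSet A := A.to_countable.measurableSet
  have hset : {y : Fin n → ℕ | countIn A y = k} =
      ⋃ I ∈ Finset.powersetCard k (Finset.univ : Finset (Fin n)),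
        Set.univ.pi fun i => if i ∈ I then A else Aᶜ := by
    ext y
    simp only [Set.mem_ofPred_eq, Set.mem_iUnion, Finset.mem_powersetCard_univ, exists_prop,
      Set.mem_univ_pi, countIn_eq_card]
    constructor
    · intro h
      refine ⟨_, h, fun i => ?_⟩
      by_cases hi : y i ∈ A <;> simp [hi]
    · rintro ⟨I, hI, h⟩
      rw [← hI]
      congr 1; ext i
      have := h i
      by_cases hi : i ∈ I <;> simp_all
  rw [hset, measureReal_biUnion_finset]
  · have : ∀ I ∈ Finset.powersetCard k (Finset.univ : Finset (Fin n)),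
        (iidLaw μ n).real (Set.univ.pi fun i => if i ∈ I then A else Aᶜ) =
        μ.real A ^ k * (1 - μ.real A) ^ (n - k) := by
      intro I hI
      have hIk := Finset.mem_powersetCard_univ.1 hI
      rw [iidLaw, measureReal_def, Measure.pi_pi, ENNReal.toReal_prod]
      have h1 : ∀ i, (μ (if i ∈ I then A else Aᶜ)).toReal =
          if i ∈ I then μ.real A else 1 - μ.real A := by
        intro i
        split_ifs
        · rfl
        · exact probReal_compl_eq_one_sub hA
      simp_rw [h1]
      rw [Finset.prod_ite, Finset.prod_const, Finset.prod_const]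
      have h2 : (Finset.univ.filter fun i => i ∈ I) = I := by ext; simp
      have h3 : (Finset.univ.filter fun i => i ∉ I) = Iᶜ := by ext; simp
      rw [h2, h3, Finset.card_compl, hIk, Fintype.card_fin]
    rw [Finset.sum_congr rfl this, Finset.sum_const, Finset.card_powersetCard, Finset.card_univ,
      Fintype.card_fin, nsmul_eq_mul, mul_assoc]
  · intro I hI J hJ hIJ
    refine Set.disjoint_left.2 fun y hy hy' => hIJ ?_
    ext i
    have h1 := hy i (Set.mem_univ i)
    have h2 := hy' i (Set.mem_univ i)
    by_cases hi : i ∈ I <;> by_cases hi' : i ∈ J <;> simp_all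
  · intro I _
    exact (Set.to_countable _).measurableSet

lemma measureReal_countIn_lt (ρ : Measure (Fin n → ℕ)) [IsFiniteMeasure ρ] (A : Set ℕ) (j : ℕ) :
    ρ.real {y | countIn A y < j} = ∑ k ∈ Finset.range j, ρ.real {y | countIn A y = k} := by
  have : {y : Fin n → ℕ | countIn A y < j} =
      ⋃ k ∈ Finset.range j, {y | countIn A y = k} := by
    ext y; simp
  rw [this, measureReal_biUnion_finset]
  · intro a _ b _ hab
    exact Set.disjoint_left.2 fun y hy hy' => hab (hy.symm.trans hy')
  · intro _ _
    exact (Set.to_countable _).measurableSet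

end Counting

lemma isProbabilityMeasure_allocLaw {w : ℕ → ℝ≥0} {m n : ℕ} (hZ : 0 < partitionFn w m n) :
    IsProbabilityMeasure (allocLaw w m n) := by
  refine ⟨?_⟩
  rw [allocLaw, Measure.finsetSum_apply]
  have : ∀ y ∈ Finset.Nat.antidiagonalTuple n m,
      (((∏ i, w (y i)) / partitionFn w m n) • Measure.dirac y : Measure (Fin n → ℕ)) Set.univ =
      (((∏ i, w (y i)) / partitionFn w m n : ℝ≥0) : ℝ≥0∞) := fun y _ => by
    rw [Measure.smul_apply]; simp [ENNReal.smul_def]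
  rw [Finset.sum_congr rfl this, ← ENNReal.ofNNReal_finsetSum, ← Finset.sum_div]
  change ((partitionFn w m n / partitionFn w m n : ℝ≥0) : ℝ≥0∞) = 1
  rw [div_self hZ.ne', ENNReal.coe_one]

/-! ### Weak convergence on `{0, 1, …, ∞}` -/

/-- A continuous function on `{0, 1, …, ∞}` is uniformly close to one that is constant off finitely
many integers, and integrals of the latter are combinations of the probabilities `P(X < j)`. -/
lemma tendsto_finiteMeasure_enat {ι : Type*} {l : Filter ι} {ν : ι → FiniteMeasure ℕ∞}
    {ν₀ : FiniteMeasure ℕ∞} (hν : ∀ᶠ i in l, IsProbabilityMeasure (ν i : Measure ℕ∞))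
    (hν₀ : IsProbabilityMeasure (ν₀ : Measure ℕ∞))
    (h : ∀ j : ℕ, Tendsto (fun i => (ν i : Measure ℕ∞).real {x | x < j}) l
      (𝓝 ((ν₀ : Measure ℕ∞).real {x | x < j}))) : Tendsto ν l (𝓝 ν₀) := by
  classical
  have hms : ∀ A : Set ℕ∞, MeasurableSet A := fun A => MeasurableSpace.measurableSet_top
  rw [FiniteMeasure.tendsto_iff_forall_integral_tendsto]
  intro f
  have hsing : ∀ (ρ : Measure ℕ∞) [IsFiniteMeasure ρ] (k : ℕ),
      ρ.real {(k : ℕ∞)} = ρ.real {x | x < ((k + 1 : ℕ) : ℕ∞)} - ρ.real {x | x < (k : ℕ∞)} := by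
    intro ρ _ k
    rw [← measureReal_sdiff ?_ (hms _)]
    · congr 1; ext x
      simp only [Set.mem_singleton_iff, Set.mem_sdiff, Set.mem_ofPred_eq, not_lt]
      constructor
      · rintro rfl; exact ⟨by exact_mod_cast Nat.lt_succ_self k, le_rfl⟩
      · rintro ⟨h1, h2⟩
        refine le_antisymm ?_ h2
        push_cast at h1
        exact Order.le_of_lt_add_one h1
    · intro x hx
      have hx' : x < (k : ℕ∞) := hx
      exact hx'.trans (by exact_mod_cast Nat.lt_succ_self k)
  have happrox : ∀ ε > 0, ∃ g : ℕ∞ → ℝ, (∀ x, |f x - g x| ≤ ε) ∧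
      (∀ ρ : Measure ℕ∞, IsFiniteMeasure ρ → Integrable g ρ) ∧
      Tendsto (fun i => ∫ x, g x ∂(ν i : Measure ℕ∞)) l (𝓝 (∫ x, g x ∂(ν₀ : Measure ℕ∞))) := by
    intro ε hε
    have hcont : Tendsto (fun k : ℕ => f (k : ℕ∞)) atTop (𝓝 (f ⊤)) :=
      (f.continuous.tendsto ⊤).comp ENat.tendsto_natCast_nhds_top
    obtain ⟨J, hJ⟩ := Metric.tendsto_atTop.1 hcont ε hε
    set g : ℕ∞ → ℝ := fun x => f ⊤ + ∑ k ∈ Finset.range J,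
      Set.indicator {(k : ℕ∞)} (fun _ => f k - f ⊤) x
    have hind : ∀ (ρ : Measure ℕ∞) [IsFiniteMeasure ρ] (k : ℕ),
        Integrable (Set.indicator {(k : ℕ∞)} (fun _ => f k - f ⊤)) ρ := fun ρ _ k =>
      (integrable_const _).indicator (hms _)
    have hgint : ∀ (ρ : Measure ℕ∞) [IsProbabilityMeasure ρ], ∫ x, g x ∂ρ =
        f ⊤ + ∑ k ∈ Finset.range J, ρ.real {(k : ℕ∞)} * (f k - f ⊤) := by
      intro ρ _
      simp only [g]
      rw [integral_add (integrable_const _) (integrable_finsetSum _ fun k _ => hind ρ k),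
        integral_finsetSum _ fun k _ => hind ρ k]
      simp_rw [integral_indicator_const _ (hms _)]
      simp
    refine ⟨g, fun x => ?_, fun ρ _ =>
      (integrable_const _).add (integrable_finsetSum _ fun k _ => hind ρ k), ?_⟩
    · induction x using ENat.recTopCoe with
      | top => simp [g, hε.le]
      | coe k =>
        by_cases hk : k < J
        · have : g k = f k := by
            simp only [g]
            rw [Finset.sum_eq_single k]
            · simp
            · intro b _ hb
              rw [Set.indicator_of_notMem]
              simpa using hb.symm
            · intro h; exact absurd (Finset.mem_range.2 hk) h
          rw [this]; simp [hε.le]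
        · have : g k = f ⊤ := by
            simp only [g]
            rw [Finset.sum_eq_zero, add_zero]
            intro b hb
            rw [Set.indicator_of_notMem]
            have := Finset.mem_range.1 hb
            simp only [Set.mem_singleton_iff, Nat.cast_inj]
            omega
          rw [this]
          exact (hJ k (not_lt.1 hk)).le
    · rw [hgint]
      have : Tendsto (fun i => f ⊤ + ∑ k ∈ Finset.range J,
          (ν i : Measure ℕ∞).real {(k : ℕ∞)} * (f k - f ⊤)) l
          (𝓝 (f ⊤ + ∑ k ∈ Finset.range J, (ν₀ : Measure ℕ∞).real {(k : ℕ∞)} * (f k - f ⊤))) := by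
        refine tendsto_const_nhds.add (tendsto_finsetSum _ fun k _ => Tendsto.mul_const _ ?_)
        simp_rw [hsing]
        exact (h (k + 1)).sub (h k)
      refine this.congr' ?_
      filter_upwards [hν] with i hi
      rw [hgint]
  rw [Metric.tendsto_nhds]
  intro ε hε
  obtain ⟨g, hfg, hgI, hgt⟩ := happrox (ε / 4) (by positivity)
  have hdiff : ∀ ρ : Measure ℕ∞, IsProbabilityMeasure ρ →
      |∫ x, f x ∂ρ - ∫ x, g x ∂ρ| ≤ ε / 4 := by
    intro ρ _
    rw [← integral_sub (f.integrable ρ) (hgI ρ inferInstance), ← Real.norm_eq_abs]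
    refine (norm_integral_le_of_norm_le_const (C := ε / 4) (ae_of_all _ hfg)).trans ?_
    simp
  filter_upwards [hν, Metric.tendsto_nhds.1 hgt (ε / 4) (by positivity)] with i hi hgi
  rw [Real.dist_eq] at hgi ⊢
  have h1 := abs_le.1 (hdiff _ hi)
  have h2 := abs_le.1 (hdiff _ hν₀)
  have h3 := abs_lt.1 hgi
  rw [abs_lt]
  constructor <;> linarith

/-! ### Large boxes of allocations whose configurations are close to i.i.d. ones -/

lemma setOf_int_le (h : ℤ) : {k : ℕ | h ≤ (k : ℤ)} = Set.Ici h.toNat := by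
  ext k; simp [Int.toNat_le]

lemma tendsto_zero_of_eventually_abs_le {ι : Type*} {l : Filter ι} {f : ι → ℝ}
    (h : ∀ ε > 0, ∀ᶠ i in l, |f i| ≤ ε) : Tendsto f l (𝓝 0) := by
  rw [Metric.tendsto_nhds]
  intro ε hε
  filter_upwards [h (ε / 2) (half_pos hε)] with i hi
  rw [Real.dist_eq, sub_zero]
  linarith

lemma exists_two_pow_mul_exp_le (j : ℕ) {ε : ℝ} (hε : 0 < ε) :
    ∃ M > 0, ∀ x : ℝ, M ≤ x → 2 ^ j * Real.exp (-x / 2) ≤ ε := by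
  have h : Tendsto (fun x : ℝ => 2 ^ j * Real.exp (-x / 2)) atTop (𝓝 (2 ^ j * 0)) := by
    refine Tendsto.const_mul _ (Real.tendsto_exp_atBot.comp ?_)
    simp_rw [neg_div]
    exact tendsto_neg_atTop_atBot.comp (tendsto_id.atTop_div_const two_pos)
  rw [mul_zero] at h
  obtain ⟨M, hM⟩ := eventually_atTop.1 (h.eventually_le_const hε)
  exact ⟨max M 1, by positivity, fun x hx => hM x ((le_max_left _ _).trans hx)⟩

section

variable {w : ℕ → ℝ≥0} {m : ℕ → ℕ} {S : Set ℕ} {μ : ℕ → Measure ℕ}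

/-- For large `n P(A)` the comparison is unavailable on all boxes, but a subset `B` with `M ≤ |B|
P(A) ≤ M + 1` suffices: by the Chernoff bound it already contains `j` boxes in `A` with high
probability. -/
lemma ConfigurationsClose.exists_measureReal_lt_le (h : ConfigurationsClose w m S μ)
    (hp : ∀ᶠ n in atTop ⊓ 𝓟 S, IsProbabilityMeasure (μ n)) (j : ℕ) {ε : ℝ} (hε : 0 < ε) :
    ∃ M > 0, ∀ᶠ n : ℕ in atTop ⊓ 𝓟 S, ∀ A : Set ℕ, M ≤ n * (μ n).real A →
      (allocLaw w (m n) n).real {y | countIn A y < j} ≤ ε ∧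
      (iidLaw (μ n) n).real {y | countIn A y < j} ≤ ε := by
  classical
  obtain ⟨M, hM, hexp⟩ := exists_two_pow_mul_exp_le j (half_pos hε)
  refine ⟨M, hM, ?_⟩
  filter_upwards [h (M + 1) (ε / 2) (half_pos hε), hp] with n hn hpn A hA
  set p := (μ n).real A
  have hp1 : p ≤ 1 := measureReal_le_one
  have hp0 : 0 < p := by
    by_contra h0
    have : n * p ≤ 0 := mul_nonpos_of_nonneg_of_nonpos (by positivity) (not_lt.1 h0)
    linarith
  have hb : ⌈M / p⌉₊ ≤ (Finset.univ : Finset (Fin n)).card := by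
    rw [Finset.card_univ, Fintype.card_fin, Nat.ceil_le, div_le_iff₀ hp0]
    exact hA
  obtain ⟨B, -, hB⟩ := Finset.exists_subset_card_eq hb
  have hB1 : M ≤ B.card * p := by
    rw [hB, ← div_le_iff₀ hp0]; exact Nat.le_ceil _
  have hB2 : B.card * p ≤ M + 1 := by
    have : (⌈M / p⌉₊ : ℝ) ≤ M / p + 1 := (Nat.ceil_lt_add_one (by positivity)).le
    rw [hB]
    calc (⌈M / p⌉₊ : ℝ) * p ≤ (M / p + 1) * p := by gcongr
      _ = M + p := by field_simp
      _ ≤ M + 1 := by gcongr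
  have hiid := (iidLaw_card_lt_le (μ n) B A j).trans (hexp _ hB1)
  have hcl := (abs_le.1 (hn B A hB2 _ (determinedBy_card_filter B A (· < j)))).2
  have hsub : {y : Fin n → ℕ | countIn A y < j} ⊆ {y | (B.filter fun i => y i ∈ A).card < j} := by
    intro y hy
    rw [Set.mem_ofPred_eq, countIn_eq_card] at hy
    exact (Finset.card_le_card (Finset.filter_subset_filter _ (Finset.subset_univ B))).trans_lt hy
  have h1 : (allocLaw w (m n) n).real {y | countIn A y < j} ≤ _ := measureReal_mono hsub
  have h2 : (iidLaw (μ n) n).real {y | countIn A y < j} ≤ _ := measureReal_mono hsub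
  constructor <;> linarith

/-- Either `n P(A) ≥ M` and both probabilities are small, or `n P(A) ≤ M` and configurations of all
boxes can be compared. No restriction on `A` remains. -/
lemma ConfigurationsClose.eventually_abs_sub_le (h : ConfigurationsClose w m S μ)
    (hp : ∀ᶠ n in atTop ⊓ 𝓟 S, IsProbabilityMeasure (μ n)) (j : ℕ) {ε : ℝ} (hε : 0 < ε) :
    ∀ᶠ n : ℕ in atTop ⊓ 𝓟 S, ∀ A : Set ℕ,
      |(allocLaw w (m n) n).real {y | countIn A y < j} -
        (iidLaw (μ n) n).real {y | countIn A y < j}| ≤ ε := by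
  obtain ⟨M, -, hM⟩ := h.exists_measureReal_lt_le hp j hε
  filter_upwards [hM, h M ε hε] with n hn hn' A
  rcases le_total M (n * (μ n).real A) with hA | hA
  · obtain ⟨h1, h2⟩ := hn A hA
    have h3 : 0 ≤ (allocLaw w (m n) n).real {y | countIn A y < j} := measureReal_nonneg
    have h4 : 0 ≤ (iidLaw (μ n) n).real {y | countIn A y < j} := measureReal_nonneg
    exact abs_sub_le_iff.2 ⟨by linarith, by linarith⟩
  · exact hn' Finset.univ A (by simpa using hA) _ (determinedBy_countIn A (· < j))

lemma tendsto_measure_one_of_real {ι : Type*} {l : Filter ι} {Ω : ι → Type*}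
    [∀ i, MeasurableSpace (Ω i)] {ρ : ∀ i, Measure (Ω i)} {E : ∀ i, Set (Ω i)}
    (hρ : ∀ᶠ i in l, IsProbabilityMeasure (ρ i))
    (h : ∀ ε > 0, ∀ᶠ i in l, 1 - ε ≤ (ρ i).real (E i)) :
    Tendsto (fun i => ρ i (E i)) l (𝓝 1) := by
  have h1 : Tendsto (fun i => (ρ i).real (E i)) l (𝓝 1) := by
    have : Tendsto (fun i => (ρ i).real (E i) - 1) l (𝓝 0) :=
      tendsto_zero_of_eventually_abs_le fun ε hε => by
        filter_upwards [h ε hε, hρ] with i hi hi'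
        have : (ρ i).real (E i) ≤ 1 := measureReal_le_one
        rw [abs_le]; constructor <;> linarith
    simpa using this.add_const 1
  have h2 := ENNReal.tendsto_ofReal h1
  rw [ENNReal.ofReal_one] at h2
  refine h2.congr' ?_
  filter_upwards [hρ] with i hi
  exact ofReal_measureReal

lemma tendsto_real_of_tendsto_mul {l : Filter ℕ} {A : ℕ → Set ℕ} {α : ℝ≥0∞} (hα : α ≠ ⊤)
    (h : Tendsto (fun n : ℕ => (n : ℝ≥0∞) * μ n (A n)) l (𝓝 α)) :
    Tendsto (fun n : ℕ => (n : ℝ) * (μ n).real (A n)) l (𝓝 α.toReal) := by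
  have := (ENNReal.tendsto_toReal hα).comp h
  refine this.congr fun n => ?_
  simp [measureReal_def]

lemma eventually_le_real_of_tendsto_top {l : Filter ℕ}
    (hp : ∀ᶠ n in l, IsProbabilityMeasure (μ n)) {A : ℕ → Set ℕ}
    (h : Tendsto (fun n : ℕ => (n : ℝ≥0∞) * μ n (A n)) l (𝓝 ⊤)) (M : ℝ) :
    ∀ᶠ n : ℕ in l, M ≤ n * (μ n).real (A n) := by
  filter_upwards [ENNReal.tendsto_nhds_top_iff_nnreal.1 h M.toNNReal, hp] with n hn hpn
  have h1 : (n : ℝ≥0∞) * μ n (A n) ≠ ⊤ := ENNReal.mul_ne_top (by simp) (measure_ne_top _ _)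
  have h2 := (ENNReal.toReal_le_toReal ENNReal.coe_ne_top h1).2 hn.le
  rw [ENNReal.toReal_mul] at h2
  exact (Real.le_coe_toNNReal M).trans (by simpa [measureReal_def] using h2)

lemma tendsto_binomial_poisson {S : Set ℕ} {p : ℕ → ℝ} {r : ℝ} (k : ℕ)
    (h : Tendsto (fun n : ℕ => (n : ℝ) * p n) (atTop ⊓ 𝓟 S) (𝓝 r)) :
    Tendsto (fun n : ℕ => n.choose k * p n ^ k * (1 - p n) ^ (n - k)) (atTop ⊓ 𝓟 S)
      (𝓝 (Real.exp (-r) * r ^ k / k.factorial)) := by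
  classical
  set p' : ℕ → ℝ := fun n => if n ∈ S then p n else r / n
  have h1 : Tendsto (fun n : ℕ => (n : ℝ) * p' n) atTop (𝓝 r) := by
    intro U hU
    have h2 := h hU
    rw [mem_map, mem_inf_principal] at h2
    rw [mem_map]
    filter_upwards [h2, eventually_ne_atTop 0] with n hn hn0
    by_cases hS : n ∈ S
    · simpa [p', hS] using hn hS
    · have : (n : ℝ) ≠ 0 := by exact_mod_cast hn0
      simpa [p', hS, mul_div_cancel₀ _ this] using mem_of_mem_nhds hU
  refine ((tendsto_choose_mul_pow_of_tendsto_mul_atTop k h1).mono_left inf_le_left).congr' ?_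
  filter_upwards [mem_inf_of_right (mem_principal_self S)] with n hn
  simp [p', hn]

lemma poissonExt_real_lt_of_ne_top {α : ℝ≥0∞} (hα : α ≠ ⊤) (j : ℕ) :
    (poissonExt α).real {x | x < j} =
      ∑ k ∈ Finset.range j, Real.exp (-α.toReal) * α.toReal ^ k / k.factorial := by
  rw [poissonExt, if_neg hα, map_measureReal_apply Measurable.of_discrete
    MeasurableSpace.measurableSet_top]
  have : ((fun k : ℕ => (k : ℕ∞)) ⁻¹' {x | x < j}) = ↑(Finset.range j) := by
    ext k; simp
  rw [this, ← sum_measureReal_singleton]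
  refine Finset.sum_congr rfl fun k _ => ?_
  rw [measureReal_def, poissonMeasure_singleton, ENNReal.toReal_ofReal (by positivity)]
  rfl

lemma isProbabilityMeasure_poissonExt (α : ℝ≥0∞) : IsProbabilityMeasure (poissonExt α) := by
  unfold poissonExt
  split_ifs
  · infer_instance
  · exact Measure.isProbabilityMeasure_map Measurable.of_discrete.aemeasurable

lemma boxCountLaw_real_lt (m n : ℕ) (A : Set ℕ) (j : ℕ) :
    (boxCountLaw w m n A : Measure ℕ∞).real {x | x < j} =
      (allocLaw w m n).real {y | countIn A y < j} := by
  change ((allocLaw w m n).map (fun y => (countIn A y : ℕ∞))).real {x | x < j} = _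
  rw [map_measureReal_apply Measurable.of_discrete MeasurableSpace.measurableSet_top]
  congr 1; ext y; simp

theorem ConfigurationsClose.largestBoxesLikeIID (hZ : ∀ n ∈ S, 0 < partitionFn w (m n) n)
    (h : ConfigurationsClose w m S μ)
    (hp : ∀ᶠ n in atTop ⊓ 𝓟 S, IsProbabilityMeasure (μ n)) :
    LargestBoxesLikeIID w m S μ := by
  have hS : ∀ᶠ n in atTop ⊓ 𝓟 S, n ∈ S := mem_inf_of_right (mem_principal_self S)
  have hge : ∀ N : ℕ, ∀ᶠ n in atTop ⊓ 𝓟 S, N ≤ n := fun N =>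
    mem_inf_of_left (eventually_ge_atTop N)
  have hpa : ∀ᶠ n in atTop ⊓ 𝓟 S, IsProbabilityMeasure (allocLaw w (m n) n) :=
    hS.mono fun n hn => isProbabilityMeasure_allocLaw (hZ n hn)
  have hms : ∀ {n : ℕ} (E : Set (Fin n → ℕ)), MeasurableSet E := fun E =>
    E.to_countable.measurableSet
  have hjlt : ∀ {n j : ℕ}, 1 ≤ j → j ≤ n → ∀ (h : ℤ) (y : Fin n → ℕ),
      (jthLargest j y : ℤ) < h ↔ countIn {k : ℕ | h ≤ (k : ℤ)} y < j := by
    intro n j hj hjn h y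
    rw [setOf_int_le, ← jthLargest_lt_iff hj hjn, Int.lt_toNat]
  refine ⟨?_, ?_, ?_, ?_, ?_, ?_⟩
  · intro T hT h' α hα
    have hle : (atTop ⊓ 𝓟 T : Filter ℕ) ≤ atTop ⊓ 𝓟 S :=
      inf_le_inf_left _ (principal_mono.2 hT)
    refine tendsto_finiteMeasure_enat ?_ (isProbabilityMeasure_poissonExt α) fun j => ?_
    · filter_upwards [hle hpa] with n hn
      exact Measure.isProbabilityMeasure_map Measurable.of_discrete.aemeasurable
    simp_rw [boxCountLaw_real_lt]
    by_cases hα' : α = ⊤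
    · subst hα'
      have h0 : (poissonExt ⊤).real {x | x < (j : ℕ∞)} = 0 := by
        rw [poissonExt, if_pos rfl, measureReal_def, Measure.dirac_apply]
        simp
      change Tendsto _ _ (𝓝 ((poissonExt ⊤).real {x | x < (j : ℕ∞)}))
      rw [h0]
      refine tendsto_zero_of_eventually_abs_le fun ε hε => ?_
      obtain ⟨M, -, hM⟩ := h.exists_measureReal_lt_le hp j hε
      filter_upwards [hle hM, eventually_le_real_of_tendsto_top (hle hp) hα M] with n hn hMn
      rw [abs_of_nonneg measureReal_nonneg]
      exact (hn _ hMn).1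
    · change Tendsto _ _ (𝓝 ((poissonExt α).real {x | x < (j : ℕ∞)}))
      have h1 := tendsto_real_of_tendsto_mul hα' hα
      have h2 : Tendsto (fun n : ℕ => (iidLaw (μ n) n).real
          {y | countIn {k : ℕ | h' n ≤ (k : ℤ)} y < j}) (atTop ⊓ 𝓟 T)
          (𝓝 ((poissonExt α).real {x | x < (j : ℕ∞)})) := by
        rw [poissonExt_real_lt_of_ne_top hα']
        refine (tendsto_finsetSum (Finset.range j) fun k _ =>
          tendsto_binomial_poisson k h1).congr' ?_
        filter_upwards [hle hp] with n hn
        rw [measureReal_countIn_lt]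
        exact Finset.sum_congr rfl fun k _ => (iidLaw_countIn_eq (μ n) _ k).symm
      have h3 : Tendsto (fun n : ℕ => (allocLaw w (m n) n).real
          {y | countIn {k : ℕ | h' n ≤ (k : ℤ)} y < j} - (iidLaw (μ n) n).real
          {y | countIn {k : ℕ | h' n ≤ (k : ℤ)} y < j}) (atTop ⊓ 𝓟 T) (𝓝 0) :=
        tendsto_zero_of_eventually_abs_le fun ε hε => by
          filter_upwards [hle (h.eventually_abs_sub_le hp j hε)] with n hn
          exact hn _
      simpa using h3.add h2
  · intro h' hh
    refine tendsto_measure_one_of_real hpa fun ε hε => ?_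
    have h1 := tendsto_real_of_tendsto_mul ENNReal.zero_ne_top hh
    rw [ENNReal.toReal_zero] at h1
    filter_upwards [h.eventually_abs_sub_le hp 1 (half_pos hε), hp,
      h1.eventually_le_const (half_pos hε), hge 1] with n hn hpn hsmall hn1
    have h2 := hn {k : ℕ | h' n ≤ (k : ℤ)}
    have h3 : 1 - ε / 2 ≤ (iidLaw (μ n) n).real {y | countIn {k : ℕ | h' n ≤ (k : ℤ)} y < 1} := by
      rw [measureReal_countIn_lt, Finset.sum_range_one, iidLaw_countIn_eq]
      have hp1 : (μ n).real {k : ℕ | h' n ≤ (k : ℤ)} ≤ 1 := measureReal_le_one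
      -- Bernoulli's inequality bounds the probability `(1 - p)^n` of no large variable below by `1
      -- - np`.
      have h4 := one_add_mul_le_pow (a := -(μ n).real {k : ℕ | h' n ≤ (k : ℤ)}) (by linarith) n
      rw [← sub_eq_add_neg 1 ((μ n).real _)] at h4
      simp only [Nat.choose_zero_right, Nat.cast_one, pow_zero, mul_one, one_mul, Nat.sub_zero]
      linarith
    have h5 : {y : Fin n → ℕ | (jthLargest 1 y : ℤ) < h' n} =
        {y | countIn {k : ℕ | h' n ≤ (k : ℤ)} y < 1} := by
      ext y; exact hjlt le_rfl hn1 _ y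
    rw [h5]
    linarith [(abs_le.1 h2).1]
  · intro h' hh j hj
    refine tendsto_measure_one_of_real hpa fun ε hε => ?_
    obtain ⟨M, -, hM⟩ := h.exists_measureReal_lt_le hp j hε
    filter_upwards [hM, hpa, eventually_le_real_of_tendsto_top hp hh M, hge j]
      with n hn hpn hMn hnj
    have h5 : {y : Fin n → ℕ | h' n ≤ (jthLargest j y : ℤ)} =
        {y | countIn {k : ℕ | h' n ≤ (k : ℤ)} y < j}ᶜ := by
      ext y
      rw [Set.mem_compl_iff, Set.mem_ofPred_eq, Set.mem_ofPred_eq, ← hjlt hj hnj, not_lt]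
    rw [h5, probReal_compl_eq_one_sub (hms _)]
    linarith [(hn _ hMn).1]
  · intro h'
    refine tendsto_zero_of_eventually_abs_le fun ε hε => ?_
    -- For `x ≥ J` the weight `1 / (1 + x)` is already below `ε`, so only finitely many `j` need the
    -- uniform comparison.
    obtain ⟨J, hJ⟩ := exists_nat_gt (1 / ε)
    have hall : ∀ᶠ n : ℕ in atTop ⊓ 𝓟 S, ∀ j ∈ Finset.range (J + 1), ∀ A : Set ℕ,
        |(allocLaw w (m n) n).real {y | countIn A y < j} -
          (iidLaw (μ n) n).real {y | countIn A y < j}| ≤ ε :=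
      (Finset.eventually_all _).2 fun j _ => h.eventually_abs_sub_le hp j hε
    filter_upwards [hall, hp, hpa] with n hn hpn hpan
    rw [dKmod, abs_of_nonneg (Real.iSup_nonneg fun x => by positivity)]
    refine Real.iSup_le (fun x => ?_) hε.le
    rw [map_measureReal_apply Measurable.of_discrete (Set.to_countable _).measurableSet,
      map_measureReal_apply Measurable.of_discrete (Set.to_countable _).measurableSet]
    have hpre : (countIn {k : ℕ | h' n ≤ (k : ℝ)} ⁻¹' {k | k ≤ x} : Set (Fin n → ℕ)) =
        {y | countIn {k : ℕ | h' n ≤ (k : ℝ)} y < x + 1} := by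
      ext y; simp
    rw [hpre]
    rcases lt_or_ge x J with hx | hx
    · refine (div_le_self (abs_nonneg _) (by linarith [Nat.cast_nonneg (α := ℝ) x])).trans ?_
      exact hn (x + 1) (Finset.mem_range.2 (by omega)) _
    · have h1 : |(allocLaw w (m n) n).real {y | countIn {k : ℕ | h' n ≤ (k : ℝ)} y < x + 1} -
          (iidLaw (μ n) n).real {y | countIn {k : ℕ | h' n ≤ (k : ℝ)} y < x + 1}| ≤ 1 :=
        abs_sub_le_of_nonneg_of_le measureReal_nonneg measureReal_le_one measureReal_nonneg
          measureReal_le_one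
      rw [div_le_iff₀ (by positivity)]
      have hxJ : (J : ℝ) ≤ x := by exact_mod_cast hx
      have : 1 < J * ε := by rwa [div_lt_iff₀ hε] at hJ
      nlinarith
  · intro j hj
    refine tendsto_zero_of_eventually_abs_le fun ε hε => ?_
    filter_upwards [h.eventually_abs_sub_le hp j hε, hge j] with n hn hnj
    rw [dK, abs_of_nonneg (Real.iSup_nonneg fun x => abs_nonneg _)]
    refine Real.iSup_le (fun x => ?_) hε.le
    rw [map_measureReal_apply Measurable.of_discrete (Set.to_countable _).measurableSet,
      map_measureReal_apply Measurable.of_discrete (Set.to_countable _).measurableSet]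
    have hpre : (jthLargest j ⁻¹' {k | k ≤ x} : Set (Fin n → ℕ)) =
        {y | countIn (Set.Ici (x + 1)) y < j} := by
      ext y
      rw [Set.mem_ofPred_eq, ← jthLargest_lt_iff hj hnj]
      simp
    rw [hpre]
    exact hn _
  · refine tendsto_zero_of_eventually_abs_le fun ε hε => ?_
    have hε5 : 0 < ε / 5 := by positivity
    obtain ⟨M, hM0, hM⟩ := h.exists_measureReal_lt_le hp 1 hε5
    filter_upwards [hM, h M (ε / 5) hε5, h.eventually_abs_sub_le hp 1 hε5, hge 1, hp]
      with n hMn hMn' hn hn1 hpn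
    rw [dTV, abs_of_nonneg (Real.iSup_nonneg fun x => abs_nonneg _)]
    refine Real.iSup_le (fun F => ?_) hε.le
    rw [map_measureReal_apply Measurable.of_discrete (Set.to_countable _).measurableSet,
      map_measureReal_apply Measurable.of_discrete (Set.to_countable _).measurableSet]
    have hex : ∃ x : ℕ, n * (μ n).real (Set.Ici x) ≤ M := by
      have h1 : Tendsto (fun x : ℕ => (μ n).real (Set.Ici x)) atTop (𝓝 0) := by
        have h2 := tendsto_measure_iInter_atTop (μ := μ n) (s := fun x : ℕ => Set.Ici x)
          (fun x => (Set.to_countable _).measurableSet.nullMeasurableSet)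
          (fun a b hab => Set.Ici_subset_Ici.2 hab) ⟨0, measure_ne_top _ _⟩
        have h3 : ⋂ x : ℕ, Set.Ici x = (∅ : Set ℕ) := by
          ext k
          simp only [Set.mem_iInter, Set.mem_Ici, Set.mem_empty_iff_false, iff_false, not_forall]
          exact ⟨k + 1, by omega⟩
        rw [h3, measure_empty] at h2
        exact (ENNReal.tendsto_toReal ENNReal.zero_ne_top).comp h2
      have h2 := h1.const_mul (n : ℝ)
      rw [mul_zero] at h2
      exact (h2.eventually_le_const hM0).exists
    classical
    -- At and above the least `x` with `n P(ξ ≥ x) ≤ M`, configurations are close. By minimality the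
    -- maximum is rarely below `x - 1`. There remains the single value `x - 1`, whose probability is
    -- a difference of two values of the distribution function.
    set x := Nat.find hex
    have hx : n * (μ n).real (Set.Ici x) ≤ M := Nat.find_spec hex
    set a := (allocLaw w (m n) n).real
    set b := (iidLaw (μ n) n).real
    have hE1 := hMn' Finset.univ (Set.Ici x) (by simpa using hx) _ (determinedBy_max hn1 x F)
    have hlow : |a {y | jthLargest 1 y < x ∧ jthLargest 1 y ∈ F} -
        b {y | jthLargest 1 y < x ∧ jthLargest 1 y ∈ F}| ≤ 4 * (ε / 5) := by
      rcases Nat.eq_zero_or_pos x with hx0 | hx0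
      · have : {y : Fin n → ℕ | jthLargest 1 y < x ∧ jthLargest 1 y ∈ F} = ∅ := by
          ext y; simp [hx0]
        rw [this]
        simp only [a, b, measureReal_empty, sub_zero, abs_zero]
        positivity
      · have hx1 : M ≤ n * (μ n).real (Set.Ici (x - 1)) :=
          (not_le.1 (Nat.find_min hex (m := x - 1) (by omega))).le
        obtain ⟨hs1, hs2⟩ := hMn _ hx1
        have e0 : {y : Fin n → ℕ | countIn (Set.Ici (x - 1)) y < 1} =
            {y | jthLargest 1 y < x - 1} := by
          ext y; exact (jthLargest_lt_iff le_rfl hn1 _ y).symm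
        have e1 : {y : Fin n → ℕ | countIn (Set.Ici x) y < 1} = {y | jthLargest 1 y < x} := by
          ext y; exact (jthLargest_lt_iff le_rfl hn1 _ y).symm
        have h1 := hn (Set.Ici x)
        rw [e1] at h1
        have h2 := hn (Set.Ici (x - 1))
        rw [e0] at h2 hs1 hs2
        have hsplit : ∀ (ρ : Measure (Fin n → ℕ)) [IsFiniteMeasure ρ], ∃ t : ℝ, 0 ≤ t ∧
            t ≤ ρ.real {y | jthLargest 1 y < x - 1} ∧
            ρ.real {y | jthLargest 1 y < x ∧ jthLargest 1 y ∈ F} = t +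
              if x - 1 ∈ F then ρ.real {y | jthLargest 1 y < x} -
                ρ.real {y | jthLargest 1 y < x - 1} else 0 := by
          intro ρ _
          refine ⟨ρ.real {y | jthLargest 1 y < x - 1 ∧ jthLargest 1 y ∈ F}, measureReal_nonneg,
            measureReal_mono fun y hy => hy.1, ?_⟩
          have hsub : {y : Fin n → ℕ | jthLargest 1 y < x - 1} ⊆ {y | jthLargest 1 y < x} :=
            fun y (hy : jthLargest 1 y < x - 1) => show jthLargest 1 y < x by omega
          split_ifs with hF
          · rw [← measureReal_sdiff hsub (hms _), ← measureReal_union _ (hms _)]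
            · congr 1; ext y
              simp only [Set.mem_ofPred_eq, Set.mem_union, Set.mem_sdiff]
              constructor
              · rintro ⟨h1, h2⟩
                by_cases h3 : jthLargest 1 y < x - 1
                · exact Or.inl ⟨h3, h2⟩
                · exact Or.inr ⟨h1, h3⟩
              · rintro (⟨h1, h2⟩ | ⟨h1, h2⟩)
                · exact ⟨by omega, h2⟩
                · have : jthLargest 1 y = x - 1 := by omega
                  exact ⟨h1, this ▸ hF⟩
            · exact Set.disjoint_left.2 fun y hy hy' => hy'.2 hy.1
          · rw [add_zero]
            congr 1; ext y
            simp only [Set.mem_ofPred_eq]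
            constructor
            · rintro ⟨h1, h2⟩
              have : jthLargest 1 y ≠ x - 1 := fun h => hF (h ▸ h2)
              exact ⟨by omega, h2⟩
            · rintro ⟨h1, h2⟩
              exact ⟨by omega, h2⟩
        obtain ⟨t, ht0, ht, hta⟩ := hsplit (allocLaw w (m n) n)
        obtain ⟨t', ht0', ht', htb⟩ := hsplit (iidLaw (μ n) n)
        simp only [a, b]
        rw [hta, htb]
        rw [abs_le] at h1 h2 ⊢
        split_ifs <;> constructor <;> linarith
    have hsplit : ∀ (ρ : Measure (Fin n → ℕ)) [IsFiniteMeasure ρ],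
        ρ.real (jthLargest 1 ⁻¹' F) = ρ.real {y | x ≤ jthLargest 1 y ∧ jthLargest 1 y ∈ F} +
          ρ.real {y | jthLargest 1 y < x ∧ jthLargest 1 y ∈ F} := by
      intro ρ _
      rw [← measureReal_union _ (hms _)]
      · congr 1; ext y
        simp only [Set.mem_preimage, Set.mem_union, Set.mem_ofPred_eq]
        rcases le_or_gt x (jthLargest 1 y) with h | h
        · simp [h]
        · simp [h]
      · refine Set.disjoint_left.2 fun y hy hy' => ?_
        exact absurd hy.1 (not_le.2 hy'.1)
    have ea : a (jthLargest 1 ⁻¹' F) = _ := hsplit (allocLaw w (m n) n)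
    have eb : b (jthLargest 1 ⁻¹' F) = _ := hsplit (iidLaw (μ n) n)
    rw [ea, eb]
    rw [abs_le] at hE1 hlow ⊢
    constructor <;> linarith

end

/-! ### The functions `Φ` and `Ψ` at real arguments -/

section RealFunctions

variable (w : ℕ → ℝ≥0)

/-- `∑ w_k t^k` for real `t`. -/
def genSum (t : ℝ) : ℝ := ∑' k : ℕ, (w k : ℝ) * t ^ k

/-- `∑ k w_k t^k` for real `t`. -/
def genMoment (t : ℝ) : ℝ := ∑' k : ℕ, (k : ℝ) * (w k : ℝ) * t ^ k

variable {w}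

lemma summable_of_moment {t : ℝ} (ht : 0 ≤ t)
    (h : Summable fun k : ℕ => (k : ℝ) * (w k : ℝ) * t ^ k) :
    Summable fun k : ℕ => (w k : ℝ) * t ^ k := by
  rw [← summable_nat_add_iff 1] at h ⊢
  refine Summable.of_nonneg_of_le (fun k => by positivity) (fun k => ?_) h
  push_cast
  rw [mul_assoc]
  exact le_mul_of_one_le_left (by positivity) (by linarith [Nat.cast_nonneg (α := ℝ) k])

lemma summable_moment_of_le {s t : ℝ} (hs : 0 ≤ s) (hst : s ≤ t)
    (h : Summable fun k : ℕ => (k : ℝ) * (w k : ℝ) * t ^ k) :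
    Summable fun k : ℕ => (k : ℝ) * (w k : ℝ) * s ^ k :=
  Summable.of_nonneg_of_le (fun k => by positivity) (fun k => by gcongr) h

lemma summable_of_le {s t : ℝ} (hs : 0 ≤ s) (hst : s ≤ t)
    (h : Summable fun k : ℕ => (w k : ℝ) * t ^ k) :
    Summable fun k : ℕ => (w k : ℝ) * s ^ k :=
  Summable.of_nonneg_of_le (fun k => by positivity) (fun k => by gcongr) h

lemma summable_sq_of_lt {s t : ℝ} (hs : 0 ≤ s) (hst : s < t)
    (h : Summable fun k : ℕ => (w k : ℝ) * t ^ k) :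
    Summable fun k : ℕ => ((k : ℝ) ^ 2 + 1) * ((w k : ℝ) * s ^ k) := by
  have ht : 0 < t := hs.trans_lt hst
  have hlim : Tendsto (fun k : ℕ => ((k : ℝ) ^ 2 + 1) * (s / t) ^ k) atTop (𝓝 (0 + 0)) := by
    have h1 : s / t < 1 := (div_lt_one ht).2 hst
    have h2 : |s / t| < 1 := by rwa [abs_of_nonneg (by positivity)]
    simp_rw [add_mul, one_mul]
    exact (tendsto_pow_const_mul_const_pow_of_abs_lt_one 2 h2).add
      (tendsto_pow_atTop_nhds_zero_of_lt_one (by positivity) h1)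
  rw [add_zero] at hlim
  obtain ⟨C, hC⟩ := hlim.bddAbove_range
  refine Summable.of_nonneg_of_le (fun k => by positivity) (fun k => ?_) (h.mul_left C)
  have h3 : ((k : ℝ) ^ 2 + 1) * (s / t) ^ k ≤ C := hC ⟨k, rfl⟩
  have h4 : s ^ k = (s / t) ^ k * t ^ k := by rw [div_pow]; field_simp
  calc ((k : ℝ) ^ 2 + 1) * ((w k : ℝ) * s ^ k) =
        ((k : ℝ) ^ 2 + 1) * (s / t) ^ k * ((w k : ℝ) * t ^ k) := by rw [h4]; ring
    _ ≤ _ := by gcongr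

lemma summable_moment_of_sq {t : ℝ} (ht : 0 ≤ t)
    (h : Summable fun k : ℕ => ((k : ℝ) ^ 2 + 1) * ((w k : ℝ) * t ^ k)) :
    Summable fun k : ℕ => (k : ℝ) * (w k : ℝ) * t ^ k := by
  refine Summable.of_nonneg_of_le (fun k => by positivity) (fun k => ?_) h
  rw [mul_assoc]
  gcongr
  nlinarith [sq_nonneg ((k : ℝ) - 1)]

lemma genSum_pos (hw0 : 0 < w 0) {t : ℝ} (ht : 0 ≤ t)
    (h : Summable fun k : ℕ => (w k : ℝ) * t ^ k) : 0 < genSum w t :=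
  h.tsum_pos (fun k => by positivity) 0 (by simpa using hw0)

lemma genSum_mono {s t : ℝ} (hs : 0 ≤ s) (hst : s ≤ t)
    (h : Summable fun k : ℕ => (w k : ℝ) * t ^ k) : genSum w s ≤ genSum w t :=
  Summable.tsum_le_tsum (fun k => by gcongr) (summable_of_le hs hst h) h

lemma genMoment_pos {t : ℝ} (ht : 0 < t) {k₁ : ℕ} (hk₁ : k₁ ≠ 0) (hw : 0 < w k₁)
    (h : Summable fun k : ℕ => (k : ℝ) * (w k : ℝ) * t ^ k) : 0 < genMoment w t := by
  refine h.tsum_pos (fun k => by positivity) k₁ ?_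
  have h1 : (0 : ℝ) < k₁ := by exact_mod_cast Nat.pos_of_ne_zero hk₁
  have h2 : (0 : ℝ) < w k₁ := by exact_mod_cast hw
  positivity

/-- The ratio `Ψ = genMoment / genSum` grows at least logarithmically. -/
lemma log_div_le_ratio_sub (hw0 : 0 < w 0) {s t : ℝ} (hs : 0 < s) (hst : s ≤ t)
    (h : Summable fun k : ℕ => (k : ℝ) * (w k : ℝ) * t ^ k) :
    (genMoment w s / genSum w s) ^ 2 * w 0 * Real.log (t / s) ≤
      (genMoment w t / genSum w t - genMoment w s / genSum w s) * genSum w t := by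
  have ht : 0 < t := hs.trans_le hst
  have hS := summable_of_moment ht.le h
  have hs1 := summable_moment_of_le hs.le hst h
  have hs0 := summable_of_moment hs.le hs1
  have hFs := genSum_pos hw0 hs.le hs0
  have hFt := genSum_pos hw0 ht.le hS
  have hN : 0 ≤ genMoment w s := tsum_nonneg fun k => by positivity
  set a := genMoment w s / genSum w s with ha
  have ha0 : 0 ≤ a := by positivity
  set x := t / s
  have hx : 1 ≤ x := (one_le_div hs).2 hst
  have hx0 : 0 < x := by positivity
  have e1 : HasSum (fun k : ℕ => (k - a) * ((w k : ℝ) * t ^ k))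
      (genMoment w t - a * genSum w t) := by
    convert! h.hasSum.sub (hS.hasSum.mul_left a) using 1
    ext k; ring
  have e2 : HasSum (fun k : ℕ => (k - a) * ((w k : ℝ) * s ^ k)) 0 := by
    have : genMoment w s - a * genSum w s = 0 := by rw [ha]; field_simp; ring
    rw [← this]
    convert! hs1.hasSum.sub (hs0.hasSum.mul_left a) using 1
    ext k; ring
  -- Subtracting `x^a` times the vanishing sum `e2` makes every term nonnegative, as `k - a` and
  -- `x^k - x^a` have the same sign. The term `k = 0` alone then gives the bound.
  have e3 : HasSum (fun k : ℕ => (k - a) * (w k * s ^ k) * (x ^ k - x ^ a))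
      (genMoment w t - a * genSum w t) := by
    have := e1.sub (e2.mul_right (x ^ a))
    rw [zero_mul, sub_zero] at this
    convert! this using 1
    ext k
    have : t ^ k = s ^ k * x ^ k := by rw [← mul_pow]; congr 1; simp only [x]; field_simp
    rw [this]; ring
  have e4 : ∀ k : ℕ, 0 ≤ (k - a) * (w k * s ^ k) * (x ^ k - x ^ a) := by
    intro k
    rcases le_total (k : ℝ) a with hk | hk
    · have : x ^ k ≤ x ^ a := by
        rw [← Real.rpow_natCast]; exact Real.rpow_le_rpow_of_exponent_le hx hk
      refine mul_nonneg_of_nonpos_of_nonpos ?_ (by linarith)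
      exact mul_nonpos_of_nonpos_of_nonneg (by linarith) (by positivity)
    · have : x ^ a ≤ x ^ k := by
        rw [← Real.rpow_natCast]; exact Real.rpow_le_rpow_of_exponent_le hx hk
      have h1 : 0 ≤ k - a := by linarith
      have h2 : 0 ≤ x ^ k - x ^ a := by linarith
      positivity
  have e5 := le_hasSum e3 0 fun k _ => e4 k
  have e6 : a * Real.log x ≤ x ^ a - 1 := by
    have := Real.add_one_le_exp (a * Real.log x)
    rw [Real.rpow_def_of_pos hx0, mul_comm (Real.log x)]
    linarith
  have e7 : (genMoment w t / genSum w t - a) * genSum w t = genMoment w t - a * genSum w t := by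
    field_simp
  rw [e7]
  refine le_trans ?_ e5
  simp only [Nat.cast_zero, pow_zero, mul_one]
  have := mul_le_mul_of_nonneg_left e6 (by positivity : 0 ≤ a * w 0)
  linarith

lemma genMoment_zero : genMoment w 0 = 0 := by
  rw [genMoment, ← tsum_zero (α := ℝ) (β := ℕ)]
  congr 1; ext k
  rcases Nat.eq_zero_or_pos k with rfl | hk
  · simp
  · simp [hk.ne']

lemma ratio_strictMono (hw0 : 0 < w 0) {k₁ : ℕ} (hk₁ : k₁ ≠ 0) (hw : 0 < w k₁) {s t : ℝ}
    (hs : 0 ≤ s) (hst : s < t) (h : Summable fun k : ℕ => (k : ℝ) * (w k : ℝ) * t ^ k) :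
    genMoment w s / genSum w s < genMoment w t / genSum w t := by
  have ht : 0 < t := hs.trans_lt hst
  have hFt := genSum_pos hw0 ht.le (summable_of_moment ht.le h)
  have hNt := genMoment_pos ht hk₁ hw h
  rcases hs.eq_or_lt with rfl | hs
  · rw [genMoment_zero, zero_div]; positivity
  · have hs1 := summable_moment_of_le hs.le hst.le h
    have hFs := genSum_pos hw0 hs.le (summable_of_moment hs.le hs1)
    have hNs := genMoment_pos hs hk₁ hw hs1
    have h1 := log_div_le_ratio_sub hw0 hs hst.le h
    have h2 : 0 < Real.log (t / s) := Real.log_pos ((one_lt_div hs).2 hst)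
    have h3 : (0 : ℝ) < w 0 := by exact_mod_cast hw0
    have h4 : 0 < (genMoment w s / genSum w s) ^ 2 * w 0 * Real.log (t / s) := by positivity
    have h5 := pos_of_mul_pos_left (h4.trans_le h1) hFt.le
    linarith

/-- Growth of `Φ` is controlled by `Ψ` (Jensen's inequality). -/
lemma genSum_le_mul_pow (hw0 : 0 < w 0) {s t : ℝ} (hs : 0 < s) (hst : s ≤ t)
    (h : Summable fun k : ℕ => (k : ℝ) * (w k : ℝ) * t ^ k) {L : ℕ}
    (hL : genMoment w t / genSum w t ≤ L) : genSum w t ≤ genSum w s * (t / s) ^ L := by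
  have ht : 0 < t := hs.trans_le hst
  have hS := summable_of_moment ht.le h
  have hs0 := summable_of_le hs.le hst hS
  have hFt := genSum_pos hw0 ht.le hS
  set x := t / s
  have hx : 1 ≤ x := (one_le_div hs).2 hst
  have hx0 : 0 < x := by positivity
  have hN : genMoment w t ≤ L * genSum w t := by rwa [div_le_iff₀ hFt] at hL
  -- The inequality `1 + y ≤ e^y` at `y = (L - k) log x` bounds each term by `w_k s^k x^L`; the
  -- hypothesis `Ψ(t) ≤ L` makes the logarithmic correction of the sum nonnegative.
  have e1 : HasSum (fun k : ℕ => (w k : ℝ) * t ^ k * (1 - (k - L) * Real.log x))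
      (genSum w t - (genMoment w t - L * genSum w t) * Real.log x) := by
    convert! hS.hasSum.sub ((h.hasSum.sub (hS.hasSum.mul_left (L : ℝ))).mul_right (Real.log x))
      using 1
    ext k; ring
  have e2 : HasSum (fun k : ℕ => (w k : ℝ) * s ^ k * x ^ L) (genSum w s * x ^ L) :=
    hs0.hasSum.mul_right _
  have e3 := hasSum_le (fun k => ?_) e1 e2
  · have := mul_nonneg (sub_nonneg.2 hN) (Real.log_nonneg hx)
    linarith
  · have h1 := Real.add_one_le_exp (-((k - L) * Real.log x))
    have h2 : Real.exp (-((k - L) * Real.log x)) * x ^ k = x ^ L := by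
      rw [← Real.rpow_natCast x L, ← Real.rpow_natCast x k, Real.rpow_def_of_pos hx0,
        Real.rpow_def_of_pos hx0, ← Real.exp_add]
      congr 1; ring
    have h3 : t ^ k = s ^ k * x ^ k := by rw [← mul_pow]; congr 1; simp only [x]; field_simp
    rw [← h2, h3]
    calc (w k : ℝ) * (s ^ k * x ^ k) * (1 - (k - L) * Real.log x) ≤
          (w k : ℝ) * (s ^ k * x ^ k) * Real.exp (-((k - L) * Real.log x)) := by
            gcongr; linarith
      _ = _ := by ring

lemma exists_ratio_eq (hw0 : 0 < w 0) {t : ℝ} (ht : 0 ≤ t)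
    (h : Summable fun k : ℕ => (k : ℝ) * (w k : ℝ) * t ^ k) {x : ℝ} (hx0 : 0 ≤ x)
    (hx : x ≤ genMoment w t / genSum w t) :
    ∃ s ∈ Set.Icc 0 t, genMoment w s / genSum w s = x := by
  have hS := summable_of_moment ht h
  have hc1 : ContinuousOn (genSum w) (Set.Icc 0 t) := by
    refine continuousOn_tsum (fun k => by fun_prop) hS fun k s hs => ?_
    rw [Real.norm_of_nonneg (mul_nonneg (by positivity) (pow_nonneg hs.1 k))]
    have := hs.1; have := hs.2
    gcongr
  have hc2 : ContinuousOn (genMoment w) (Set.Icc 0 t) := by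
    refine continuousOn_tsum (fun k => by fun_prop) h fun k s hs => ?_
    rw [Real.norm_of_nonneg (mul_nonneg (by positivity) (pow_nonneg hs.1 k))]
    have := hs.1; have := hs.2
    gcongr
  have hc : ContinuousOn (fun s => genMoment w s / genSum w s) (Set.Icc 0 t) :=
    hc2.div hc1 fun s hs => (genSum_pos hw0 hs.1 (summable_of_le hs.1 hs.2 hS)).ne'
  have h0 : genMoment w 0 / genSum w 0 = 0 := by rw [genMoment_zero, zero_div]
  exact intermediate_value_Icc ht hc ⟨by rw [h0]; exact hx0, hx⟩

end RealFunctions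

/-! ### The function `Ψ` on `[0, ρ]` -/

section ExtendedFunctions

variable {w : ℕ → ℝ≥0}

lemma Phi_coe_ne_top_iff (t : ℝ≥0) :
    Phi w t ≠ ⊤ ↔ Summable fun k : ℕ => (w k : ℝ) * (t : ℝ) ^ k := by
  have h : Phi w t = ∑' k : ℕ, ((w k * t ^ k : ℝ≥0) : ℝ≥0∞) := by
    unfold Phi; congr 1
  rw [h, ENNReal.tsum_coe_ne_top_iff_summable, ← NNReal.summable_coe]
  push_cast
  rfl

lemma Phi_coe_eq {t : ℝ≥0} (h : Summable fun k : ℕ => (w k : ℝ) * (t : ℝ) ^ k) :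
    Phi w t = ENNReal.ofReal (genSum w t) := by
  rw [genSum, ENNReal.ofReal_tsum_of_nonneg (fun k => by positivity) h, Phi]
  congr 1; ext k
  rw [ENNReal.ofReal_mul (by positivity), ENNReal.ofReal_pow (by positivity)]
  simp

lemma psiRatio_coe_eq (hw0 : 0 < w 0) {t : ℝ≥0}
    (h : Summable fun k : ℕ => (k : ℝ) * (w k : ℝ) * (t : ℝ) ^ k) :
    psiRatio w t = ENNReal.ofReal (genMoment w t / genSum w t) := by
  have hS := summable_of_moment t.coe_nonneg h
  rw [psiRatio, Phi_coe_eq hS, ENNReal.ofReal_div_of_pos (genSum_pos hw0 t.coe_nonneg hS), genMoment,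
    ENNReal.ofReal_tsum_of_nonneg (fun k => by positivity) h]
  congr 2; ext k
  rw [ENNReal.ofReal_mul (by positivity), ENNReal.ofReal_pow (by positivity),
    ENNReal.ofReal_mul (by positivity)]
  simp

lemma psiRatio_coe_eq_top {t : ℝ≥0} (hS : Summable fun k : ℕ => (w k : ℝ) * (t : ℝ) ^ k)
    (h : ¬ Summable fun k : ℕ => (k : ℝ) * (w k : ℝ) * (t : ℝ) ^ k) : psiRatio w t = ⊤ := by
  have h1 : (∑' k : ℕ, (k : ℝ≥0∞) * (w k : ℝ≥0∞) * (t : ℝ≥0∞) ^ k) = ⊤ := by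
    by_contra hne
    apply h
    have e : (∑' k : ℕ, (k : ℝ≥0∞) * (w k : ℝ≥0∞) * (t : ℝ≥0∞) ^ k) =
        ∑' k : ℕ, ((k * w k * t ^ k : ℝ≥0) : ℝ≥0∞) := by
      congr 1
    rw [e] at hne
    have := NNReal.summable_coe.2 (ENNReal.tsum_coe_ne_top_iff_summable.1 hne)
    push_cast at this
    exact this
  rw [psiRatio, h1, ENNReal.top_div_of_ne_top ((Phi_coe_ne_top_iff t).2 hS)]

lemma summable_of_lt_rho {t : ℝ≥0} (ht : (t : ℝ≥0∞) < rho w) :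
    Summable fun k : ℕ => (w k : ℝ) * (t : ℝ) ^ k := by
  have h := (FormalMultilinearSeries.ofScalars ℝ (fun k => (w k : ℝ))).summable_norm_mul_pow ht
  refine h.congr fun k => ?_
  rw [FormalMultilinearSeries.ofScalars_norm]
  simp

lemma summable_sq_of_lt_rho {t : ℝ≥0} (ht : (t : ℝ≥0∞) < rho w) :
    Summable fun k : ℕ => ((k : ℝ) ^ 2 + 1) * ((w k : ℝ) * (t : ℝ) ^ k) := by
  obtain ⟨t', h1, h2⟩ := ENNReal.lt_iff_exists_nnreal_btwn.1 ht
  exact summable_sq_of_lt t.coe_nonneg (by exact_mod_cast h1) (summable_of_lt_rho h2)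

lemma summable_moment_of_lt_rho {t : ℝ≥0} (ht : (t : ℝ≥0∞) < rho w) :
    Summable fun k : ℕ => (k : ℝ) * (w k : ℝ) * (t : ℝ) ^ k :=
  summable_moment_of_sq t.coe_nonneg (summable_sq_of_lt_rho ht)

lemma Psi_coe_of_lt_rho (hw0 : 0 < w 0) {t : ℝ≥0} (ht : (t : ℝ≥0∞) < rho w) :
    Psi w t = ENNReal.ofReal (genMoment w t / genSum w t) := by
  rw [Psi, if_neg ((Phi_coe_ne_top_iff t).2 (summable_of_lt_rho ht)),
    psiRatio_coe_eq hw0 (summable_moment_of_lt_rho ht)]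

lemma exists_pos_of_omega (hω : omega w = ⊤) (L : ℕ) : ∃ k, L < k ∧ 0 < w k := by
  by_contra! h
  have : omega w ≤ L := by
    refine iSup₂_le fun k hk => ?_
    by_contra hlt
    exact absurd (h k (by exact_mod_cast not_le.1 hlt)) (not_le.2 hk)
  rw [hω, top_le_iff] at this
  exact ENat.natCast_ne_top L this

/-- If `Ψ ≤ L` on `(0, ρ)`, then `Φ` grows at most like `t^L`. For `ρ = ∞` this contradicts a
positive weight of index above `L`; for `ρ < ∞` it bounds `Φ` near `ρ`, and the partial sums carry
the bound to `ρ`, contradicting `Φ(ρ) = ∞`. -/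
lemma psiRatio_unbounded (hw0 : 0 < w 0) (hω : omega w = ⊤) (hΦ : Phi w (rho w) = ⊤) (L : ℕ) :
    ∃ t : ℝ≥0, 0 < t ∧ (t : ℝ≥0∞) < rho w ∧ (L : ℝ) < genMoment w t / genSum w t := by
  by_contra! hcon
  have hρ0 : rho w ≠ 0 := by
    intro h0
    rw [h0] at hΦ
    have := (Phi_coe_ne_top_iff (w := w) 0).2 (summable_of_ne_finset_zero (s := {0})
      fun k hk => by simp at hk; simp [hk])
    exact this hΦ
  by_cases hρ : rho w = ⊤
  · obtain ⟨k, hk, hwk⟩ := exists_pos_of_omega hω L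
    have hwk' : (0 : ℝ) < w k := by exact_mod_cast hwk
    have h1 : Summable fun k : ℕ => (w k : ℝ) * ((1 : ℝ≥0) : ℝ) ^ k :=
      summable_of_lt_rho (by rw [hρ]; simp)
    have hF1 := genSum_pos hw0 zero_le_one h1
    -- Chosen so that `w_k t = Φ(1) + w_k` exceeds `Φ(1)`.
    set t : ℝ≥0 := ⟨genSum w 1 / w k + 1, by positivity⟩
    have ht1 : (1 : ℝ) ≤ t := by
      change 1 ≤ genSum w 1 / w k + 1
      have : 0 ≤ genSum w 1 / w k := by positivity
      linarith
    have ht : (t : ℝ≥0∞) < rho w := by rw [hρ]; simp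
    have h2 := genSum_le_mul_pow hw0 one_pos ht1 (summable_moment_of_lt_rho ht)
      (hcon t (by exact_mod_cast one_pos.trans_le ht1) ht)
    have h3 : (w k : ℝ) * (t : ℝ) ^ k ≤ genSum w t :=
      (summable_of_lt_rho ht).le_tsum k fun j _ => by positivity
    rw [div_one] at h2
    have h4 : (t : ℝ) ^ (L + 1) ≤ (t : ℝ) ^ k := pow_le_pow_right₀ ht1 hk
    have h5 : (w k : ℝ) * t * (t : ℝ) ^ L ≤ genSum w 1 * (t : ℝ) ^ L := by
      calc (w k : ℝ) * t * (t : ℝ) ^ L = (w k : ℝ) * (t : ℝ) ^ (L + 1) := by ring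
        _ ≤ (w k : ℝ) * (t : ℝ) ^ k := by gcongr
        _ ≤ _ := h3.trans h2
    have h6 := le_of_mul_le_mul_right h5 (by positivity)
    have h7 : (w k : ℝ) * t = genSum w 1 + w k := by
      change (w k : ℝ) * (genSum w 1 / w k + 1) = _
      field_simp
    linarith
  · lift rho w to ℝ≥0 using hρ with r hr
    have hr0 : 0 < r := by
      rw [pos_iff_ne_zero]; exact_mod_cast hρ0
    have hhalf : 0 < r / 2 := by positivity
    refine absurd hΦ ((Phi_coe_ne_top_iff r).2 ?_)
    refine summable_of_sum_range_le (c := genSum w (r / 2 : ℝ≥0) * 2 ^ L) (fun k => by positivity)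
      fun K => ?_
    have hcont : ContinuousWithinAt
        (fun t : ℝ => ∑ k ∈ Finset.range K, (w k : ℝ) * t ^ k) (Set.Iio r) r :=
      (continuous_finsetSum _ fun k _ => by fun_prop).continuousWithinAt
    refine le_of_tendsto hcont ?_
    have hr2 : ((r / 2 : ℝ≥0) : ℝ) < r := by
      push_cast
      have : (0 : ℝ) < r := by exact_mod_cast hr0
      linarith
    filter_upwards [Ioo_mem_nhdsLT hr2] with t ht
    have ht0 : 0 < t := (by positivity : (0 : ℝ) < (r / 2 : ℝ≥0)).trans ht.1
    lift t to ℝ≥0 using ht0.le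
    have htρ : (t : ℝ≥0∞) < rho w := by rw [← hr]; exact_mod_cast ht.2
    have h2 := genSum_le_mul_pow hw0 (s := (r / 2 : ℝ≥0)) (by positivity) ht.1.le
      (summable_moment_of_lt_rho htρ) (hcon t (by exact_mod_cast ht0) (by exact_mod_cast ht.2))
    refine ((summable_of_lt_rho htρ).sum_le_tsum _ fun k _ => by positivity).trans (h2.trans ?_)
    have hF := genSum_pos hw0 (t := (r / 2 : ℝ≥0)) (by positivity)
      (summable_of_le (by positivity) ht.1.le (summable_of_lt_rho htρ))
    gcongr
    rw [div_le_iff₀ (by positivity)]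
    have := ht.2.le
    push_cast
    linarith

lemma Psi_rho_eq_top (hw0 : 0 < w 0) (hω : omega w = ⊤) (hΦ : Phi w (rho w) = ⊤) :
    Psi w (rho w) = ⊤ := by
  rw [Psi, if_pos hΦ]
  obtain ⟨k₁, hk₁, hwk₁⟩ := exists_pos_of_omega hω 0
  have hρ0 : 0 < rho w := by
    obtain ⟨t, -, ht, -⟩ := psiRatio_unbounded hw0 hω hΦ 0
    exact pos_of_gt ht
  have : (𝓝[<] rho w).NeBot := by
    exact nhdsLT_neBot_of_exists_lt ⟨0, hρ0⟩
  refine Tendsto.limUnder_eq (ENNReal.tendsto_nhds_top fun L => ?_)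
  obtain ⟨t, -, ht, hL⟩ := psiRatio_unbounded hw0 hω hΦ L
  filter_upwards [Ioo_mem_nhdsLT ht] with u hu
  have hu' : u ≠ ⊤ := (hu.2.trans_le le_top).ne
  lift u to ℝ≥0 using hu'
  rw [psiRatio_coe_eq hw0 (summable_moment_of_lt_rho hu.2), ← ENNReal.ofReal_natCast,
    ENNReal.ofReal_lt_ofReal_iff_of_nonneg (by positivity)]
  exact hL.trans (ratio_strictMono hw0 hk₁.ne' hwk₁ t.coe_nonneg (by exact_mod_cast hu.1)
    (summable_moment_of_lt_rho hu.2))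

lemma rho_ne_top_of_Phi_ne_top (hω : omega w = ⊤) (hΦ : Phi w (rho w) ≠ ⊤) : rho w ≠ ⊤ := by
  intro h
  obtain ⟨k₁, hk₁, hwk₁⟩ := exists_pos_of_omega hω 0
  apply hΦ
  rw [h, Phi]
  refine ENNReal.tsum_eq_top_of_eq_top ⟨k₁, ?_⟩
  rw [ENNReal.top_pow hk₁.ne', ENNReal.mul_top]
  exact_mod_cast hwk₁.ne'

lemma Psi_strictMono (hw0 : 0 < w 0) (hω : omega w = ⊤) {s t : ℝ≥0∞} (hst : s < t)
    (ht : t ≤ rho w) : Psi w s < Psi w t := by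
  obtain ⟨k₁, hk₁, hwk₁⟩ := exists_pos_of_omega hω 0
  have hs : s ≠ ⊤ := (hst.trans_le le_top).ne
  lift s to ℝ≥0 using hs
  rw [Psi_coe_of_lt_rho hw0 (hst.trans_le ht)]
  by_cases hΦ : Phi w t = ⊤
  · have htρ : t = rho w := by
      by_contra hne
      have hlt := lt_of_le_of_ne ht hne
      have ht' : t ≠ ⊤ := (hlt.trans_le le_top).ne
      lift t to ℝ≥0 using ht'
      exact (Phi_coe_ne_top_iff t).2 (summable_of_lt_rho hlt) hΦ
    subst htρ
    rw [Psi_rho_eq_top hw0 hω hΦ]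
    exact ENNReal.ofReal_lt_top
  · have ht' : t ≠ ⊤ := by
      rintro rfl
      have hρ : rho w = ⊤ := top_le_iff.1 ht
      exact rho_ne_top_of_Phi_ne_top hω (by rwa [hρ]) hρ
    lift t to ℝ≥0 using ht'
    rw [Psi, if_neg hΦ]
    have hS := (Phi_coe_ne_top_iff t).1 hΦ
    by_cases hM : Summable fun k : ℕ => (k : ℝ) * (w k : ℝ) * (t : ℝ) ^ k
    · rw [psiRatio_coe_eq hw0 hM, ENNReal.ofReal_lt_ofReal_iff_of_nonneg]
      · exact ratio_strictMono hw0 hk₁.ne' hwk₁ s.coe_nonneg (by exact_mod_cast hst) hM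
      · exact div_nonneg (tsum_nonneg fun k => by positivity) (tsum_nonneg fun k => by positivity)
    · rw [psiRatio_coe_eq_top hS hM]
      exact ENNReal.ofReal_lt_top

/-- Levels below `ν` are exceeded strictly inside `[0, ρ)`. When `Φ(ρ) < ∞`, a partial sum of `∑ k
w_k ρ^k` exceeds `x Φ(ρ)`; by continuity this persists for some `t < ρ`, where moreover `Φ(t) ≤
Φ(ρ)`. -/
lemma exists_lt_ratio_of_lt_nu (hw0 : 0 < w 0) (hω : omega w = ⊤) {x : ℝ} (hx0 : 0 ≤ x)
    (hx : ENNReal.ofReal x < nu w) :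
    ∃ t : ℝ≥0, (t : ℝ≥0∞) < rho w ∧ x < genMoment w t / genSum w t := by
  by_cases hΦ : Phi w (rho w) = ⊤
  · obtain ⟨L, hL⟩ := exists_nat_gt x
    obtain ⟨t, -, ht, hLt⟩ := psiRatio_unbounded hw0 hω hΦ L
    exact ⟨t, ht, hL.trans hLt⟩
  · have hρ := rho_ne_top_of_Phi_ne_top hω hΦ
    rw [nu, Psi, if_neg hΦ] at hx
    obtain ⟨r, hr⟩ : ∃ r : ℝ≥0, (r : ℝ≥0∞) = rho w := ⟨_, ENNReal.coe_toNNReal hρ⟩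
    rw [← hr] at hx hΦ
    have hS := (Phi_coe_ne_top_iff r).1 hΦ
    have hF := genSum_pos hw0 r.coe_nonneg hS
    obtain ⟨K, hK⟩ : ∃ K : ℕ, x * genSum w r <
        ∑ k ∈ Finset.range K, (k : ℝ) * (w k : ℝ) * (r : ℝ) ^ k := by
      by_contra! hcon
      have hM : Summable fun k : ℕ => (k : ℝ) * (w k : ℝ) * (r : ℝ) ^ k :=
        summable_of_sum_range_le (fun k => by positivity) hcon
      have h1 : genMoment w r ≤ x * genSum w r :=
        Real.tsum_le_of_sum_range_le (fun k => by positivity) hcon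
      rw [psiRatio_coe_eq hw0 hM, ENNReal.ofReal_lt_ofReal_iff_of_nonneg hx0, lt_div_iff₀ hF] at hx
      linarith
    have hcont : ContinuousWithinAt
        (fun t : ℝ => ∑ k ∈ Finset.range K, (k : ℝ) * (w k : ℝ) * t ^ k) (Set.Iio r) r :=
      (continuous_finsetSum _ fun k _ => by fun_prop).continuousWithinAt
    have hr0 : (0 : ℝ) < r := by
      by_contra h
      have : (r : ℝ) = 0 := le_antisymm (not_lt.1 h) r.coe_nonneg
      rw [this] at hK
      have h0 : ∑ k ∈ Finset.range K, (k : ℝ) * (w k : ℝ) * (0 : ℝ) ^ k = 0 :=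
        Finset.sum_eq_zero fun k _ => by
          rcases Nat.eq_zero_or_pos k with rfl | hk
          · simp
          · simp [hk.ne']
      rw [h0] at hK
      rw [this] at hF
      nlinarith
    obtain ⟨t, ht1, ht2⟩ := ((hcont.eventually_const_lt hK).and (Ioo_mem_nhdsLT hr0)).exists
    lift t to ℝ≥0 using ht2.1.le
    have htρ : (t : ℝ≥0∞) < rho w := by rw [← hr]; exact_mod_cast ht2.2
    refine ⟨t, htρ, ?_⟩
    have hSt := summable_of_lt_rho htρ
    have hMt := summable_moment_of_lt_rho htρ
    have hFt := genSum_pos hw0 t.coe_nonneg hSt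
    rw [lt_div_iff₀ hFt]
    calc x * genSum w t ≤ x * genSum w r := by
          gcongr
          exact genSum_mono t.coe_nonneg ht2.2.le hS
      _ < _ := ht1
      _ ≤ _ := hMt.sum_le_tsum _ fun k _ => by positivity

/-- For `0 < x ≤ ν`, the equation `Ψ(t) = x` has the unique solution `τ(x)` in `[0, ρ]`. -/
lemma Psi_eq_iff_eq_tau (hw0 : 0 < w 0) (hω : omega w = ⊤) {x : ℝ} (hx0 : 0 ≤ x)
    (hx : ENNReal.ofReal x ≤ nu w) (t : ℝ≥0∞) :
    (t ≤ rho w ∧ Psi w t = ENNReal.ofReal x) ↔ t = tau w (ENNReal.ofReal x) := by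
  have hinj : ∀ s t : ℝ≥0∞, s ≤ rho w → t ≤ rho w → Psi w s = Psi w t → s = t := by
    intro s t hs ht h
    rcases lt_trichotomy s t with h1 | h1 | h1
    · exact absurd h (Psi_strictMono hw0 hω h1 ht).ne
    · exact h1
    · exact absurd h (Psi_strictMono hw0 hω h1 hs).ne'
  obtain ⟨t₀, ht₀, hPsi⟩ : ∃ t₀ ≤ rho w, Psi w t₀ = ENNReal.ofReal x := by
    rcases hx.eq_or_lt with h | h
    · exact ⟨rho w, le_rfl, h.symm⟩
    · obtain ⟨t, ht, hxt⟩ := exists_lt_ratio_of_lt_nu hw0 hω hx0 h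
      obtain ⟨s, hs, hsx⟩ := exists_ratio_eq hw0 t.coe_nonneg (summable_moment_of_lt_rho ht) hx0 hxt.le
      have hs0 := hs.1
      lift s to ℝ≥0 using hs0
      have hsρ : (s : ℝ≥0∞) < rho w := lt_of_le_of_lt (by exact_mod_cast hs.2) ht
      exact ⟨s, hsρ.le, by rw [Psi_coe_of_lt_rho hw0 hsρ, hsx]⟩
  have htau : tau w (ENNReal.ofReal x) = t₀ := by
    refine IsGreatest.csSup_eq ⟨⟨ht₀, hPsi.le⟩, fun s hs => ?_⟩
    by_contra hlt
    have := Psi_strictMono hw0 hω (not_le.1 hlt) hs.1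
    rw [hPsi] at this
    exact absurd hs.2 (not_le.2 this)
  rw [htau]
  constructor
  · rintro ⟨h1, h2⟩
    exact hinj _ _ h1 ht₀ (h2.trans hPsi.symm)
  · rintro rfl
    exact ⟨ht₀, hPsi⟩

/-- `τ(x)` is a positive real number at which `∑ k w_k t^k` converges, with ratio `x`. -/
lemma exists_tau_eq (hw0 : 0 < w 0) (hω : omega w = ⊤) {x : ℝ} (hx0 : 0 < x)
    (hx : ENNReal.ofReal x ≤ nu w) : ∃ t : ℝ≥0, 0 < t ∧ tau w (ENNReal.ofReal x) = t ∧
      (t : ℝ≥0∞) ≤ rho w ∧ (ENNReal.ofReal x < nu w → (t : ℝ≥0∞) < rho w) ∧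
      (Summable fun k : ℕ => (k : ℝ) * (w k : ℝ) * (t : ℝ) ^ k) ∧
      genMoment w t / genSum w t = x := by
  obtain ⟨hle, hPsi⟩ := (Psi_eq_iff_eq_tau hw0 hω hx0.le hx _).2 rfl
  set T := tau w (ENNReal.ofReal x)
  have hΦ : Phi w T ≠ ⊤ := by
    rcases hle.eq_or_lt with h | h
    · intro htop
      rw [h] at htop hPsi
      rw [Psi_rho_eq_top hw0 hω htop] at hPsi
      exact ENNReal.ofReal_ne_top hPsi.symm
    · have hT : T ≠ ⊤ := (h.trans_le le_top).ne
      rw [← ENNReal.coe_toNNReal hT] at h ⊢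
      exact (Phi_coe_ne_top_iff _).2 (summable_of_lt_rho h)
  have hT : T ≠ ⊤ := by
    intro h
    rw [h] at hle hΦ
    have hρ := top_le_iff.1 hle
    exact rho_ne_top_of_Phi_ne_top hω (by rwa [hρ]) hρ
  obtain ⟨t, ht⟩ : ∃ t : ℝ≥0, (t : ℝ≥0∞) = T := ⟨_, ENNReal.coe_toNNReal hT⟩
  rw [← ht] at hle hPsi hΦ
  have hS := (Phi_coe_ne_top_iff t).1 hΦ
  rw [Psi, if_neg hΦ] at hPsi
  have hM : Summable fun k : ℕ => (k : ℝ) * (w k : ℝ) * (t : ℝ) ^ k := by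
    by_contra h
    rw [psiRatio_coe_eq_top hS h] at hPsi
    exact ENNReal.ofReal_ne_top hPsi.symm
  rw [psiRatio_coe_eq hw0 hM] at hPsi
  have hr : genMoment w t / genSum w t = x := by
    have h0 : 0 ≤ genMoment w t / genSum w t :=
      div_nonneg (tsum_nonneg fun k => by positivity) (tsum_nonneg fun k => by positivity)
    exact (ENNReal.ofReal_eq_ofReal_iff h0 hx0.le).1 hPsi
  refine ⟨t, ?_, ht.symm, hle, fun hlt => lt_of_le_of_ne hle fun h => ?_, hM, hr⟩
  · rw [pos_iff_ne_zero]
    rintro rfl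
    rw [NNReal.coe_zero, genMoment_zero, zero_div] at hr
    exact hx0.ne hr
  · rw [nu, ← h, Psi, if_neg hΦ, psiRatio_coe_eq hw0 hM, hr] at hlt
    exact lt_irrefl _ hlt

end ExtendedFunctions

/-! ### Tilted laws -/

section TiltedLaws

variable {w : ℕ → ℝ≥0}

lemma tiltedLaw_real_singleton (hw0 : 0 < w 0) {t : ℝ≥0}
    (h : Summable fun k : ℕ => (w k : ℝ) * (t : ℝ) ^ k) (k : ℕ) :
    (tiltedLaw w t).real {k} = w k * (t : ℝ) ^ k / genSum w t := by
  have h1 : tiltedLaw w t {k} = (w k : ℝ≥0∞) * t ^ k / Phi w t := by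
    rw [tiltedLaw, Measure.sum_apply _ (measurableSet_singleton k), tsum_eq_single k]
    · simp
    · intro j hj
      simp [hj]
  rw [measureReal_def, h1, Phi_coe_eq h, ENNReal.toReal_div,
    ENNReal.toReal_ofReal (genSum_pos hw0 t.coe_nonneg h).le]
  simp

lemma isProbabilityMeasure_tiltedLaw (hw0 : 0 < w 0) {t : ℝ≥0}
    (h : Summable fun k : ℕ => (w k : ℝ) * (t : ℝ) ^ k) :
    IsProbabilityMeasure (tiltedLaw w t) := by
  constructor
  have h0 : Phi w t ≠ 0 := by
    rw [Phi_coe_eq h]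
    exact (ENNReal.ofReal_pos.2 (genSum_pos hw0 t.coe_nonneg h)).ne'
  rw [tiltedLaw, Measure.sum_apply _ MeasurableSet.univ]
  simp only [Measure.smul_apply, measure_univ, smul_eq_mul, mul_one, div_eq_mul_inv]
  rw [ENNReal.tsum_mul_right]
  exact ENNReal.mul_inv_cancel h0 ((Phi_coe_ne_top_iff t).2 h)

lemma isTilt_tiltedLaw (hw0 : 0 < w 0) {t : ℝ≥0} (ht : 0 < t)
    (h : Summable fun k : ℕ => (w k : ℝ) * (t : ℝ) ^ k) : IsTilt w (tiltedLaw w t) :=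
  ⟨t, genSum w t, by exact_mod_cast ht, genSum_pos hw0 t.coe_nonneg h,
    tiltedLaw_real_singleton hw0 h⟩

lemma integral_tiltedLaw (hw0 : 0 < w 0) {t : ℝ≥0}
    (h : Summable fun k : ℕ => (k : ℝ) * (w k : ℝ) * (t : ℝ) ^ k) :
    ∫ k : ℕ, (k : ℝ) ∂(tiltedLaw w t) = genMoment w t / genSum w t := by
  have hS := summable_of_moment t.coe_nonneg h
  have := isProbabilityMeasure_tiltedLaw hw0 hS
  have hterm : ∀ k : ℕ, (tiltedLaw w t).real {k} * (k : ℝ) =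
      (k : ℝ) * (w k : ℝ) * (t : ℝ) ^ k / genSum w t := fun k => by
    rw [tiltedLaw_real_singleton hw0 hS]; ring
  have hint : Integrable (fun k : ℕ => (k : ℝ)) (tiltedLaw w t) :=
    integrable_of_summable_real ((h.div_const (genSum w t)).congr fun k => by
      rw [Real.norm_of_nonneg (by positivity), hterm])
  rw [integral_countable hint, genMoment, ← tsum_div_const]
  exact tsum_congr fun k => by rw [smul_eq_mul, hterm]

lemma evariance_tiltedLaw_lt_top_iff (hw0 : 0 < w 0) {t : ℝ≥0}
    (h : Summable fun k : ℕ => (w k : ℝ) * (t : ℝ) ^ k) :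
    evariance (fun k : ℕ => (k : ℝ)) (tiltedLaw w t) < ⊤ ↔
      Summable fun k : ℕ => ((k : ℝ) ^ 2 + 1) * (tiltedLaw w t).real {k} := by
  have := isProbabilityMeasure_tiltedLaw hw0 h
  have hm : AEStronglyMeasurable (fun k : ℕ => (k : ℝ)) (tiltedLaw w t) :=
    Measurable.of_discrete.aestronglyMeasurable
  rw [evariance_lt_top_iff_memLp hm, memLp_two_iff_integrable_sq hm]
  constructor
  · intro hi
    have hi' := hi.add (integrable_const (1 : ℝ))
    have hfin := hi'.hasFiniteIntegral
    rw [HasFiniteIntegral, lintegral_countable'] at hfin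
    refine (ENNReal.summable_toReal hfin.ne).congr fun k => ?_
    rw [ENNReal.toReal_mul, measureReal_def, toReal_enorm, Real.norm_of_nonneg]
    · rfl
    · change 0 ≤ (k : ℝ) ^ 2 + 1
      positivity
  · intro hs
    refine integrable_of_le hs (fun k => le_rfl) (C := 1) fun k => ?_
    rw [Real.norm_of_nonneg (by positivity)]
    linarith

lemma weight_zero_le_genSum {t : ℝ} (ht : 0 ≤ t) (h : Summable fun k : ℕ => (w k : ℝ) * t ^ k) :
    (w 0 : ℝ) ≤ genSum w t := by
  simpa [genSum] using h.le_tsum 0 fun j _ => by positivity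

lemma tendsto_genSum {l : Filter ℕ} {s : ℕ → ℝ≥0} {t r : ℝ≥0} (hs : Tendsto s l (𝓝 t))
    (hsr : ∀ᶠ n in l, s n ≤ r) (hr : Summable fun k : ℕ => (w k : ℝ) * (r : ℝ) ^ k) :
    Tendsto (fun n => genSum w (s n)) l (𝓝 (genSum w t)) := by
  refine tendsto_tsum_of_dominated_convergence hr (fun k => ?_) ?_
  · exact ((NNReal.tendsto_coe.2 hs).pow k).const_mul _
  · filter_upwards [hsr] with n hn k
    rw [Real.norm_of_nonneg (by positivity)]
    have : (s n : ℝ) ≤ r := by exact_mod_cast hn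
    gcongr

lemma tiltedLaw_real_singleton_le (hw0 : 0 < w 0) {s r : ℝ≥0} (hsr : s ≤ r)
    (hr : Summable fun k : ℕ => (w k : ℝ) * (r : ℝ) ^ k) (k : ℕ) :
    (tiltedLaw w s).real {k} ≤ w k * (r : ℝ) ^ k / w 0 := by
  have hsr' : (s : ℝ) ≤ r := by exact_mod_cast hsr
  have hs := summable_of_le s.coe_nonneg hsr' hr
  have hw0' : (0 : ℝ) < w 0 := by exact_mod_cast hw0
  rw [tiltedLaw_real_singleton hw0 hs]
  have := weight_zero_le_genSum s.coe_nonneg hs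
  gcongr

/-- For parameters at most `r`, the masses are at most `w_k r^k / w_0` because `Φ ≥ w_0`, and `r <
ρ` gives this sequence a finite second moment. -/
lemma dominatedLaws_tiltedLaw (hw0 : 0 < w 0) {l : Filter ℕ} {s : ℕ → ℝ≥0} {t r : ℝ≥0}
    (hs : Tendsto s l (𝓝 t)) (htr : t < r) (hr : (r : ℝ≥0∞) < rho w) :
    DominatedLaws l (fun n => tiltedLaw w (s n)) (tiltedLaw w t)
      (fun k => w k * (r : ℝ) ^ k / w 0) := by
  have hS := summable_of_lt_rho hr
  have hsr : ∀ᶠ n in l, s n ≤ r := hs.eventually_le_const htr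
  have hsum : ∀ {u : ℝ≥0}, u ≤ r → Summable fun k : ℕ => (w k : ℝ) * (u : ℝ) ^ k := fun hu =>
    summable_of_le (NNReal.coe_nonneg _) (by exact_mod_cast hu) hS
  refine ⟨hsr.mono fun n hn => isProbabilityMeasure_tiltedLaw hw0 (hsum hn),
    isProbabilityMeasure_tiltedLaw hw0 (hsum htr.le), fun k => ?_,
    hsr.mono fun n hn => tiltedLaw_real_singleton_le hw0 hn hS, ?_⟩
  · rw [tiltedLaw_real_singleton hw0 (hsum htr.le)]
    refine Tendsto.congr' (hsr.mono fun n hn => (tiltedLaw_real_singleton hw0 (hsum hn) k).symm) ?_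
    exact (((NNReal.tendsto_coe.2 hs).pow k).const_mul _).div (tendsto_genSum hs hsr hS)
      (genSum_pos hw0 t.coe_nonneg (hsum htr.le)).ne'
  · refine ((summable_sq_of_lt_rho hr).div_const (w 0 : ℝ)).congr fun k => ?_
    ring

/-- Markov's inequality for `(u/r)^ξ`, whose mean is bounded uniformly over tilting parameters up to
`r`. -/
lemma mul_tiltedLaw_real_le (hw0 : 0 < w 0) {s r u : ℝ≥0} (hsr : s ≤ r) (hr0 : 0 < r)
    (hu : Summable fun k : ℕ => (w k : ℝ) * (u : ℝ) ^ k) (hru : r ≤ u) (a : ℝ) :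
    a * (tiltedLaw w s).real {k : ℕ | a ≤ ((u : ℝ) / r) ^ k} ≤ genSum w u / w 0 := by
  have hr0' : (0 : ℝ) < r := by exact_mod_cast hr0
  have hw0' : (0 : ℝ) < w 0 := by exact_mod_cast hw0
  have hr := summable_of_le r.coe_nonneg (by exact_mod_cast hru) hu
  have := isProbabilityMeasure_tiltedLaw hw0
    (summable_of_le s.coe_nonneg (by exact_mod_cast hsr) hr)
  have hle : ∀ k : ℕ, (tiltedLaw w s).real {k} * ((u : ℝ) / r) ^ k ≤
      w k * (u : ℝ) ^ k / w 0 := fun k => by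
    calc (tiltedLaw w s).real {k} * ((u : ℝ) / r) ^ k
        ≤ (w k * (r : ℝ) ^ k / w 0) * ((u : ℝ) / r) ^ k := by
          gcongr
          exact tiltedLaw_real_singleton_le hw0 hsr hr k
      _ = _ := by
          rw [div_pow]
          field_simp
  have hsum : Summable fun k : ℕ => (tiltedLaw w s).real {k} * ((u : ℝ) / r) ^ k :=
    Summable.of_nonneg_of_le (fun k => by positivity) hle (hu.div_const _)
  have hint : Integrable (fun k : ℕ => ((u : ℝ) / r) ^ k) (tiltedLaw w s) :=
    integrable_of_summable_real (hsum.congr fun k => by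
      rw [Real.norm_of_nonneg (by positivity)])
  refine (mul_meas_ge_le_integral_of_nonneg (Eventually.of_forall fun k => by positivity)
    hint a).trans ?_
  rw [integral_countable hint, genSum, ← tsum_div_const]
  exact hsum.tsum_le_tsum hle (hu.div_const _)

lemma abs_measureReal_sub_le {μ μ' : Measure ℕ} [IsFiniteMeasure μ] [IsFiniteMeasure μ'] {F : Set ℕ}
    (hF : F.Finite) {ε : ℝ} (h : ∀ k ∈ F, |μ.real {k} - μ'.real {k}| ≤ ε * μ'.real {k}) :
    |μ.real F - μ'.real F| ≤ ε * μ'.real F := by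
  lift F to Finset ℕ using hF
  rw [← sum_measureReal_singleton, ← sum_measureReal_singleton, ← Finset.sum_sub_distrib,
    Finset.mul_sum]
  exact (Finset.abs_sum_le_sum_abs _ _).trans (Finset.sum_le_sum fun k hk => h k hk)

/-- If `x n → λ < ν`, then `τ(x n) → τ(λ) < ρ`. -/
lemma exists_tendsto_tau (hw0 : 0 < w 0) (hω : omega w = ⊤) {l : Filter ℕ} {x : ℕ → ℝ} {lam : ℝ}
    (hlam : 0 < lam) (hlt : ENNReal.ofReal lam < nu w) (hx : Tendsto x l (𝓝 lam)) :
    ∃ (t : ℝ≥0) (s : ℕ → ℝ≥0), 0 < t ∧ (t : ℝ≥0∞) < rho w ∧ tau w (ENNReal.ofReal lam) = t ∧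
      genMoment w t / genSum w t = lam ∧ Tendsto s l (𝓝 t) ∧
      ∀ᶠ n in l, 0 < x n ∧ ENNReal.ofReal (x n) ≤ nu w ∧ 0 < s n ∧ (s n : ℝ≥0∞) < rho w ∧
        tau w (ENNReal.ofReal (x n)) = s n ∧ genMoment w (s n) / genSum w (s n) = x n := by
  obtain ⟨k₁, hk₁, hwk₁⟩ := exists_pos_of_omega hω 0
  obtain ⟨t, ht0, htau, -, htρ, -, hmean⟩ := exists_tau_eq hw0 hω hlam hlt.le
  set s : ℕ → ℝ≥0 := fun n => (tau w (ENNReal.ofReal (x n))).toNNReal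
  have hs : ∀ᶠ n in l, 0 < x n ∧ ENNReal.ofReal (x n) ≤ nu w ∧ 0 < s n ∧
      (s n : ℝ≥0∞) < rho w ∧ tau w (ENNReal.ofReal (x n)) = s n ∧
      genMoment w (s n) / genSum w (s n) = x n := by
    filter_upwards [hx.eventually_const_lt hlam,
      (ENNReal.tendsto_ofReal hx).eventually_lt_const hlt] with n h0 hν
    obtain ⟨u, hu0, hu, -, huρ, -, hum⟩ := exists_tau_eq hw0 hω h0 hν.le
    have hsu : s n = u := by simp only [s, hu, ENNReal.toNNReal_coe]
    rw [hsu]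
    exact ⟨h0, hν.le, hu0, huρ hν, hu, hum⟩
  have hmono : ∀ {a b : ℝ≥0}, (a : ℝ≥0∞) < rho w →
      genMoment w a / genSum w a < genMoment w b / genSum w b → a < b := fun {a b} ha hab => by
    by_contra hba
    rcases (not_lt.1 hba).eq_or_lt with rfl | h
    · exact lt_irrefl _ hab
    · exact absurd hab (ratio_strictMono hw0 hk₁.ne' hwk₁ b.coe_nonneg (by exact_mod_cast h)
        (summable_moment_of_lt_rho ha)).not_gt
  refine ⟨t, s, ht0, htρ hlt, htau, hmean, tendsto_order.2 ⟨fun a ha => ?_, fun b hb => ?_⟩, hs⟩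
  · have hlt' : genMoment w a / genSum w a < lam := by
      rw [← hmean]
      exact ratio_strictMono hw0 hk₁.ne' hwk₁ a.coe_nonneg (by exact_mod_cast ha)
        (summable_moment_of_lt_rho (htρ hlt))
    filter_upwards [hs, hx.eventually_const_lt hlt'] with n hn hxn
    refine hmono ((by exact_mod_cast ha : (a : ℝ≥0∞) < t).trans (htρ hlt)) ?_
    rwa [hn.2.2.2.2.2]
  -- The bound `b` may lie beyond `ρ`, where `Ψ` gives no information, so a point between `t` and
  -- `min b ρ` is compared instead.
  · obtain ⟨c, hc1, hc2⟩ : ∃ c : ℝ≥0, (t : ℝ≥0∞) < c ∧ (c : ℝ≥0∞) < min (b : ℝ≥0∞) (rho w) :=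
      ENNReal.lt_iff_exists_nnreal_btwn.1 (lt_min (ENNReal.coe_lt_coe.2 hb) (htρ hlt))
    have hlt' : lam < genMoment w c / genSum w c := by
      rw [← hmean]
      exact ratio_strictMono hw0 hk₁.ne' hwk₁ t.coe_nonneg (by exact_mod_cast hc1)
        (summable_moment_of_lt_rho (hc2.trans_le (min_le_right _ _)))
    filter_upwards [hs, hx.eventually_lt_const hlt'] with n hn hxn
    have : s n < c := hmono hn.2.2.2.1 (by rwa [hn.2.2.2.2.2])
    exact this.trans (by exact_mod_cast hc2.trans_le (min_le_left _ _))

/-- The logarithm of the tilting parameter is Lipschitz in the mean. -/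
lemma abs_log_sub_log_le (hw0 : 0 < w 0) {s t r : ℝ≥0} (hs : 0 < s) (ht : 0 < t) (hsr : s ≤ r)
    (htr : t ≤ r) (hr : (r : ℝ≥0∞) < rho w) {a : ℝ} (ha : 0 < a)
    (hsa : a ≤ genMoment w s / genSum w s) (hta : a ≤ genMoment w t / genSum w t) :
    |Real.log s - Real.log t| ≤ genSum w r / (a ^ 2 * w 0) *
      |genMoment w s / genSum w s - genMoment w t / genSum w t| := by
  wlog hst : s ≤ t generalizing s t
  · rw [abs_sub_comm, abs_sub_comm (genMoment w s / genSum w s)]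
    exact this ht hs htr hsr hta hsa (not_le.1 hst).le
  have hs' : (0 : ℝ) < s := by exact_mod_cast hs
  have ht' : (0 : ℝ) < t := by exact_mod_cast ht
  have hst' : (s : ℝ) ≤ t := by exact_mod_cast hst
  have htr' : (t : ℝ) ≤ r := by exact_mod_cast htr
  have hw0' : (0 : ℝ) < w 0 := by exact_mod_cast hw0
  have h := log_div_le_ratio_sub hw0 hs' hst'
    (summable_moment_of_le ht'.le htr' (summable_moment_of_lt_rho hr))
  have hG := genSum_mono ht'.le htr' (summable_of_lt_rho hr)
  have hG0 := genSum_pos hw0 ht'.le (summable_of_le ht'.le htr' (summable_of_lt_rho hr))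
  have hlog : 0 ≤ Real.log (t / s) := Real.log_nonneg ((one_le_div hs').2 hst')
  have e : |Real.log s - Real.log t| = Real.log (t / s) := by
    rw [abs_sub_comm, ← Real.log_div ht'.ne' hs'.ne', abs_of_nonneg hlog]
  rw [e, div_mul_eq_mul_div, le_div_iff₀ (by positivity)]
  set D := genMoment w t / genSum w t - genMoment w s / genSum w s
  have hD : D ≤ |genMoment w s / genSum w s - genMoment w t / genSum w t| := by
    rw [abs_sub_comm]; exact le_abs_self _
  calc Real.log (t / s) * (a ^ 2 * w 0) = a ^ 2 * w 0 * Real.log (t / s) := by ring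
    _ ≤ (genMoment w s / genSum w s) ^ 2 * w 0 * Real.log (t / s) := by gcongr
    _ ≤ D * genSum w t := h
    _ ≤ |genMoment w s / genSum w s - genMoment w t / genSum w t| * genSum w t := by gcongr
    _ ≤ |genMoment w s / genSum w s - genMoment w t / genSum w t| * genSum w r := by gcongr
    _ = _ := mul_comm _ _

end TiltedLaws

/-! ### The largest boxes -/

section LargestBoxes

variable {w : ℕ → ℝ≥0} {m : ℕ → ℕ} {S : Set ℕ}

lemma configurationsClose_of_evariance (hw0 : 0 < w 0) (hω : omega w = ⊤)
    (hZ : ∀ n ∈ S, 0 < partitionFn w (m n) n) {t : ℝ≥0} (ht : 0 < t)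
    (h : Summable fun k : ℕ => (k : ℝ) * (w k : ℝ) * (t : ℝ) ^ k)
    (hvar : evariance (fun k : ℕ => (k : ℝ)) (tiltedLaw w t) < ⊤)
    (hm : (fun n : ℕ => (m n : ℝ) - genMoment w t / genSum w t * n)
      =o[atTop ⊓ 𝓟 S] (fun n : ℕ => √(n : ℝ))) :
    ConfigurationsClose w m S (fun _ => tiltedLaw w t) := by
  obtain ⟨k₁, hk₁, hwk₁⟩ := exists_pos_of_omega hω 0
  have hS := summable_of_moment t.coe_nonneg h
  have hp := isProbabilityMeasure_tiltedLaw hw0 hS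
  have hD : DominatedLaws (atTop ⊓ 𝓟 S) (fun _ => tiltedLaw w t) (tiltedLaw w t)
      (fun k => (tiltedLaw w t).real {k}) :=
    ⟨Eventually.of_forall fun _ => hp, hp, fun k => tendsto_const_nhds,
      Eventually.of_forall fun _ _ => le_rfl, (evariance_tiltedLaw_lt_top_iff hw0 hS).1 hvar⟩
  have hT := isTilt_tiltedLaw hw0 ht hS
  refine hD.configurationsClose hw0 hk₁.ne' hwk₁ hZ hT (Eventually.of_forall fun _ => hT) ?_
  simpa only [integral_tiltedLaw hw0 h, mul_comm] using hm

/-- Each law has mean exactly `m / n`, so the `o(√n)` condition holds with difference zero. -/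
lemma configurationsClose_of_tendsto (hw0 : 0 < w 0) (hω : omega w = ⊤)
    (hZ : ∀ n ∈ S, 0 < partitionFn w (m n) n) {t : ℝ≥0} {s : ℕ → ℝ≥0} (ht : 0 < t)
    (htρ : (t : ℝ≥0∞) < rho w) (hs : Tendsto s (atTop ⊓ 𝓟 S) (𝓝 t))
    (hs' : ∀ᶠ n in atTop ⊓ 𝓟 S, 0 < s n ∧ (s n : ℝ≥0∞) < rho w ∧
      genMoment w (s n) / genSum w (s n) = (m n : ℝ) / n) :
    ConfigurationsClose w m S (fun n => tiltedLaw w (s n)) := by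
  obtain ⟨k₁, hk₁, hwk₁⟩ := exists_pos_of_omega hω 0
  obtain ⟨r, hr1, hr2⟩ := ENNReal.lt_iff_exists_nnreal_btwn.1 htρ
  refine (dominatedLaws_tiltedLaw hw0 hs (ENNReal.coe_lt_coe.1 hr1) hr2).configurationsClose
    hw0 hk₁.ne' hwk₁ hZ (isTilt_tiltedLaw hw0 ht (summable_of_lt_rho htρ))
    (hs'.mono fun n hn => isTilt_tiltedLaw hw0 hn.1 (summable_of_lt_rho hn.2.1)) ?_
  refine (isLittleO_zero _ _).congr' ?_ EventuallyEq.rfl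
  filter_upwards [hs', mem_inf_of_left (eventually_ge_atTop 1)] with n hn hn1
  have : (n : ℝ) ≠ 0 := by positivity
  rw [integral_tiltedLaw hw0 (summable_moment_of_lt_rho hn.2.1), hn.2.2]
  field_simp
  ring

/-- The law with tilting parameter `s n` may be replaced by that with the limiting parameter if
`log s n - log t = o(1 / log n)`. -/
lemma ConfigurationsClose.tiltedLaw_limit (hw0 : 0 < w 0) {t : ℝ≥0} {s : ℕ → ℝ≥0} (ht : 0 < t)
    (htρ : (t : ℝ≥0∞) < rho w) (hs : Tendsto s (atTop ⊓ 𝓟 S) (𝓝 t))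
    (hlog : Tendsto (fun n : ℕ => Real.log n * |Real.log (s n) - Real.log t|) (atTop ⊓ 𝓟 S) (𝓝 0))
    (h : ConfigurationsClose w m S (fun n => tiltedLaw w (s n))) :
    ConfigurationsClose w m S (fun _ => tiltedLaw w t) := by
  obtain ⟨r, htr', hrρ⟩ := ENNReal.lt_iff_exists_nnreal_btwn.1 htρ
  obtain ⟨u, hru', huρ⟩ := ENNReal.lt_iff_exists_nnreal_btwn.1 hrρ
  have htr := ENNReal.coe_lt_coe.1 htr'
  have hru := ENNReal.coe_lt_coe.1 hru'
  have hr0 : 0 < r := ht.trans htr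
  have hr0' : (0 : ℝ) < r := by exact_mod_cast hr0
  have ht' : (0 : ℝ) < t := by exact_mod_cast ht
  have hw0' : (0 : ℝ) < w 0 := by exact_mod_cast hw0
  have hSu := summable_of_lt_rho huρ
  have hSr := summable_of_lt_rho hrρ
  have hSt := summable_of_lt_rho htρ
  have hGt := genSum_pos hw0 ht'.le hSt
  have hGu := genSum_pos hw0 u.coe_nonneg hSu
  have hsum : ∀ {v : ℝ≥0}, v ≤ r → Summable fun k : ℕ => (w k : ℝ) * (v : ℝ) ^ k := fun hv =>
    summable_of_le (NNReal.coe_nonneg _) (by exact_mod_cast hv) hSr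
  have hsr : ∀ᶠ n in atTop ⊓ 𝓟 S, s n ≤ r := hs.eventually_le_const htr
  have hs0 : ∀ᶠ n in atTop ⊓ 𝓟 S, 0 < s n := hs.eventually_const_lt ht
  have hq : 1 < (u : ℝ) / r := (one_lt_div hr0').2 (by exact_mod_cast hru)
  set b := Real.log ((u : ℝ) / r)
  have hb : 0 < b := Real.log_pos hq
  refine h.congr_law (hsr.mono fun n hn => isProbabilityMeasure_tiltedLaw hw0 (hsum hn))
    (Eventually.of_forall fun _ => isProbabilityMeasure_tiltedLaw hw0 hSt) fun ε hε => ?_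
  set δ : ℕ → ℝ := fun n => 2 / b * (Real.log n * |Real.log (s n) - Real.log t|)
  have hδ : Tendsto δ (atTop ⊓ 𝓟 S) (𝓝 0) := by simpa using hlog.const_mul (2 / b)
  set g : ℕ → ℝ := fun n => genSum w t / genSum w (s n)
  have hg : Tendsto g (atTop ⊓ 𝓟 S) (𝓝 1) := by
    have := (tendsto_const_nhds (x := genSum w t)).div (tendsto_genSum hs hsr hSr) hGt.ne'
    rwa [div_self hGt.ne'] at this
  have hup : Tendsto (fun n => Real.exp (δ n) * g n) (atTop ⊓ 𝓟 S) (𝓝 1) := by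
    simpa using ((Real.continuous_exp.tendsto 0).comp hδ).mul hg
  have hlow : Tendsto (fun n => Real.exp (-δ n) * g n) (atTop ⊓ 𝓟 S) (𝓝 1) := by
    have hδ' : Tendsto (fun n => -δ n) (atTop ⊓ 𝓟 S) (𝓝 0) := by simpa using hδ.neg
    simpa using ((Real.continuous_exp.tendsto 0).comp hδ').mul hg
  have htail : Tendsto (fun n : ℕ => genSum w u / w 0 / (n : ℝ)) (atTop ⊓ 𝓟 S) (𝓝 0) :=
    (tendsto_const_div_atTop_nhds_zero_nat _).mono_left inf_le_left
  filter_upwards [hsr, hs0, mem_inf_of_left (eventually_ge_atTop 1),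
    hup.eventually_le_const (show (1 : ℝ) < 1 + ε by linarith),
    hlow.eventually_const_le (show 1 - ε < (1 : ℝ) by linarith),
    htail.eventually_le_const hε] with n hsn hs0n hn1 hupn hlown htn
  have hn0 : (0 : ℝ) < n := by positivity
  have hsn0 : (0 : ℝ) < s n := by exact_mod_cast hs0n
  have hGs := genSum_pos hw0 hsn0.le (hsum hsn)
  have hps := isProbabilityMeasure_tiltedLaw hw0 (hsum hsn)
  have hpt := isProbabilityMeasure_tiltedLaw hw0 hSt
  -- The cutoff at `n²` rather than `n` makes the tail, after multiplication by `n`, of order `1/n`;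
  -- the values kept are still `O(log n)`.
  have hKlog : ∀ k ∈ {k : ℕ | (n : ℝ) ^ 2 ≤ ((u : ℝ) / r) ^ k}ᶜ, (k : ℝ) ≤ 2 / b * Real.log n := by
    intro k hk
    have hk' : ((u : ℝ) / r) ^ k < (n : ℝ) ^ 2 := not_le.1 hk
    have := Real.log_lt_log (by positivity) hk'
    rw [Real.log_pow, Real.log_pow] at this
    push_cast at this
    rw [div_mul_eq_mul_div, le_div_iff₀ hb]
    exact this.le
  have hcompl : ∀ v : ℝ≥0, v ≤ r →
      n * (tiltedLaw w v).real {k : ℕ | (n : ℝ) ^ 2 ≤ ((u : ℝ) / r) ^ k} ≤ ε := fun v hv => by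
    refine le_trans ?_ htn
    rw [le_div_iff₀ hn0]
    have := mul_tiltedLaw_real_le hw0 hv hr0 hSu hru.le ((n : ℝ) ^ 2)
    linarith
  refine ⟨{k : ℕ | (n : ℝ) ^ 2 ≤ ((u : ℝ) / r) ^ k}ᶜ, fun F hF => ?_, ?_, ?_⟩
  · refine abs_measureReal_sub_le ?_ fun k hk => ?_
    · refine (Set.finite_Iic ⌊2 / b * Real.log n⌋₊).subset fun k hk => ?_
      exact Nat.le_floor (hKlog k (hF hk))
    · have hkn := hKlog k (hF hk)
      rw [tiltedLaw_real_singleton hw0 (hsum hsn), tiltedLaw_real_singleton hw0 hSt]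
      have hpow : (s n : ℝ) ^ k = (t : ℝ) ^ k *
          Real.exp (k * (Real.log (s n) - Real.log t)) := by
        rw [← Real.log_div hsn0.ne' ht'.ne', ← Real.log_pow, Real.exp_log (by positivity), div_pow]
        field_simp
      have hexp : |k * (Real.log (s n) - Real.log t)| ≤ δ n := by
        rw [abs_mul, Nat.abs_cast]
        calc (k : ℝ) * |Real.log (s n) - Real.log t|
            ≤ (2 / b * Real.log n) * |Real.log (s n) - Real.log t| := by gcongr
          _ = δ n := by simp only [δ]; ring
      have hgn : 0 < g n := div_pos hGt hGs
      have h1 : |Real.exp (k * (Real.log (s n) - Real.log t)) * g n - 1| ≤ ε := by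
        rw [abs_le]
        constructor
        · have : Real.exp (-δ n) * g n ≤
              Real.exp (k * (Real.log (s n) - Real.log t)) * g n := by
            gcongr
            exact (abs_le.1 hexp).1
          linarith
        · have : Real.exp (k * (Real.log (s n) - Real.log t)) * g n ≤
              Real.exp (δ n) * g n := by
            gcongr
            exact (abs_le.1 hexp).2
          linarith
      have e : w k * (s n : ℝ) ^ k / genSum w (s n) - w k * (t : ℝ) ^ k / genSum w t =
          (Real.exp (k * (Real.log (s n) - Real.log t)) * g n - 1) *
            (w k * (t : ℝ) ^ k / genSum w t) := by
        rw [hpow]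
        simp only [g]
        field_simp
      rw [e, abs_mul, abs_of_nonneg (show 0 ≤ w k * (t : ℝ) ^ k / genSum w t by positivity)]
      gcongr
  · rw [compl_compl]; exact hcompl _ hsn
  · rw [compl_compl]; exact hcompl _ htr.le

lemma natCast_div_natCast_eq_ofReal (a : ℕ) {n : ℕ} (hn : n ≠ 0) :
    (a : ℝ≥0∞) / n = ENNReal.ofReal ((a : ℝ) / n) := by
  rw [ENNReal.ofReal_div_of_pos (by positivity), ENNReal.ofReal_natCast, ENNReal.ofReal_natCast]

end LargestBoxes

/-! ### From closeness of means to closeness of tilting parameters -/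

section Means

variable {w : ℕ → ℝ≥0} {m : ℕ → ℕ} {S : Set ℕ}

lemma ConfigurationsClose.congr {μ μ' : ℕ → Measure ℕ} (h : ConfigurationsClose w m S μ)
    (heq : ∀ᶠ n in atTop ⊓ 𝓟 S, μ n = μ' n) : ConfigurationsClose w m S μ' := by
  intro C ε hε
  filter_upwards [h C ε hε, heq] with n hn he
  rwa [← he]

/-- By `abs_log_sub_log_le` the difference of logarithms is `O(x n - λ)`, with a uniform constant
because both means are eventually at least `λ/2`. -/
lemma tendsto_log_mul_abs_log_sub (hw0 : 0 < w 0) {l : Filter ℕ} {t : ℝ≥0}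
    {s : ℕ → ℝ≥0} {x : ℕ → ℝ} {lam : ℝ} (hlam : 0 < lam) (ht : 0 < t) (htρ : (t : ℝ≥0∞) < rho w)
    (htm : genMoment w t / genSum w t = lam) (hs : Tendsto s l (𝓝 t))
    (hsm : ∀ᶠ n in l, genMoment w (s n) / genSum w (s n) = x n)
    (hx : (fun n => x n - lam) =o[l] (fun n : ℕ => 1 / Real.log n)) (hx' : Tendsto x l (𝓝 lam)) :
    Tendsto (fun n : ℕ => Real.log n * |Real.log (s n) - Real.log t|) l (𝓝 0) := by
  obtain ⟨r, hr1, hr2⟩ := ENNReal.lt_iff_exists_nnreal_btwn.1 htρ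
  have htr := ENNReal.coe_lt_coe.1 hr1
  have h1 : Tendsto (fun n : ℕ => genSum w r / ((lam / 2) ^ 2 * w 0) *
      |(x n - lam) / (1 / Real.log n)|) l (𝓝 0) := by
    simpa using hx.tendsto_div_nhds_zero.abs.const_mul (genSum w r / ((lam / 2) ^ 2 * w 0))
  refine squeeze_zero' (Eventually.of_forall fun n => by positivity) ?_ h1
  filter_upwards [hsm, hs.eventually_le_const htr, hs.eventually_const_lt ht,
    hx'.eventually_const_le (half_lt_self hlam)] with n hn hsr hs0 hxn
  have h := abs_log_sub_log_le hw0 hs0 ht hsr htr.le hr2 (half_pos hlam) (hn ▸ hxn)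
    (htm ▸ (half_lt_self hlam).le)
  rw [hn, htm] at h
  calc Real.log n * |Real.log (s n) - Real.log t|
      ≤ Real.log n * (genSum w r / ((lam / 2) ^ 2 * w 0) * |x n - lam|) := by gcongr
    _ = _ := by
      rw [div_div_eq_mul_div, div_one, abs_mul, abs_of_nonneg (Real.log_natCast_nonneg n)]
      ring

end Means

end BallsInBoxes

end

/-! ### The theorem -/

theorem mainTheorem8 (w : ℕ → ℝ≥0) (hw0 : 0 < w 0) (hω : omega w = ⊤)
    (m : ℕ → ℕ) (S : Set ℕ) (hZ : ∀ n ∈ S, 0 < partitionFn w (m n) n)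
    (lam : ℝ) (hlam : 0 < lam) (hlamν : ENNReal.ofReal lam ≤ nu w) :
    -- `τ` is the unique element of `[0, ρ]` with `Ψ(τ) = λ`, and it defines a law of `ξ`
    ((∀ t : ℝ≥0∞, (t ≤ rho w ∧ Psi w t = ENNReal.ofReal lam) ↔ t = tau w (ENNReal.ofReal lam)) ∧
      IsProbabilityMeasure (tiltedLaw w (tau w (ENNReal.ofReal lam)))) ∧
    -- `Var ξ < ∞` is automatic when `λ < ν`
    (ENNReal.ofReal lam < nu w →
      evariance (fun k : ℕ => (k : ℝ)) (tiltedLaw w (tau w (ENNReal.ofReal lam))) < ⊤) ∧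
    -- the case `Var ξ < ∞` and `m = λ n + o(√n)`
    (evariance (fun k : ℕ => (k : ℝ)) (tiltedLaw w (tau w (ENNReal.ofReal lam))) < ⊤ →
      (fun n : ℕ => (m n : ℝ) - lam * n) =o[atTop ⊓ 𝓟 S] (fun n : ℕ => √(n : ℝ)) →
      LargestBoxesLikeIID w m S (fun _ => tiltedLaw w (tau w (ENNReal.ofReal lam)))) ∧
    -- the case `λ < ν` and `m / n = λ + o(1 / log n)`
    (ENNReal.ofReal lam < nu w →
      (fun n : ℕ => (m n : ℝ) / n - lam) =o[atTop ⊓ 𝓟 S] (fun n : ℕ => 1 / Real.log n) →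
      LargestBoxesLikeIID w m S (fun _ => tiltedLaw w (tau w (ENNReal.ofReal lam)))) ∧
    -- the case `λ < ν` and `m / n → λ`, with `ξ` replaced by `ξ^(n)`, whose law is defined by
    -- `τ_n` with `Ψ(τ_n) = m / n`
    (ENNReal.ofReal lam < nu w →
      Tendsto (fun n : ℕ => (m n : ℝ) / n) (atTop ⊓ 𝓟 S) (𝓝 lam) →
      (∀ᶠ n : ℕ in atTop ⊓ 𝓟 S,
        (∀ t : ℝ≥0∞, (t ≤ rho w ∧ Psi w t = (m n : ℝ≥0∞) / n) ↔
          t = tau w ((m n : ℝ≥0∞) / n)) ∧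
        IsProbabilityMeasure (tiltedLaw w (tau w ((m n : ℝ≥0∞) / n)))) ∧
      LargestBoxesLikeIID w m S (fun n => tiltedLaw w (tau w ((m n : ℝ≥0∞) / n)))) := by
  obtain ⟨t, ht0, htau, -, htρ, htM, hmean⟩ := exists_tau_eq hw0 hω hlam hlamν
  have hS := summable_of_moment t.coe_nonneg htM
  have hp := isProbabilityMeasure_tiltedLaw hw0 hS
  have htends : ∀ (_ : ENNReal.ofReal lam < nu w)
      (_ : Tendsto (fun n : ℕ => (m n : ℝ) / n) (atTop ⊓ 𝓟 S) (𝓝 lam)),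
      ∃ s : ℕ → ℝ≥0, Tendsto s (atTop ⊓ 𝓟 S) (𝓝 t) ∧
        ConfigurationsClose w m S (fun n => tiltedLaw w (s n)) ∧
        ∀ᶠ n : ℕ in atTop ⊓ 𝓟 S, 0 < (m n : ℝ) / n ∧ ENNReal.ofReal ((m n : ℝ) / n) ≤ nu w ∧
          (s n : ℝ≥0∞) < rho w ∧ tau w (ENNReal.ofReal ((m n : ℝ) / n)) = s n ∧
          genMoment w (s n) / genSum w (s n) = (m n : ℝ) / n := by
    intro hlt hx
    obtain ⟨t', s, -, -, htau', -, hs, hs'⟩ := exists_tendsto_tau hw0 hω hlam hlt hx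
    obtain rfl : t = t' := ENNReal.coe_injective (htau.symm.trans htau')
    exact ⟨s, hs, configurationsClose_of_tendsto hw0 hω hZ ht0 (htρ hlt) hs
      (hs'.mono fun n hn => ⟨hn.2.2.1, hn.2.2.2.1, hn.2.2.2.2.2⟩),
      hs'.mono fun n hn => ⟨hn.1, hn.2.1, hn.2.2.2⟩⟩
  refine ⟨⟨Psi_eq_iff_eq_tau hw0 hω hlam.le hlamν, by rwa [htau]⟩, ?_, ?_, ?_, ?_⟩
  · intro hlt
    rw [htau, evariance_tiltedLaw_lt_top_iff hw0 hS]
    refine ((summable_sq_of_lt_rho (htρ hlt)).div_const (genSum w t)).congr fun k => ?_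
    rw [tiltedLaw_real_singleton hw0 hS]
    ring
  · intro hvar hm
    rw [htau] at hvar ⊢
    exact (configurationsClose_of_evariance hw0 hω hZ ht0 htM hvar (by rwa [hmean])).largestBoxesLikeIID
      hZ (Eventually.of_forall fun _ => hp)
  · intro hlt hx
    have hx' : Tendsto (fun n : ℕ => (m n : ℝ) / n) (atTop ⊓ 𝓟 S) (𝓝 lam) := by
      have h0 : Tendsto (fun n : ℕ => 1 / Real.log n) (atTop ⊓ 𝓟 S) (𝓝 0) :=
        (((Real.tendsto_log_atTop.comp tendsto_natCast_atTop_atTop).const_div_atTop 1)).mono_left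
          inf_le_left
      simpa using (hx.trans_tendsto h0).add_const lam
    obtain ⟨s, hs, hclose, hs'⟩ := htends hlt hx'
    rw [htau]
    exact (hclose.tiltedLaw_limit hw0 ht0 (htρ hlt) hs (tendsto_log_mul_abs_log_sub hw0 hlam
      ht0 (htρ hlt) hmean hs (hs'.mono fun n hn => hn.2.2.2.2) hx hx')).largestBoxesLikeIID
      hZ (Eventually.of_forall fun _ => hp)
  · intro hlt hx
    obtain ⟨s, hs, hclose, hs'⟩ := htends hlt hx
    have hlaw : ∀ᶠ n : ℕ in atTop ⊓ 𝓟 S,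
        (∀ t : ℝ≥0∞, (t ≤ rho w ∧ Psi w t = (m n : ℝ≥0∞) / n) ↔ t = tau w ((m n : ℝ≥0∞) / n)) ∧
        IsProbabilityMeasure (tiltedLaw w (tau w ((m n : ℝ≥0∞) / n))) ∧
        tiltedLaw w (s n) = tiltedLaw w (tau w ((m n : ℝ≥0∞) / n)) := by
      -- `n = 0` is excluded because a quotient by zero is zero in `ℝ` but may be infinite in
      -- `ℝ≥0∞`.
      filter_upwards [hs', mem_inf_of_left (eventually_ge_atTop 1)] with n hn hn1
      rw [natCast_div_natCast_eq_ofReal _ (Nat.one_le_iff_ne_zero.1 hn1), hn.2.2.2.1]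
      refine ⟨fun u => ?_, isProbabilityMeasure_tiltedLaw hw0 (summable_of_lt_rho hn.2.2.1), rfl⟩
      rw [Psi_eq_iff_eq_tau hw0 hω hn.1.le hn.2.1, hn.2.2.2.1]
    exact ⟨hlaw.mono fun n hn => ⟨hn.1, hn.2.1⟩,
      (hclose.congr (hlaw.mono fun n hn => hn.2.2)).largestBoxesLikeIID hZ
        (hlaw.mono fun n hn => hn.2.1)⟩
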